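/- All manifolds are real, finite-dimensional, Hausdorff, without boundary and $C^\infty$; maps, sections and curves are $C^\infty$. Let $\tau:E\to M$ be a Lie algebroid, that is, a vector bundle of finite rank with a Lie bracket $[\![\cdot,\cdot]\!]$ on $\Gamma(E)$ and a vector bundle morphism $\rho:E\to TM$ over $\mathrm{id}_M$ (the anchor) such that $[\![X,fY]\!]=f[\![X,Y]\!]+\rho(X)(f)\,Y$. On any Lie algebroid put $df(X)=\rho(X)(f)$ for functions $f$ and $d\mu(X,Y)=\rho(X)(\mu(Y))-\rho(Y)(\mu(X))-\mu([\![X,Y]\!])$ for sections $\mu$ of the dual bundle. *Prolongations.* For a vector bundle $\pi:N\to M$ let $\mathcal L^{\pi}E\to N$ be the vector bundle with fibre $\{(b,v)\in E_{\pi(w)}\times T_wN:\rho(b)=T_w\pi(v)\}$ at $w$. It is a Lie algebroid with anchor $(b,v)\mapsto v$; if $e_i$ is a local frame of $E$, $X=(\sum_i h_i\,(e_i\circ\pi),X')$ and $Y=(\sum_j s_j\,(e_j\circ\pi),Y')$, with $X',Y'$ vector fields on $N$, then $$[\![X,Y]\!]=\Big(\sum_{i,j}h_is_j\,([\![e_i,e_j]\!]\circ\pi)+\sum_j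 X'(s_j)\,(e_j\circ\pi)-\sum_i Y'(h_i)\,(e_i\circ\pi),\ [X',Y']\Big).$$ Let $\tau^*:E^*\to M$ be the dual bundle. On $\mathcal L^{\tau^*}E$ put $\lambda_E(w)(b,v)=w(b)$ and $\Omega_E=-d\lambda_E$, its canonical symplectic section. *Euler–Lagrange equations.* Let $L:E\to\mathbb R$ be a function (the Lagrangian). For $e\in E_x$, $a\in E_x$ let $e^v_a=\frac{d}{dt}\big|_{0}(a+te)\in T_aE$. On $\mathcal L^{\tau}E$ put $S(b,v)=(0,b^v_a)$ for $(b,v)$ in the fibre at $a$, $\Delta(a)=(0,a^v_a)$, $\theta_L=dL\circ S$, $\omega_L=-d\theta_L$, $E_L=dL(\Delta)-L$. A curve $c:J\to E$ is a solution of the Euler–Lagrange equations for $L$ if for all $t\in J$ one has $(c(t),\dot c(t))\in\mathcal L^{\tau}E$, i.e. $\rho(c(t))=T\tau(\dot c(t))$, and $\omega_L(c(t))\big((c(t),\dot c(t)),\cdot\big)=dE_L(c(t))$. *The map $A_E$.* For a section $\theta$ of $E^*$ let $\hat\theta:E\to\mathbb R$ be the fibrewise linear function it defines. The canonical involution of $\mathcal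 L^\tau E$ sends $(c,u)$ in the fibre at $b\in E_x$ to $(b,\bar u)$ in the fibre at $c\in E_x$, where $\bar u\in T_cE$ is the unique vector with $\bar u(f\circ\tau)=df(x)(b)$ and $\bar u(\hat\theta)=u(\hat\theta)+d\theta(x)(b,c)$ for all functions $f$ on $M$ and sections $\theta$ of $E^*$. Let $T\langle\cdot,\cdot\rangle$ be the derivative of the pairing $E\times_ME^*\to\mathbb R$. The map $A_E:\mathcal L^{\tau^*}E\to(\mathcal L^\tau E)^*$ sends $(b,v)$ to the linear form $(c,u)\mapsto T\langle\cdot,\cdot\rangle(\bar u,v)$ on the fibre of $\mathcal L^\tau E$ at $b$. It is an isomorphism of vector bundles over $E$ if $\mathcal L^{\tau^*}E$ is regarded as a vector bundle over $E$ by $(b,v)\mapsto b$. *Lagrangian submanifolds.* Let $F\to N$, with projection $\pi_F$ and anchor $\rho_F$, be a Lie algebroid with a symplectic section $\Omega$. Its complete lift $\Omega^c$ is the 2-section of $\mathcal L^{\pi_F}F$ determined by $\Omega^c(X^c,Y^c)(p)=\rho_F(p)(\Omega(X,Y))$, $\Omega^c(X^v,Y^c)=\Omega(X,Y)\circ\pi_F$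 and $\Omega^c(X^v,Y^v)=0$ for $X,Y\in\Gamma(F)$. Here $X^v(p)=(0,X(\pi_F p)^v_p)$ and $X^c(p)=(X(\pi_Fp),V)$, where $V\in T_pF$ projects to $\rho_F(X(\pi_F p))$ and satisfies $V(\hat\alpha)=(\mathcal L_X\alpha)(p)$ for all $\alpha\in\Gamma(F^*)$, with $\mathcal L_X\alpha=i_Xd\alpha+d(\alpha(X))$. An embedded submanifold $S$ of the total space $F$ is Lagrangian if $\dim\big(\rho_F(F_{\pi_F(p)})+T\pi_F(T_pS)\big)$ is constant for $p\in S$ and, for every $p\in S$, the space $\{(b,v)\in F_{\pi_F(p)}\times T_pS:\rho_F(b)=T\pi_F(v)\}$ is a Lagrangian subspace (equal to its own orthogonal) of the fibre of $\mathcal L^{\pi_F}F$ at $p$ with respect to $\Omega^c$. **Theorem.** Let $L:E\to\mathbb R$ be a Lagrangian and $S_L=A_E^{-1}(dL(E))\subseteq\mathcal L^{\tau^*}E$, where $dL$ is the differential of $L$ in $\mathcal L^\tau E$. 1. $S_L$ is a Lagrangian submanifold of the symplectic Lie algebroid $(\mathcal L^{\tau^*}E,\Omega_E)$. 2. For every open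 interval $J\subseteq\mathbb R$ there is a bijection $\Psi_L$ from the curves $\gamma:J\to\mathcal L^{\tau^*}E$ with values in $S_L$ onto the curves $c:J\to E$, given by $A_E(\gamma(t))=dL(c(t))$ for all $t\in J$. Call $\gamma=(\gamma_1,\gamma_2)$, with $\gamma_1$ in $E$ and $\gamma_2$ in $TE^*$, admissible if $\gamma_2$ is the tangent lift of its projection to $E^*$. Then $\gamma$ is admissible if and only if $\Psi_L(\gamma)$ is a solution of the Euler–Lagrange equations for $L$. -/

import Mathlib

open Bundle Manifold ContDiff Topology

set_option linter.unusedSectionVars false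

section
variable {EB : Type*} [NormedAddCommGroup EB] [NormedSpace ℝ EB] {H : Type*} [TopologicalSpace H]
  {I : ModelWithCorners ℝ EB H} {B : Type*} [TopologicalSpace B] [ChartedSpace H B]
  {F : Type*} [NormedAddCommGroup F] [NormedSpace ℝ F] {V : B → Type*}
  [TopologicalSpace (TotalSpace F V)] [∀ x, AddCommGroup (V x)] [∀ x, Module ℝ (V x)]
  [∀ x, TopologicalSpace (V x)] [FiberBundle F V] [VectorBundle ℝ F V]
  {FW : Type*} [NormedAddCommGroup FW] [NormedSpace ℝ FW] {W : B → Type*}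
  [TopologicalSpace (TotalSpace FW W)] [∀ x, AddCommGroup (W x)] [∀ x, Module ℝ (W x)]
  [∀ x, TopologicalSpace (W x)] [FiberBundle FW W] [VectorBundle ℝ FW W]

/-- Let `V → B` be a vector bundle with an anchor `ρ : V → TB`, and let `π : W → B` be a vector
bundle.  The fibre at the point `w` of `W` of the prolongation of `V` over `π` is
`{(b, v) | b ∈ V_{π w}, v ∈ T_w W, ρ b = T_w π v}`. -/
noncomputable def prolFiber (ρ : ∀ x, V x →L[ℝ] TangentSpace I x) (w : TotalSpace FW W) :
    Submodule ℝ (V w.proj × TangentSpace (I.prod 𝓘(ℝ, FW)) w) where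
  carrier := {p | ρ w.proj p.1 = mfderiv (I.prod 𝓘(ℝ, FW)) I (π FW W) w p.2}
  zero_mem' := by simp
  add_mem' := by
    intro a b ha hb
    change ρ w.proj (a.1 + b.1) = mfderiv (I.prod 𝓘(ℝ, FW)) I (π FW W) w (a.2 + b.2)
    rw [map_add, map_add, ← show _ = _ from ha, ← show _ = _ from hb]
  smul_mem' := by
    intro c a ha
    change ρ w.proj (c • a.1) = mfderiv (I.prod 𝓘(ℝ, FW)) I (π FW W) w (c • a.2)
    rw [map_smul, map_smul, ← show _ = _ from ha]

theorem mem_prolFiber {ρ : ∀ x, V x →L[ℝ] TangentSpace I x} {w : TotalSpace FW W}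
    {p : V w.proj × TangentSpace (I.prod 𝓘(ℝ, FW)) w} :
    p ∈ prolFiber ρ w ↔ ρ w.proj p.1 = mfderiv (I.prod 𝓘(ℝ, FW)) I (π FW W) w p.2 := Iff.rfl

variable [IsManifold I ∞ B] [ContMDiffVectorBundle ∞ F V I] [ContMDiffVectorBundle ∞ FW W I]

/-- The preferred chart of the total space at `w₀` is defined at `w` if and only if the preferred
trivialization and the preferred chart of the base at `π w₀` are defined at `π w`. -/
theorem mem_chart_source_total (w₀ w : TotalSpace FW W) :
    w ∈ (chartAt (ModelProd H FW) w₀).source ↔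
      w.proj ∈ (trivializationAt FW W w₀.proj).baseSet ∧ w.proj ∈ (chartAt H w₀.proj).source := by
  rw [FiberBundle.chartedSpace_chartAt]
  simp only [mfld_simps, Trivialization.mem_source]
  constructor
  · rintro ⟨h1, h2⟩
    rw [Trivialization.coe_fst' _ h1] at h2
    exact ⟨h1, h2⟩
  · rintro ⟨h1, h2⟩
    rw [Trivialization.coe_fst' _ h1]
    exact ⟨h1, h2⟩

/-- In the preferred charts of the total space and of the base, the tangent map of the bundle
projection is the first projection. -/
theorem clma_mfderiv_proj (w₀ w : TotalSpace FW W) (hw : w ∈ (chartAt (ModelProd H FW) w₀).source)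
    (v : TangentSpace (I.prod 𝓘(ℝ, FW)) w) :
    (trivializationAt EB (TangentSpace I) w₀.proj).continuousLinearMapAt ℝ w.proj
      (mfderiv (I.prod 𝓘(ℝ, FW)) I (π FW W) w v) =
    ((trivializationAt (EB × FW) (TangentSpace (I.prod 𝓘(ℝ, FW))) w₀).continuousLinearMapAt ℝ w
      v).1 := by
  have hp : w.proj ∈ (chartAt H w₀.proj).source := by
    exact ((mem_chart_source_total w₀ w).1 hw).2
  rw [TangentBundle.continuousLinearMapAt_trivializationAt hw,
    TangentBundle.continuousLinearMapAt_trivializationAt hp]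
  have e1 : mfderiv (I.prod 𝓘(ℝ, FW)) 𝓘(ℝ, EB) (extChartAt I w₀.proj ∘ π FW W) w =
      (mfderiv I 𝓘(ℝ, EB) (extChartAt I w₀.proj) w.proj).comp
       (mfderiv (I.prod 𝓘(ℝ, FW)) I (π FW W) w) :=
    mfderiv_comp w (mdifferentiableAt_extChartAt hp) ((contMDiff_proj W (n := ∞)).mdifferentiable (by simp) w)
  have e2 : mfderiv (I.prod 𝓘(ℝ, FW)) 𝓘(ℝ, EB) (Prod.fst ∘ extChartAt (I.prod 𝓘(ℝ, FW)) w₀) w =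
      (mfderiv 𝓘(ℝ, EB × FW) 𝓘(ℝ, EB) (Prod.fst : EB × FW → EB) (extChartAt (I.prod 𝓘(ℝ, FW)) w₀ w)).comp
       (mfderiv (I.prod 𝓘(ℝ, FW)) 𝓘(ℝ, EB × FW) (extChartAt (I.prod 𝓘(ℝ, FW)) w₀) w) :=
    mfderiv_comp w (g := (Prod.fst : EB × FW → EB))
      (differentiable_fst.differentiableAt.mdifferentiableAt) (mdifferentiableAt_extChartAt hw)
  have e3 : (extChartAt I w₀.proj ∘ π FW W) =ᶠ[𝓝 w] (Prod.fst ∘ extChartAt (I.prod 𝓘(ℝ, FW)) w₀) := by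
    filter_upwards [(chartAt (ModelProd H FW) w₀).open_source.mem_nhds hw] with y hy
    change extChartAt I w₀.proj y.proj = (extChartAt (I.prod 𝓘(ℝ, FW)) w₀ y).1
    rw [FiberBundle.extChartAt]
    change _ = extChartAt I w₀.proj (trivializationAt FW W w₀.proj y).1
    rw [Trivialization.coe_fst' _ ((mem_chart_source_total w₀ y).1 hy).1]
  have := DFunLike.congr_fun (e1.symm.trans (e3.mfderiv_eq.trans e2)) v
  rw [mfderiv_eq_fderiv, fderiv_fst] at this
  exact this


variable (FW W)

/-- The prolongation of the vector bundle `V` with anchor `ρ` over the projection of the vector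
bundle `W`, as a family of vector spaces over the total space of `W`.  Below it is made a smooth
vector bundle, with the standard coordinates: the fibre coordinates of `(b, v)` are those of `b` in
a trivialization of `V`, and the vertical components of `v` in a chart of the total space. -/
def Prol (ρ : Cₛ^∞⟮I; F →L[ℝ] EB, fun x => V x →L[ℝ] TangentSpace I x⟯) (w : TotalSpace FW W) :
    Type _ :=
  prolFiber (fun x => ρ x) w

namespace Prol

variable {FW W} (ρ : Cₛ^∞⟮I; F →L[ℝ] EB, fun x => V x →L[ℝ] TangentSpace I x⟯)

noncomputable instance (w : TotalSpace FW W) : AddCommGroup (Prol FW W ρ w) :=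
  inferInstanceAs (AddCommGroup (prolFiber (fun x => ρ x) w))

noncomputable instance (w : TotalSpace FW W) : Module ℝ (Prol FW W ρ w) :=
  inferInstanceAs (Module ℝ (prolFiber (fun x => ρ x) w))

instance (w : TotalSpace FW W) : TopologicalSpace (Prol FW W ρ w) :=
  inferInstanceAs (TopologicalSpace (prolFiber (fun x => ρ x) w))

/-- The anchor read in trivializations around `w₀`. -/
noncomputable def coordAnchor (w₀ w : TotalSpace FW W) : F →L[ℝ] EB :=
  ((trivializationAt EB (TangentSpace I) w₀.proj).continuousLinearMapAt ℝ w.proj).comp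
    ((ρ w.proj).comp ((trivializationAt F V w₀.proj).symmL ℝ w.proj))

variable (H F V) in
/-- The domain of the trivialization of the prolongation around `w₀`. -/
def triBase (w₀ : TotalSpace FW W) : Set (TotalSpace FW W) :=
  (π FW W ⁻¹' (trivializationAt F V w₀.proj).baseSet) ∩ (chartAt (ModelProd H FW) w₀).source

/-- The element of the prolongation at `w` with the coordinates `p`. -/
noncomputable def ofCoord (w₀ w : TotalSpace FW W) (p : F × FW) :
    V w.proj × TangentSpace (I.prod 𝓘(ℝ, FW)) w :=
  ((trivializationAt F V w₀.proj).symmL ℝ w.proj p.1,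
   (trivializationAt (EB × FW) (TangentSpace (I.prod 𝓘(ℝ, FW))) w₀).symmL ℝ w
      (coordAnchor ρ w₀ w p.1, p.2))

/-- The coordinates of an element of the prolongation at `w`. -/
noncomputable def toCoord (w₀ w : TotalSpace FW W)
    (p : V w.proj × TangentSpace (I.prod 𝓘(ℝ, FW)) w) : F × FW :=
  ((trivializationAt F V w₀.proj).continuousLinearMapAt ℝ w.proj p.1,
   ((trivializationAt (EB × FW) (TangentSpace (I.prod 𝓘(ℝ, FW))) w₀).continuousLinearMapAt ℝ w
      p.2).2)

theorem ofCoord_mem (w₀ w : TotalSpace FW W) (hw : w ∈ triBase H F V w₀) (p : F × FW) :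
    ofCoord ρ w₀ w p ∈ prolFiber (fun x => ρ x) w := by
  rw [mem_prolFiber]
  have hp := ((mem_chart_source_total w₀ w).1 hw.2).2
  refine (Trivialization.symmL_continuousLinearMapAt _ hp _).symm.trans
    ((congrArg ((trivializationAt EB (TangentSpace I) w₀.proj).symmL ℝ w.proj) ?_).trans
      (Trivialization.symmL_continuousLinearMapAt _ hp _))
  refine Eq.trans ?_ (clma_mfderiv_proj w₀ w hw.2 (ofCoord ρ w₀ w p).2).symm
  exact (congrArg Prod.fst (Trivialization.continuousLinearMapAt_symmL
    (trivializationAt (EB × FW) (TangentSpace (I.prod 𝓘(ℝ, FW))) w₀) hw.2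
      (coordAnchor ρ w₀ w p.1, p.2))).symm

theorem toCoord_ofCoord (w₀ w : TotalSpace FW W) (hw : w ∈ triBase H F V w₀) (p : F × FW) :
    toCoord w₀ w (ofCoord ρ w₀ w p) = p := by
  refine Prod.ext ?_ ?_
  · exact Trivialization.continuousLinearMapAt_symmL _ hw.1 p.1
  · have h := Trivialization.continuousLinearMapAt_symmL (R := ℝ)
      (trivializationAt (EB × FW) (TangentSpace (I.prod 𝓘(ℝ, FW))) w₀) hw.2
        (coordAnchor ρ w₀ w p.1, p.2)
    exact congrArg (fun q : EB × FW => q.2) h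

theorem coordAnchor_apply (w₀ w : TotalSpace FW W) (hw : w ∈ triBase H F V w₀)
    (p : V w.proj × TangentSpace (I.prod 𝓘(ℝ, FW)) w) (h : p ∈ prolFiber (fun x => ρ x) w) :
    coordAnchor ρ w₀ w
      ((trivializationAt F V w₀.proj).continuousLinearMapAt ℝ w.proj p.1) =
      ((trivializationAt (EB × FW) (TangentSpace (I.prod 𝓘(ℝ, FW))) w₀).continuousLinearMapAt ℝ w
        p.2).1 := by
  rw [mem_prolFiber] at h
  rw [← clma_mfderiv_proj w₀ w hw.2 p.2]
  unfold coordAnchor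
  simp only [ContinuousLinearMap.comp_apply]
  rw [Trivialization.symmL_continuousLinearMapAt _ hw.1]
  exact congrArg _ h

theorem ofCoord_toCoord (w₀ w : TotalSpace FW W) (hw : w ∈ triBase H F V w₀)
    (p : V w.proj × TangentSpace (I.prod 𝓘(ℝ, FW)) w) (h : p ∈ prolFiber (fun x => ρ x) w) :
    ofCoord ρ w₀ w (toCoord w₀ w p) = p := by
  unfold ofCoord toCoord
  dsimp only
  rw [coordAnchor_apply ρ w₀ w hw p h, Trivialization.symmL_continuousLinearMapAt _ hw.1]
  refine Prod.ext rfl ?_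
  exact Trivialization.symmL_continuousLinearMapAt _ hw.2 p.2

variable (H F V) in
theorem isOpen_triBase (w₀ : TotalSpace FW W) : IsOpen (triBase H F V w₀) :=
  ((trivializationAt F V w₀.proj).open_baseSet.preimage
    (FiberBundle.continuous_proj FW W)).inter (chartAt (ModelProd H FW) w₀).open_source

open Classical in
/-- The inverse of the trivialization of the prolongation around `w₀`. -/
noncomputable def pretrivInv (w₀ : TotalSpace FW W) (q : TotalSpace FW W × (F × FW)) :
    TotalSpace (F × FW) (Prol FW W ρ) :=
  if h : q.1 ∈ triBase H F V w₀ then ⟨q.1, ⟨_, ofCoord_mem ρ w₀ q.1 h q.2⟩⟩ else ⟨q.1, 0⟩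

theorem pretrivInv_of_mem (w₀ : TotalSpace FW W) {q : TotalSpace FW W × (F × FW)}
    (h : q.1 ∈ triBase H F V w₀) :
    pretrivInv ρ w₀ q = ⟨q.1, ⟨_, ofCoord_mem ρ w₀ q.1 h q.2⟩⟩ := dif_pos h

/-- The trivialization of the prolongation around `w₀`. -/
noncomputable def pretriv (w₀ : TotalSpace FW W) :
    Pretrivialization (F × FW) (π (F × FW) (Prol FW W ρ)) where
  toFun p := (p.proj, toCoord w₀ p.proj p.2.1)
  invFun := pretrivInv ρ w₀
  source := π (F × FW) (Prol FW W ρ) ⁻¹' triBase H F V w₀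
  target := triBase H F V w₀ ×ˢ Set.univ
  map_source' := fun p h => ⟨h, Set.mem_univ _⟩
  map_target' := fun p h => by
    rw [pretrivInv_of_mem ρ w₀ h.1]
    exact h.1
  left_inv' := fun p h => (pretrivInv_of_mem ρ w₀ (q := (p.proj, toCoord w₀ p.proj p.2.1)) h).trans
    (congrArg (TotalSpace.mk' (F × FW) p.proj)
      (Subtype.ext (ofCoord_toCoord ρ w₀ p.proj h p.2.1 p.2.2)))
  right_inv' := fun p h => by
    rw [pretrivInv_of_mem ρ w₀ h.1]
    exact Prod.ext rfl (toCoord_ofCoord ρ w₀ p.1 h.1 p.2)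
  open_target := (isOpen_triBase H F V w₀).prod isOpen_univ
  baseSet := triBase H F V w₀
  open_baseSet := isOpen_triBase H F V w₀
  source_eq := rfl
  target_eq := rfl
  proj_toFun _ _ := rfl

instance pretriv_isLinear (w₀ : TotalSpace FW W) : (pretriv ρ w₀).IsLinear ℝ where
  linear w _ :=
    { map_add p q := Prod.ext (map_add _ p.1.1 q.1.1) (by
        have h := map_add ((trivializationAt (EB × FW) (TangentSpace
          (I.prod 𝓘(ℝ, FW))) w₀).continuousLinearMapAt ℝ w) p.1.2 q.1.2
        exact congrArg (fun q : EB × FW => q.2) h)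
      map_smul c p := Prod.ext (map_smul _ c p.1.1) (by
        have h := map_smul ((trivializationAt (EB × FW) (TangentSpace
          (I.prod 𝓘(ℝ, FW))) w₀).continuousLinearMapAt ℝ w) c p.1.2
        exact congrArg (fun q : EB × FW => q.2) h) }

theorem mk_pretriv_symm (w₀ w : TotalSpace FW W) (hw : w ∈ triBase H F V w₀) (p : F × FW) :
    TotalSpace.mk' (F × FW) w ((pretriv ρ w₀).symm w p) = ⟨w, ⟨_, ofCoord_mem ρ w₀ w hw p⟩⟩ :=
  (Pretrivialization.mk_symm (pretriv ρ w₀) hw p).trans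
    (pretrivInv_of_mem ρ w₀ (q := (w, p)) hw)

/-- The change of coordinates between two trivializations of the prolongation. -/
noncomputable def coordChange (w₀ w₁ w : TotalSpace FW W) : (F × FW) →L[ℝ] (F × FW) :=
  ((((trivializationAt F V w₀.proj).coordChangeL ℝ (trivializationAt F V w₁.proj) w.proj :
      F ≃L[ℝ] F) : F →L[ℝ] F).comp (ContinuousLinearMap.fst ℝ F FW)).prod
    ((ContinuousLinearMap.snd ℝ EB FW).comp
      ((((trivializationAt (EB × FW) (TangentSpace (I.prod 𝓘(ℝ, FW))) w₀).coordChangeL ℝ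
        (trivializationAt (EB × FW) (TangentSpace (I.prod 𝓘(ℝ, FW))) w₁) w :
          (EB × FW) ≃L[ℝ] (EB × FW)) : (EB × FW) →L[ℝ] (EB × FW)).comp
      (((coordAnchor ρ w₀ w).comp (ContinuousLinearMap.fst ℝ F FW)).prod
        (ContinuousLinearMap.snd ℝ F FW))))

theorem coordChange_apply (w₀ w₁ w : TotalSpace FW W)
    (hw : w ∈ triBase H F V w₀ ∩ triBase H F V w₁) (p : F × FW) :
    coordChange ρ w₀ w₁ w p = toCoord w₁ w (ofCoord ρ w₀ w p) := by
  refine Prod.ext ?_ ?_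
  · change (trivializationAt F V w₀.proj).coordChangeL ℝ (trivializationAt F V w₁.proj) w.proj p.1
      = (trivializationAt F V w₁.proj).continuousLinearMapAt ℝ w.proj
        ((trivializationAt F V w₀.proj).symmL ℝ w.proj p.1)
    rw [Trivialization.coordChangeL_apply _ _ ⟨hw.1.1, hw.2.1⟩]
    rw [Trivialization.continuousLinearMapAt_apply, Trivialization.symmL_apply _ hw.1.1,
      Trivialization.coe_linearMapAt_of_mem _ hw.2.1]
  · have h : (trivializationAt (EB × FW) (TangentSpace (I.prod 𝓘(ℝ, FW))) w₀).coordChangeL ℝ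
        (trivializationAt (EB × FW) (TangentSpace (I.prod 𝓘(ℝ, FW))) w₁) w
          (coordAnchor ρ w₀ w p.1, p.2) =
        (trivializationAt (EB × FW) (TangentSpace (I.prod 𝓘(ℝ, FW))) w₁).continuousLinearMapAt ℝ w
        ((trivializationAt (EB × FW) (TangentSpace (I.prod 𝓘(ℝ, FW))) w₀).symmL ℝ w
          (coordAnchor ρ w₀ w p.1, p.2)) := by
      rw [Trivialization.coordChangeL_apply _ _ ⟨hw.1.2, hw.2.2⟩]
      rw [Trivialization.continuousLinearMapAt_apply, Trivialization.symmL_apply _ hw.1.2,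
        Trivialization.coe_linearMapAt_of_mem _ hw.2.2]
    exact congrArg (fun q : EB × FW => q.2) h

theorem pretriv_coordChange (w₀ w₁ w : TotalSpace FW W)
    (hw : w ∈ triBase H F V w₀ ∩ triBase H F V w₁) (p : F × FW) :
    coordChange ρ w₀ w₁ w p = (pretriv ρ w₁ ⟨w, (pretriv ρ w₀).symm w p⟩).2 := by
  rw [coordChange_apply ρ w₀ w₁ w hw]
  have := congrArg (fun q => (pretriv ρ w₁ q).2) (mk_pretriv_symm ρ w₀ w hw.1 p)
  exact this.symm

theorem contMDiffOn_coordAnchor (w₀ : TotalSpace FW W) :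
    ContMDiffOn (I.prod 𝓘(ℝ, FW)) 𝓘(ℝ, F →L[ℝ] EB) ∞ (coordAnchor ρ w₀)
      (triBase H F V w₀) := by
  have h := (Bundle.Trivialization.contMDiffOn_section_baseSet_iff (IB := I) (n := ∞)
    (s := fun x => ρ x) (trivializationAt (F →L[ℝ] EB)
      (fun x => V x →L[ℝ] TangentSpace I x) w₀.proj)).1 ρ.contMDiff.contMDiffOn
  have h2 := h.comp ((contMDiff_proj W (n := ∞) (IB := I)).contMDiffOn (s := triBase H F V w₀))
    (fun w hw => ⟨hw.1, ((mem_chart_source_total w₀ w).1 hw.2).2⟩)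
  exact h2

/-- Smoothness of a pair of families of linear maps. -/
theorem clm_prod_aux {E₁ E₂ E₃ : Type*} [NormedAddCommGroup E₁] [NormedSpace ℝ E₁]
    [NormedAddCommGroup E₂] [NormedSpace ℝ E₂] [NormedAddCommGroup E₃] [NormedSpace ℝ E₃]
    {f : TotalSpace FW W → E₁ →L[ℝ] E₂} {g : TotalSpace FW W → E₁ →L[ℝ] E₃}
    {s : Set (TotalSpace FW W)}
    (hf : ContMDiffOn (I.prod 𝓘(ℝ, FW)) 𝓘(ℝ, E₁ →L[ℝ] E₂) ∞ f s)
    (hg : ContMDiffOn (I.prod 𝓘(ℝ, FW)) 𝓘(ℝ, E₁ →L[ℝ] E₃) ∞ g s) :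
    ContMDiffOn (I.prod 𝓘(ℝ, FW)) 𝓘(ℝ, E₁ →L[ℝ] (E₂ × E₃)) ∞ (fun w => (f w).prod (g w)) s :=
  (hf.clm_prodMap hg).clm_comp (contMDiffOn_const (c := (ContinuousLinearMap.id ℝ E₁).prod
    (ContinuousLinearMap.id ℝ E₁)))

theorem contMDiffOn_coordChange (w₀ w₁ : TotalSpace FW W) :
    ContMDiffOn (I.prod 𝓘(ℝ, FW)) 𝓘(ℝ, (F × FW) →L[ℝ] (F × FW)) ∞ (coordChange ρ w₀ w₁)
      (triBase H F V w₀ ∩ triBase H F V w₁) := by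
  have h0 := (contMDiffOn_coordAnchor ρ w₀).mono
    (Set.inter_subset_left (s := triBase H F V w₀) (t := triBase H F V w₁))
  have h1 : ContMDiffOn (I.prod 𝓘(ℝ, FW)) 𝓘(ℝ, F →L[ℝ] F) ∞ (fun w : TotalSpace FW W =>
      (((trivializationAt F V w₀.proj).coordChangeL ℝ (trivializationAt F V w₁.proj) w.proj :
      F ≃L[ℝ] F) : F →L[ℝ] F)) (triBase H F V w₀ ∩ triBase H F V w₁) :=
    (contMDiffOn_coordChangeL (IB := I) (n := ∞) (trivializationAt F V w₀.proj)
      (trivializationAt F V w₁.proj)).comp (contMDiff_proj W (n := ∞) (IB := I)).contMDiffOn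
      (fun w hw => ⟨hw.1.1, hw.2.1⟩)
  have h2 : ContMDiffOn (I.prod 𝓘(ℝ, FW)) 𝓘(ℝ, (EB × FW) →L[ℝ] (EB × FW)) ∞
      (fun w : TotalSpace FW W =>
      (((trivializationAt (EB × FW) (TangentSpace (I.prod 𝓘(ℝ, FW))) w₀).coordChangeL ℝ
        (trivializationAt (EB × FW) (TangentSpace (I.prod 𝓘(ℝ, FW))) w₁) w :
          (EB × FW) ≃L[ℝ] (EB × FW)) : (EB × FW) →L[ℝ] (EB × FW)))
      (triBase H F V w₀ ∩ triBase H F V w₁) :=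
    (contMDiffOn_coordChangeL (IB := I.prod 𝓘(ℝ, FW)) (n := ∞) _ _).mono
      (fun w hw => ⟨hw.1.2, hw.2.2⟩)
  exact clm_prod_aux (h1.clm_comp contMDiffOn_const) (contMDiffOn_const.clm_comp
    (h2.clm_comp (clm_prod_aux (h0.clm_comp contMDiffOn_const) contMDiffOn_const)))

variable (FW W) in
/-- The trivializations of the prolongation form a vector bundle atlas. -/
noncomputable def prebundle : VectorPrebundle ℝ (F × FW) (Prol FW W ρ) where
  pretrivializationAtlas := Set.range (pretriv ρ)
  pretrivialization_linear' := by
    rintro _ ⟨w₀, rfl⟩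
    infer_instance
  pretrivializationAt := pretriv ρ
  mem_base_pretrivializationAt w :=
    ⟨mem_baseSet_trivializationAt F V w.proj, mem_chart_source (ModelProd H FW) w⟩
  pretrivialization_mem_atlas w := Set.mem_range_self w
  exists_coordChange := by
    rintro _ ⟨w₀, rfl⟩ _ ⟨w₁, rfl⟩
    exact ⟨coordChange ρ w₀ w₁, (contMDiffOn_coordChange ρ w₀ w₁).continuousOn,
      fun w hw p => pretriv_coordChange ρ w₀ w₁ w hw p⟩
  totalSpaceMk_isInducing := by
    intro w
    have hV := mem_baseSet_trivializationAt F V w.proj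
    have hT := mem_baseSet_trivializationAt (EB × FW)
      (TangentSpace (I.prod 𝓘(ℝ, FW)) : TotalSpace FW W → Type _) w
    let e := ((trivializationAt F V w.proj).continuousLinearEquivAt ℝ w.proj hV).prodCongr
      ((trivializationAt (EB × FW) (TangentSpace (I.prod 𝓘(ℝ, FW))) w).continuousLinearEquivAt
        ℝ w hT)
    let c : F × FW → F × (EB × FW) := fun p => (p.1, (coordAnchor ρ w w p.1, p.2))
    have hc : Continuous c := by fun_prop
    have hind : IsInducing (fun p : Prol FW W ρ w => e p.1) :=
      e.toHomeomorph.isInducing.comp IsInducing.subtypeVal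
    have hcont : Continuous (fun p : Prol FW W ρ w => toCoord (F := F) (V := V) w w p.1) :=
      (((trivializationAt F V w.proj).continuousLinearMapAt ℝ w.proj).continuous.comp
        (continuous_fst.comp continuous_subtype_val)).prodMk
      (continuous_snd.comp (((trivializationAt (EB × FW) (TangentSpace
        (I.prod 𝓘(ℝ, FW))) w).continuousLinearMapAt ℝ w).continuous.comp
        (continuous_snd.comp continuous_subtype_val)))
    have h : IsInducing (fun p : Prol FW W ρ w => toCoord (F := F) (V := V) w w p.1) := by
      refine IsInducing.of_comp hcont hc ?_
      convert hind using 1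
      funext p
      have hw : w ∈ triBase H F V w := ⟨hV, mem_chart_source (ModelProd H FW) w⟩
      refine Prod.ext (congrFun (Trivialization.coe_linearMapAt_of_mem _ hV) p.1.1) ?_
      refine Eq.trans (b := (trivializationAt (EB × FW) (TangentSpace
        (I.prod 𝓘(ℝ, FW))) w).continuousLinearMapAt ℝ w p.1.2)
        (Prod.ext (coordAnchor_apply ρ w w hw p.1 p.2) rfl) ?_
      exact congrFun (Trivialization.coe_linearMapAt_of_mem _ hT) p.1.2
    exact isInducing_const_prod.mpr h

instance prebundle_isContMDiff :
    (prebundle FW W ρ).IsContMDiff (I.prod 𝓘(ℝ, FW)) ∞ where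
  exists_contMDiffCoordChange := by
    rintro _ ⟨w₀, rfl⟩ _ ⟨w₁, rfl⟩
    exact ⟨coordChange ρ w₀ w₁, contMDiffOn_coordChange ρ w₀ w₁,
      fun w hw p => pretriv_coordChange ρ w₀ w₁ w hw p⟩

noncomputable instance : TopologicalSpace (TotalSpace (F × FW) (Prol FW W ρ)) :=
  (prebundle FW W ρ).totalSpaceTopology

noncomputable instance : FiberBundle (F × FW) (Prol FW W ρ) :=
  (prebundle FW W ρ).toFiberBundle

instance : VectorBundle ℝ (F × FW) (Prol FW W ρ) :=
  (prebundle FW W ρ).toVectorBundle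

instance : ContMDiffVectorBundle ∞ (F × FW) (Prol FW W ρ) (I.prod 𝓘(ℝ, FW)) :=
  (prebundle FW W ρ).contMDiffVectorBundle (I.prod 𝓘(ℝ, FW))

end Prol
end

/-- Directional derivative of a vector-valued function on a manifold. -/
noncomputable def dirDeriv {E : Type*} [NormedAddCommGroup E] [NormedSpace ℝ E] {H : Type*}
    [TopologicalSpace H] (J : ModelWithCorners ℝ E H) {N : Type*} [TopologicalSpace N]
    [ChartedSpace H N] {G : Type*} [NormedAddCommGroup G] [NormedSpace ℝ G]
    (f : N → G) (p : N) (v : TangentSpace J p) : G :=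
  mfderiv J 𝓘(ℝ, G) f p v

section
variable {EB : Type*} [NormedAddCommGroup EB] [NormedSpace ℝ EB] {H : Type*} [TopologicalSpace H]
  (I : ModelWithCorners ℝ EB H) {B : Type*} [TopologicalSpace B] [ChartedSpace H B]
  (F : Type*) [NormedAddCommGroup F] [NormedSpace ℝ F] (V : B → Type*)
  [TopologicalSpace (TotalSpace F V)] [∀ x, AddCommGroup (V x)] [∀ x, Module ℝ (V x)]
  [∀ x, TopologicalSpace (V x)] [FiberBundle F V] [VectorBundle ℝ F V]

/-- The fibres of the dual bundle of `V`; the dual bundle has model fibre `F →L[ℝ] ℝ`. -/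
abbrev DualFiber (x : B) : Type _ := V x →L[ℝ] Bundle.Trivial B ℝ x

/-- An anchor and a bracket of sections on a vector bundle, without any law.  This only carries the
data from which differentials and complete lifts are computed; the bracket of two sections that are
smooth near a point is meaningful near that point, its other values are irrelevant. -/
structure RawAlgebroid where
  /-- The anchor, fibrewise. -/
  anchor : ∀ x, V x →L[ℝ] TangentSpace I x
  /-- The bracket of sections. -/
  bracket : (∀ x, V x) → (∀ x, V x) → ∀ x, V x

/-- A Lie algebroid structure on the smooth vector bundle `V` with model fibre `F` over the
manifold `B`: a Lie bracket on the smooth sections and a smooth anchor, with the Leibniz rule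
`⟦X, f Y⟧ = f ⟦X, Y⟧ + ρ(X)(f) Y`. -/
structure LieAlgebroid [IsManifold I ∞ B] where
  /-- The anchor `ρ : E → TM`, a smooth morphism of vector bundles over the identity. -/
  anchor : Cₛ^∞⟮I; F →L[ℝ] EB, fun x => V x →L[ℝ] TangentSpace I x⟯
  /-- The `ℝ`-bilinear bracket of smooth sections. -/
  bracket : Cₛ^∞⟮I; F, V⟯ →ₗ[ℝ] Cₛ^∞⟮I; F, V⟯ →ₗ[ℝ] Cₛ^∞⟮I; F, V⟯
  bracket_self : ∀ X, bracket X X = 0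
  jacobi : ∀ X Y Z, bracket X (bracket Y Z) + bracket Y (bracket Z X) + bracket Z (bracket X Y) = 0
  leibniz : ∀ (f : C^∞⟮I, B; ℝ⟯) (X Y Z : Cₛ^∞⟮I; F, V⟯), (∀ x, Z x = f x • Y x) →
    ∀ x, bracket X Z x = f x • bracket X Y x +
      dirDeriv I f x (anchor x (X x)) • Y x


namespace RawAlgebroid
variable {I V}

/-- The differential of a function: `df(a) = ρ(a)(f)`. -/
noncomputable def d0 (D : RawAlgebroid I V) (f : B → ℝ) (x : B) (a : V x) : ℝ :=
  dirDeriv I f x (D.anchor x a)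

/-- The differential of a section `μ` of the dual bundle,
`dμ(X, Y) = ρ(X)(μ(Y)) - ρ(Y)(μ(X)) - μ(⟦X, Y⟧)`, at the point `x` and on the vectors `a`, `b`,
computed with the sections `X`, `Y` with the values `a`, `b` at `x` that are constant in the
preferred trivialization around `x`. -/
noncomputable def d1 (D : RawAlgebroid I V) (μ : ∀ x, V x → ℝ) (x : B) (a b : V x) : ℝ :=
  D.d0 (fun y => μ y (FiberBundle.extend F b y)) x a
    - D.d0 (fun y => μ y (FiberBundle.extend F a y)) x b
    - μ x (D.bracket (FiberBundle.extend F a) (FiberBundle.extend F b) x)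

end RawAlgebroid

variable {I F V} [IsManifold I ∞ B]

open Classical in
/-- The anchor of a Lie algebroid, and its bracket at `x` for sections that are smooth near `x`:
the bracket of two smooth global sections with the same germs at `x` (on which it does not
depend). -/
noncomputable def LieAlgebroid.raw (A : LieAlgebroid I F V) : RawAlgebroid I V where
  anchor x := A.anchor x
  bracket X Y x :=
    if h : (∃ X' : Cₛ^∞⟮I; F, V⟯, ∀ᶠ y in 𝓝 x, X' y = X y) ∧
        (∃ Y' : Cₛ^∞⟮I; F, V⟯, ∀ᶠ y in 𝓝 x, Y' y = Y y) then
      A.bracket h.1.choose h.2.choose x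
    else 0

/-- The vertical lift to the point `p` of a vector `k` of the same fibre: the velocity at `0` of
`t ↦ p + t k`. -/
noncomputable def vlift (p : TotalSpace F V) (k : V p.proj) :
    TangentSpace (I.prod 𝓘(ℝ, F)) p :=
  mfderiv 𝓘(ℝ, ℝ) (I.prod 𝓘(ℝ, F)) (fun t : ℝ => TotalSpace.mk' F p.proj (p.2 + t • k)) 0 (1 : ℝ)

/-- Vertical lifts are vertical. -/
theorem mfderiv_proj_vlift [ContMDiffVectorBundle ∞ F V I] (p : TotalSpace F V) (k : V p.proj) :
    mfderiv (I.prod 𝓘(ℝ, F)) I (π F V) p (vlift p k) = 0 := by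
  have hγ : MDifferentiableAt 𝓘(ℝ, ℝ) (I.prod 𝓘(ℝ, F))
      (fun t : ℝ => TotalSpace.mk' F p.proj (p.2 + t • k)) 0 := by
    rw [mdifferentiableAt_totalSpace]
    refine ⟨mdifferentiableAt_const, ?_⟩
    have : (fun t : ℝ => (trivializationAt F V p.proj
        (TotalSpace.mk' F p.proj (p.2 + t • k))).2) = fun t : ℝ =>
          (trivializationAt F V p.proj ⟨p.proj, p.2⟩).2 +
            t • (trivializationAt F V p.proj ⟨p.proj, k⟩).2 := by
      funext t
      have hl := (trivializationAt F V p.proj).linear ℝ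
        (mem_baseSet_trivializationAt F V p.proj)
      exact (hl.map_add _ _).trans (congrArg _ (hl.map_smul _ _))
    rw [mdifferentiableAt_iff_differentiableAt]
    change DifferentiableAt ℝ (fun t : ℝ => (trivializationAt F V p.proj
        (TotalSpace.mk' F p.proj (p.2 + t • k))).2) 0
    rw [this]
    fun_prop
  have h0 : (fun t : ℝ => TotalSpace.mk' F p.proj (p.2 + t • k)) 0 = p := by simp
  have h1 := mfderiv_comp_apply_of_eq (I := 𝓘(ℝ, ℝ)) (I' := I.prod 𝓘(ℝ, F)) (I'' := I) (0 : ℝ)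
    (((contMDiff_proj V (n := ∞) (IB := I)).mdifferentiable (by simp)) p) hγ h0 (1 : ℝ)
  refine h1.symm.trans ?_
  have h2 : (π F V ∘ fun t : ℝ => TotalSpace.mk' F p.proj (p.2 + t • k)) = fun _ => p.proj := rfl
  rw [h2, mfderiv_const]
  rfl

namespace Prol

section
variable {FW : Type*} [NormedAddCommGroup FW] [NormedSpace ℝ FW] {W : B → Type*}
  [TopologicalSpace (TotalSpace FW W)] [∀ x, AddCommGroup (W x)] [∀ x, Module ℝ (W x)]
  [∀ x, TopologicalSpace (W x)] [FiberBundle FW W] [VectorBundle ℝ FW W]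
  {ρ : Cₛ^∞⟮I; F →L[ℝ] EB, fun x => V x →L[ℝ] TangentSpace I x⟯} {w : TotalSpace FW W}

/-- The element `(b, v)` of the prolongation. -/
def mk (b : V w.proj) (v : TangentSpace (I.prod 𝓘(ℝ, FW)) w)
    (h : ρ w.proj b = mfderiv (I.prod 𝓘(ℝ, FW)) I (π FW W) w v) : Prol FW W ρ w := ⟨(b, v), h⟩

/-- The component `b` of an element `(b, v)` of the prolongation. -/
def fst (u : Prol FW W ρ w) : V w.proj := u.1.1

/-- The component `v` of an element `(b, v)` of the prolongation. -/
def snd (u : Prol FW W ρ w) : TangentSpace (I.prod 𝓘(ℝ, FW)) w := u.1.2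

/-- The anchor `(b, v) ↦ v` of the prolongation. -/
noncomputable def sndL (w : TotalSpace FW W) :
    Prol FW W ρ w →L[ℝ] TangentSpace (I.prod 𝓘(ℝ, FW)) w :=
  (ContinuousLinearMap.snd ℝ (V w.proj) (TangentSpace (I.prod 𝓘(ℝ, FW)) w)).comp
    (prolFiber (fun x => ρ x) w).subtypeL
end

end Prol

section prolRaw
variable (FW : Type*) [NormedAddCommGroup FW] [NormedSpace ℝ FW] (W : B → Type*)
  [TopologicalSpace (TotalSpace FW W)] [∀ x, AddCommGroup (W x)] [∀ x, Module ℝ (W x)]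
  [∀ x, TopologicalSpace (W x)] [FiberBundle FW W] [VectorBundle ℝ FW W]
  [ContMDiffVectorBundle ∞ FW W I] [ContMDiffVectorBundle ∞ F V I]

/-- The first component of the bracket of two sections `X = (h, X')`, `Y = (s, Y')` of the
prolongation.  In a local frame `e_i` of `V`, with `h = h_i e_i` and `s = s_j e_j`, it is
`h_i s_j ⟦e_i, e_j⟧ + X'(s_j) e_j - Y'(h_i) e_i`; at `w`, the frame is taken constant in the
preferred trivialization around `π w`. -/
noncomputable def LieAlgebroid.prolBracketFst (A : LieAlgebroid I F V)
    (X Y : ∀ w : TotalSpace FW W, Prol FW W A.anchor w) (w : TotalSpace FW W) : V w.proj :=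
  A.raw.bracket (FiberBundle.extend F (X w).fst) (FiberBundle.extend F (Y w).fst) w.proj +
    (trivializationAt F V w.proj).symm w.proj
      (dirDeriv (I.prod 𝓘(ℝ, FW))
          (fun q : TotalSpace FW W => (trivializationAt F V w.proj ⟨q.proj, (Y q).fst⟩).2) w
          (X w).snd -
        dirDeriv (I.prod 𝓘(ℝ, FW))
          (fun q : TotalSpace FW W => (trivializationAt F V w.proj ⟨q.proj, (X q).fst⟩).2) w
          (Y w).snd)

open Classical in
/-- The Lie algebroid structure of the prolongation `{(b, v) | ρ b = Tπ v}` over the projection `π`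
of the vector bundle `W`.  The anchor is `(b, v) ↦ v`; the bracket of `X = (h, X')` and
`Y = (s, Y')` has the first component `prolBracketFst` and the second component `[X', Y']`.  For
sections that are smooth near `w` this pair lies in the prolongation, because `ρ` is compatible
with the brackets; the other case of the definition is only there to have a total function. -/
noncomputable def LieAlgebroid.prol (A : LieAlgebroid I F V) :
    RawAlgebroid (I.prod 𝓘(ℝ, FW)) (Prol FW W A.anchor) where
  anchor w := Prol.sndL w
  bracket X Y w :=
    if h : A.anchor w.proj (A.prolBracketFst FW W X Y w) =
        mfderiv (I.prod 𝓘(ℝ, FW)) I (π FW W) w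
          (VectorField.mlieBracket (I.prod 𝓘(ℝ, FW)) (fun q => (X q).snd)
            (fun q => (Y q).snd) w) then
      Prol.mk _ _ h
    else 0

end prolRaw

section Lagrangian

variable [ContMDiffVectorBundle ∞ F V I]

/-- The vertical endomorphism `S(b, v) = (0, b^v_a)` of the prolongation of `V` over itself. -/
noncomputable def LieAlgebroid.vertEndo (A : LieAlgebroid I F V) (a : TotalSpace F V)
    (u : Prol F V A.anchor a) : Prol F V A.anchor a :=
  Prol.mk 0 (vlift a u.fst) (by rw [mfderiv_proj_vlift, map_zero])

/-- The Liouville section `Δ(a) = (0, a^v_a)`. -/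
noncomputable def LieAlgebroid.liouville (A : LieAlgebroid I F V) (a : TotalSpace F V) :
    Prol F V A.anchor a :=
  Prol.mk 0 (vlift a a.2) (by rw [mfderiv_proj_vlift, map_zero])

/-- The Cartan 1-section `θ_L(a)(u) = dL(a)(S u)`. -/
noncomputable def LieAlgebroid.cartanOne (A : LieAlgebroid I F V) (L : TotalSpace F V → ℝ)
    (a : TotalSpace F V) (u : Prol F V A.anchor a) : ℝ :=
  (A.prol F V).d0 L a (A.vertEndo a u)

/-- The Cartan 2-section `ω_L = -dθ_L`. -/
noncomputable def LieAlgebroid.cartanTwo (A : LieAlgebroid I F V) (L : TotalSpace F V → ℝ)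
    (a : TotalSpace F V) (u u' : Prol F V A.anchor a) : ℝ :=
  -(A.prol F V).d1 (F × F) (A.cartanOne L) a u u'

/-- The Lagrangian energy `E_L = ρ(Δ)(L) - L`. -/
noncomputable def LieAlgebroid.energy (A : LieAlgebroid I F V) (L : TotalSpace F V → ℝ)
    (a : TotalSpace F V) : ℝ :=
  (A.prol F V).d0 L a (A.liouville a) - L a

/-- A curve `c` in the total space is a solution of the Euler-Lagrange equations for `L` if, for all
`t`, the pair `(c t, c' t)` lies in the prolongation (that is, `ρ(c t) = Tπ(c' t)`) and
`ω_L(c t)((c t, c' t), u) = dE_L(c t)(u)` for all `u`. -/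
def LieAlgebroid.IsELSolution (A : LieAlgebroid I F V) (L : TotalSpace F V → ℝ)
    {J : TopologicalSpace.Opens ℝ} (c : J → TotalSpace F V) : Prop :=
  ∀ t : J, ∃ h : A.anchor (c t).proj (c t).2 = mfderiv (I.prod 𝓘(ℝ, F)) I (π F V) (c t)
      (mfderiv 𝓘(ℝ, ℝ) (I.prod 𝓘(ℝ, F)) c t (1 : ℝ)),
    ∀ u : Prol F V A.anchor (c t),
      A.cartanTwo L (c t) (Prol.mk (c t).2 (mfderiv 𝓘(ℝ, ℝ) (I.prod 𝓘(ℝ, F)) c t (1 : ℝ)) h) u =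
        (A.prol F V).d0 (A.energy L) (c t) u

end Lagrangian

section Dual

variable [ContMDiffVectorBundle ∞ F V I]

/-- The Liouville section `λ(w)(b, v) = w(b)` on the prolongation over the dual bundle. -/
noncomputable def LieAlgebroid.liouvilleOne (A : LieAlgebroid I F V)
    (w : TotalSpace (F →L[ℝ] ℝ) (DualFiber V))
    (u : Prol (F →L[ℝ] ℝ) (DualFiber V) A.anchor w) : ℝ :=
  w.2 u.fst

/-- The canonical symplectic section `Ω = -dλ` of the prolongation over the dual bundle. -/
noncomputable def LieAlgebroid.canonicalTwo (A : LieAlgebroid I F V)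
    (w : TotalSpace (F →L[ℝ] ℝ) (DualFiber V))
    (u u' : Prol (F →L[ℝ] ℝ) (DualFiber V) A.anchor w) : ℝ :=
  -(A.prol (F →L[ℝ] ℝ) (DualFiber V)).d1 (F × (F →L[ℝ] ℝ)) A.liouvilleOne w u u'

/-- Let `u = (c, u')` be an element of the prolongation of `V` over itself at `b ∈ V_x`.  The
canonical involution sends it to the element `(b, v)` of the prolongation at `c ∈ V_x`, where `v` is
the tangent vector at `c` with `v(f ∘ π) = df(x)(b)` for functions `f` on the base, and
`v(θ̂) = u'(θ̂) + dθ(x)(b, c)` for sections `θ` of the dual bundle, with `θ̂` the fibrewise linear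
function given by `θ`. -/
def LieAlgebroid.IsInvolutionVec (A : LieAlgebroid I F V) (w : TotalSpace F V)
    (u : Prol F V A.anchor w)
    (v : TangentSpace (I.prod 𝓘(ℝ, F)) (TotalSpace.mk' F w.proj u.fst)) : Prop :=
  (∀ f : B → ℝ, ContMDiffAt I 𝓘(ℝ, ℝ) ∞ f w.proj →
    dirDeriv (I.prod 𝓘(ℝ, F)) (fun q : TotalSpace F V => f q.proj) (TotalSpace.mk' F w.proj u.fst) v
      = A.raw.d0 f w.proj w.2) ∧
  (∀ θ : ∀ y, DualFiber V y,
    ContMDiffAt I (I.prod 𝓘(ℝ, F →L[ℝ] ℝ)) ∞ (fun y => TotalSpace.mk' (F →L[ℝ] ℝ) y (θ y)) w.proj →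
    dirDeriv (I.prod 𝓘(ℝ, F)) (fun q : TotalSpace F V => (θ q.proj q.2 : ℝ))
      (TotalSpace.mk' F w.proj u.fst) v
      = dirDeriv (I.prod 𝓘(ℝ, F)) (fun q : TotalSpace F V => (θ q.proj q.2 : ℝ)) w u.snd +
        A.raw.d1 F (fun y e => θ y e) w.proj w.2 u.fst)

open Classical in
/-- The tangent component of the canonical involution: the unique vector with the properties of
`IsInvolutionVec`. -/
noncomputable def LieAlgebroid.involutionVec (A : LieAlgebroid I F V) (w : TotalSpace F V)
    (u : Prol F V A.anchor w) : TangentSpace (I.prod 𝓘(ℝ, F)) (TotalSpace.mk' F w.proj u.fst) :=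
  if h : ∃ v, A.IsInvolutionVec w u v then h.choose else 0

/-- The function `(e, φ) ↦ φ(e)` on pairs over the same point near `x`, extended to a neighbourhood
of these pairs in the product of the bundle and its dual by a trivialization around `x`. -/
noncomputable def localPairing (x : B)
    (p : TotalSpace F V × TotalSpace (F →L[ℝ] ℝ) (DualFiber V)) : ℝ :=
  p.2.2 ((trivializationAt F V x).symm p.2.proj (trivializationAt F V x p.1).2)

/-- The tangent pairing `T⟨·,·⟩(u, v)` of tangent vectors `u` at `c ∈ V_x` and `v` at `φ ∈ V_x^*`
with the same projection to `T_x B`: the derivative of the pairing along curves of pairs over the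
same point. -/
noncomputable def tangentPairing {x : B} {c : V x} {φ : DualFiber V x}
    (u : TangentSpace (I.prod 𝓘(ℝ, F)) (TotalSpace.mk' F x c))
    (v : TangentSpace (I.prod 𝓘(ℝ, F →L[ℝ] ℝ)) (TotalSpace.mk' (F →L[ℝ] ℝ) x φ)) : ℝ :=
  dirDeriv ((I.prod 𝓘(ℝ, F)).prod (I.prod 𝓘(ℝ, F →L[ℝ] ℝ))) (localPairing x)
    (TotalSpace.mk' F x c, TotalSpace.mk' (F →L[ℝ] ℝ) x φ) (u, v)

/-- The map `A_E`: for `p = (b, v)` in the prolongation over the dual bundle,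
`A_E p` is the linear form `u ↦ T⟨·,·⟩(σ(u), v)` on the fibre at `b` of the prolongation of `V` over
itself, where `σ(u)` is the tangent component of the canonical involution. -/
noncomputable def LieAlgebroid.tulczyjew (A : LieAlgebroid I F V)
    (p : TotalSpace (F × (F →L[ℝ] ℝ)) (Prol (F →L[ℝ] ℝ) (DualFiber V) A.anchor)) :
    Σ a : TotalSpace F V, Prol F V A.anchor a → ℝ :=
  ⟨⟨p.proj.proj, p.2.fst⟩, fun u =>
    tangentPairing (A.involutionVec ⟨p.proj.proj, p.2.fst⟩ u) p.2.snd⟩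

/-- The section `dL` of the dual of the prolongation of `V` over itself. -/
noncomputable def LieAlgebroid.dLagrangian (A : LieAlgebroid I F V) (L : TotalSpace F V → ℝ)
    (a : TotalSpace F V) : Σ a : TotalSpace F V, Prol F V A.anchor a → ℝ :=
  ⟨a, (A.prol F V).d0 L a⟩

/-- The set `S_L = A_E⁻¹(dL(E))`. -/
def LieAlgebroid.lagrangianSet (A : LieAlgebroid I F V) (L : TotalSpace F V → ℝ) :
    Set (TotalSpace (F × (F →L[ℝ] ℝ)) (Prol (F →L[ℝ] ℝ) (DualFiber V) A.anchor)) :=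
  {p | A.tulczyjew p ∈ Set.range (A.dLagrangian L)}

/-- A curve `γ = (γ₁, γ₂)` in the prolongation over the dual bundle is admissible if `γ₂` is the
tangent lift of its projection to the dual bundle. -/
def LieAlgebroid.IsAdmissible (A : LieAlgebroid I F V) {J : TopologicalSpace.Opens ℝ}
    (γ : J → TotalSpace (F × (F →L[ℝ] ℝ)) (Prol (F →L[ℝ] ℝ) (DualFiber V) A.anchor)) : Prop :=
  ∀ t : J, (γ t).2.snd = mfderiv 𝓘(ℝ, ℝ) (I.prod 𝓘(ℝ, F →L[ℝ] ℝ)) (fun s => (γ s).proj) t (1 : ℝ)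

end Dual

section Submanifold

variable {E : Type*} [NormedAddCommGroup E] [NormedSpace ℝ E] {K : Type*} [TopologicalSpace K]
  (J : ModelWithCorners ℝ E K) {N : Type*} [TopologicalSpace N] [ChartedSpace K N]

/-- Embedded submanifolds: locally the zero set of a smooth submersion. -/
def IsEmbeddedSubmanifold (S : Set N) : Prop :=
  ∀ p ∈ S, ∃ (U : Set N) (k : ℕ) (g : N → EuclideanSpace ℝ (Fin k)), IsOpen U ∧ p ∈ U ∧
    ContMDiffOn J 𝓘(ℝ, EuclideanSpace ℝ (Fin k)) ∞ g U ∧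
    (∀ q ∈ U, Function.Surjective (mfderiv J 𝓘(ℝ, EuclideanSpace ℝ (Fin k)) g q)) ∧
    S ∩ U = {q ∈ U | g q = 0}

/-- The tangent space of a submanifold `S` at a point, spanned by the velocities of the smooth curves
in `S`. -/
noncomputable def tangentSubmodule (S : Set N) (p : N) : Submodule ℝ (TangentSpace J p) :=
  Submodule.span ℝ {v | ∃ γ : ℝ → N, ContMDiffAt 𝓘(ℝ, ℝ) J ∞ γ 0 ∧ (∀ᶠ t in 𝓝 0, γ t ∈ S) ∧
    (⟨γ 0, mfderiv 𝓘(ℝ, ℝ) J γ 0 (1 : ℝ)⟩ : TangentBundle J N) = ⟨p, v⟩}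

end Submanifold

section CompleteLift

/-- The vector at `p` of the complete lift of a section `X` that has the value `b` at the base point
of `p` and is constant in the preferred trivialization there: the tangent vector `v` that projects
to `ρ(b)` and satisfies `v(α̂) = (L_X α)(p)` for the sections `α` of the dual bundle, where
`L_X α = i_X dα + d(α(X))`. -/
def RawAlgebroid.IsCompleteLiftVec (D : RawAlgebroid I V) (p : TotalSpace F V) (b : V p.proj)
    (v : TangentSpace (I.prod 𝓘(ℝ, F)) p) : Prop :=
  mfderiv (I.prod 𝓘(ℝ, F)) I (π F V) p v = D.anchor p.proj b ∧
  ∀ α : ∀ y, DualFiber V y,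
    ContMDiffAt I (I.prod 𝓘(ℝ, F →L[ℝ] ℝ)) ∞ (fun y => TotalSpace.mk' (F →L[ℝ] ℝ) y (α y)) p.proj →
    dirDeriv (I.prod 𝓘(ℝ, F)) (fun q : TotalSpace F V => (α q.proj q.2 : ℝ)) p v =
      D.d1 F (fun y e => α y e) p.proj b p.2 +
        D.d0 (fun y => (α y (FiberBundle.extend F b y) : ℝ)) p.proj p.2

open Classical in
/-- For `u = (b, v)` in the prolongation of `V` over itself at `p`: the unique `κ` such that
`v = X^c(p) + κ^v`, where `X` is the section constant in the preferred trivialization with the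
value `b`, and `X^c` is the tangent component of its complete lift. -/
noncomputable def RawAlgebroid.verticalPart (D : RawAlgebroid I V) (p : TotalSpace F V)
    (u : prolFiber (FW := F) (W := V) D.anchor p) : V p.proj :=
  if h : ∃ κ : V p.proj, D.IsCompleteLiftVec p u.1.1 (u.1.2 - vlift p κ) then h.choose else 0

/-- The complete lift `Ω^c` of a 2-section `Ω`, a 2-section of the prolongation of `V` over itself.
It is determined by `Ω^c(X^c, Y^c) = Ω(X, Y)^c`, `Ω^c(X^v, Y^c) = Ω(X, Y)^v` and
`Ω^c(X^v, Y^v) = 0`, with `f^c(p) = ρ(p)(f)` and `f^v = f ∘ π`; here `u` and `u'` are decomposed as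
`X^c + κ^v` and `Y^c + κ'^v`. -/
noncomputable def RawAlgebroid.completeLift (D : RawAlgebroid I V)
    (Ω : ∀ x, V x → V x → ℝ) (p : TotalSpace F V)
    (u u' : prolFiber (FW := F) (W := V) D.anchor p) : ℝ :=
  D.d0 (fun y => Ω y (FiberBundle.extend F u.1.1 y) (FiberBundle.extend F u'.1.1 y)) p.proj p.2 +
    Ω p.proj (D.verticalPart p u) u'.1.1 + Ω p.proj u.1.1 (D.verticalPart p u')

/-- A submanifold `S` of (the total space of) a symplectic Lie algebroid `(V, Ω)` with projection `π`
is Lagrangian if the dimension of `ρ(V_{π p}) + Tπ(T_p S)` is constant along `S` and, for every `p`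
in `S`, the subspace `{(b, v) | v ∈ T_p S}` of the fibre at `p` of the prolongation of `V` over
itself is Lagrangian for `Ω^c`, that is, equal to its own orthogonal. -/
def RawAlgebroid.IsLagrangianSubmanifold (D : RawAlgebroid I V) (Ω : ∀ x, V x → V x → ℝ)
    (S : Set (TotalSpace F V)) : Prop :=
  IsEmbeddedSubmanifold (I.prod 𝓘(ℝ, F)) S ∧
  (∃ r : ℕ, ∀ p ∈ S, Module.finrank ℝ
    (LinearMap.range (D.anchor p.proj).toLinearMap ⊔
      (tangentSubmodule (I.prod 𝓘(ℝ, F)) S p).map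
        (mfderiv (I.prod 𝓘(ℝ, F)) I (π F V) p).toLinearMap : Submodule ℝ (TangentSpace I p.proj)) = r) ∧
  ∀ p ∈ S, ∀ u : prolFiber (FW := F) (W := V) D.anchor p,
    u.1.2 ∈ tangentSubmodule (I.prod 𝓘(ℝ, F)) S p ↔
      ∀ u' : prolFiber (FW := F) (W := V) D.anchor p,
        u'.1.2 ∈ tangentSubmodule (I.prod 𝓘(ℝ, F)) S p → D.completeLift Ω p u u' = 0

end CompleteLift

end

/-!
The proof is a computation in coordinates. Around a point `x₀` of the base, a chart of `B` and a
trivialization of `V` give coordinates `(x, β)` on `V`, `(x, φ)` on the dual bundle, and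
`((x, φ), (β, ζ))` on the prolongation over the dual bundle; here an element `(b, v)` of a
prolongation has as fibre coordinates those of `b` and the vertical coordinates of `v`. In such
coordinates the Lie algebroid is described by its anchor `ρ(x)` and its structure functions `C(x)`:
`⟦h, s⟧ = C(h, s) + Ds(ρ h) - Dh(ρ s)` (`LieAlgebroid.fcoord_raw_bracket`). The Jacobi identity
becomes `LieAlgebroid.structFun_jacobi`, and it forces the anchor to respect brackets
(`LieAlgebroid.anchorFun_structFun`).

With `ℓ` the Lagrangian in coordinates, the formula for the canonical involution
(`LieAlgebroid.dirDeriv_involutionVec`) and that for the tangent pairing (`tangentPairing_eq`) show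
that `S_L` is the set
`φ = ∂ℓ/∂β`, `ζ = ∂ℓ/∂x ∘ ρ + ∂ℓ/∂β ∘ C(β, ·)` (`LieAlgebroid.mem_lagrangianSet_iff_coord`).
It is a graph over `V`, hence an embedded submanifold with a known tangent space
(`LieAlgebroid.mem_tangentSubmodule_iff`), and smooth curves in `S_L` correspond to smooth curves in
`V` (`LieAlgebroid.curveEquiv`).

The complete lift of the canonical symplectic section is computed in
`LieAlgebroid.completeLift_eq`. That it vanishes on pairs of tangent vectors of `S_L` is the identity
`isotropy_identity`, a consequence of the symmetry of the second derivative of `ℓ`, the Jacobi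
identity and the compatibility of the anchor with brackets. Tangent vectors of `S_L` have arbitrary
components `b` and `β'`, and the complete lift against them determines the remaining components
`ξ` and `ζ'`; so nothing else is orthogonal to the tangent space. The sum `ρ(F) + Tπ(T S_L)` is the
whole tangent space of the dual bundle, because `S_L` projects submersively to `B` and the anchor of
the prolongation reaches all vertical vectors.

Finally, a curve in `S_L` over the curve `(x, β)` is admissible if and only if `x' = ρ(β)` and
`(∂ℓ/∂β)' = ∂ℓ/∂x ∘ ρ + ∂ℓ/∂β ∘ C(β, ·)`, and these are the Euler-Lagrange equations by the formulas
for the Cartan 2-section and the energy (`LieAlgebroid.eulerLagrange_iff`).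
-/

/-! ### Coordinates on manifolds -/

section coordinates
variable {E : Type*} [NormedAddCommGroup E] [NormedSpace ℝ E] {K : Type*} [TopologicalSpace K]
  {J : ModelWithCorners ℝ E K} {N : Type*} [TopologicalSpace N] [ChartedSpace K N]
  {G : Type*} [NormedAddCommGroup G] [NormedSpace ℝ G]

/-- The function `κ` is a coordinate system near `p`: it has the germ of a preferred chart. -/
def IsCoordAt (J : ModelWithCorners ℝ E K) (κ : N → E) (p : N) : Prop :=
  ∃ p₀ : N, p ∈ (chartAt K p₀).source ∧ κ =ᶠ[𝓝 p] extChartAt J p₀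

theorem dirDeriv_add (f : N → G) (p : N) (u v : TangentSpace J p) :
    dirDeriv J f p (u + v) = dirDeriv J f p u + dirDeriv J f p v :=
  (mfderiv J 𝓘(ℝ, G) f p).map_add u v

theorem dirDeriv_sub (f : N → G) (p : N) (u v : TangentSpace J p) :
    dirDeriv J f p (u - v) = dirDeriv J f p u - dirDeriv J f p v :=
  (mfderiv J 𝓘(ℝ, G) f p).map_sub u v

theorem dirDeriv_smul (f : N → G) (p : N) (c : ℝ) (v : TangentSpace J p) :
    dirDeriv J f p (c • v) = c • dirDeriv J f p v :=
  (mfderiv J 𝓘(ℝ, G) f p).map_smul c v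

theorem dirDeriv_congr {f g : N → G} {p : N} (h : f =ᶠ[𝓝 p] g) (v : TangentSpace J p) :
    dirDeriv J f p v = dirDeriv J g p v := by
  unfold dirDeriv; rw [h.mfderiv_eq]; rfl

theorem dirDeriv_const (c : G) (p : N) (v : TangentSpace J p) :
    dirDeriv J (fun _ => c) p v = 0 := by
  unfold dirDeriv; rw [mfderiv_const]; rfl

/-- The chain rule for a map into a vector space followed by a differentiable map. -/
theorem dirDeriv_comp_of_differentiableAt {E' : Type*} [NormedAddCommGroup E'] [NormedSpace ℝ E']
    {κ : N → E'} {p : N} (hκ : MDifferentiableAt J 𝓘(ℝ, E') κ p) {f : N → G} {g : E' → G}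
    (hfg : ∀ᶠ q in 𝓝 p, f q = g (κ q)) (hg : DifferentiableAt ℝ g (κ p)) (v : TangentSpace J p) :
    dirDeriv J f p v = fderiv ℝ g (κ p) (dirDeriv J κ p v) := by
  rw [dirDeriv_congr (g := g ∘ κ) hfg]
  have h := mfderiv_comp p hg.mdifferentiableAt hκ
  unfold dirDeriv
  rw [h, mfderiv_eq_fderiv]
  rfl

/-- The chain rule for a vector-valued function along a map of manifolds. -/
theorem dirDeriv_mfderiv {E' : Type*} [NormedAddCommGroup E'] [NormedSpace ℝ E']
    {K' : Type*} [TopologicalSpace K'] {J' : ModelWithCorners ℝ E' K'} {N' : Type*}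
    [TopologicalSpace N'] [ChartedSpace K' N'] {c : N' → N} {t : N'} {f : N → G}
    (hf : MDifferentiableAt J 𝓘(ℝ, G) f (c t)) (hc : MDifferentiableAt J' J c t)
    (v : TangentSpace J' t) :
    dirDeriv J f (c t) (mfderiv J' J c t v) = dirDeriv J' (fun s => f (c s)) t v := by
  have h := mfderiv_comp t hf hc
  unfold dirDeriv
  change _ = mfderiv J' 𝓘(ℝ, G) (f ∘ c) t v
  rw [h]
  rfl

namespace IsCoordAt
variable [IsManifold J ∞ N] {κ : N → E} {p : N}

theorem mdifferentiableAt (h : IsCoordAt J κ p) : MDifferentiableAt J 𝓘(ℝ, E) κ p := by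
  obtain ⟨p₀, hp, he⟩ := h
  have : IsManifold J 1 N := .of_le (n := ∞) (by simp)
  exact (mdifferentiableAt_extChartAt hp).congr_of_eventuallyEq he

theorem contMDiffAt (h : IsCoordAt J κ p) : ContMDiffAt J 𝓘(ℝ, E) ∞ κ p := by
  obtain ⟨p₀, hp, he⟩ := h
  exact (contMDiffAt_extChartAt' hp).congr_of_eventuallyEq he

theorem dirDeriv_eq (h : IsCoordAt J κ p) {f : N → G} {g : E → G}
    (hfg : ∀ᶠ q in 𝓝 p, f q = g (κ q)) (hg : DifferentiableAt ℝ g (κ p)) (v : TangentSpace J p) :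
    dirDeriv J f p v = fderiv ℝ g (κ p) (dirDeriv J κ p v) :=
  dirDeriv_comp_of_differentiableAt h.mdifferentiableAt hfg hg v

theorem bijective (h : IsCoordAt J κ p) : Function.Bijective (dirDeriv J κ p) := by
  obtain ⟨p₀, hp, he⟩ := h
  have : IsManifold J 1 N := .of_le (n := ∞) (by simp)
  have e : dirDeriv J κ p = dirDeriv J (extChartAt J p₀) p := funext fun v => dirDeriv_congr he v
  rw [e]
  obtain ⟨M, hM⟩ := isInvertible_mfderiv_extChartAt (I := J) (x := p₀) (y := p) (by simpa using hp)
  unfold dirDeriv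
  rw [← hM]
  exact M.bijective

theorem dirDeriv_inj (h : IsCoordAt J κ p) {u v : TangentSpace J p} :
    dirDeriv J κ p u = dirDeriv J κ p v ↔ u = v := h.bijective.1.eq_iff

theorem exists_dirDeriv_eq (h : IsCoordAt J κ p) (z : E) : ∃ v : TangentSpace J p,
    dirDeriv J κ p v = z := h.bijective.2 z

section
variable [J.Boundaryless]

/-- A coordinate system has a smooth local inverse. -/
theorem exists_inverse (h : IsCoordAt J κ p) : ∃ σ : E → N, σ (κ p) = p ∧
    ContMDiffAt 𝓘(ℝ, E) J ∞ σ (κ p) ∧ (∀ᶠ q in 𝓝 p, σ (κ q) = q) ∧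
      ∀ᶠ z in 𝓝 (κ p), κ (σ z) = z := by
  obtain ⟨p₀, hp, he⟩ := h
  have hp' : p ∈ (extChartAt J p₀).source := by simpa using hp
  have hκ := he.eq_of_nhds
  have hs : ContMDiffAt 𝓘(ℝ, E) J ∞ (extChartAt J p₀).symm (extChartAt J p₀ p) :=
    (contMDiffOn_extChartAt_symm p₀).contMDiffAt
      ((isOpen_extChartAt_target p₀).mem_nhds ((extChartAt J p₀).map_source hp'))
  refine ⟨(extChartAt J p₀).symm, ?_, ?_, ?_, ?_⟩
  · rw [hκ, (extChartAt J p₀).left_inv hp']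
  · rw [hκ]; exact hs
  · filter_upwards [he, (isOpen_extChartAt_source p₀).mem_nhds hp'] with q h1 h2
    rw [h1, (extChartAt J p₀).left_inv h2]
  · rw [hκ]
    have hc : Filter.Tendsto (extChartAt J p₀).symm (𝓝 (extChartAt J p₀ p)) (𝓝 p) := by
      have := hs.continuousAt.tendsto
      rwa [(extChartAt J p₀).left_inv hp'] at this
    filter_upwards [hc.eventually he, (isOpen_extChartAt_target p₀).mem_nhds
      ((extChartAt J p₀).map_source hp')] with z h1 h2
    rw [h1, (extChartAt J p₀).right_inv h2]

end

end IsCoordAt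

theorem isCoordAt_extChartAt {p₀ p : N} (h : p ∈ (chartAt K p₀).source) :
    IsCoordAt J (extChartAt J p₀) p := ⟨p₀, h, Filter.EventuallyEq.rfl⟩

end coordinates

/-! ### Coordinates on vector bundles -/

section bundle
variable {EB : Type*} [NormedAddCommGroup EB] [NormedSpace ℝ EB] {H : Type*} [TopologicalSpace H]
  {I : ModelWithCorners ℝ EB H} {B : Type*} [TopologicalSpace B] [ChartedSpace H B]
  {F : Type*} [NormedAddCommGroup F] [NormedSpace ℝ F] {V : B → Type*}
  [TopologicalSpace (TotalSpace F V)] [∀ x, AddCommGroup (V x)] [∀ x, Module ℝ (V x)]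
  [∀ x, TopologicalSpace (V x)] [FiberBundle F V] [VectorBundle ℝ F V]

variable (H F V) in
/-- The domain of the preferred chart and of the preferred trivialization around `x₀`. -/
def coordDomain (x₀ : B) : Set B := (trivializationAt F V x₀).baseSet ∩ (chartAt H x₀).source

variable (H F V) in
theorem mem_coordDomain_self (x₀ : B) : x₀ ∈ coordDomain H F V x₀ :=
  ⟨mem_baseSet_trivializationAt F V x₀, mem_chart_source H x₀⟩

variable (H F V) in
theorem isOpen_coordDomain (x₀ : B) : IsOpen (coordDomain H F V x₀) :=
  (trivializationAt F V x₀).open_baseSet.inter (chartAt H x₀).open_source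

/-- The fibre coordinates of a vector in the preferred trivialization around `x₀`. -/
noncomputable def fcoord (F : Type*) [NormedAddCommGroup F] [NormedSpace ℝ F] {V : B → Type*}
    [TopologicalSpace (TotalSpace F V)] [∀ x, AddCommGroup (V x)] [∀ x, Module ℝ (V x)]
    [∀ x, TopologicalSpace (V x)] [FiberBundle F V] [VectorBundle ℝ F V]
    (x₀ : B) {x : B} (b : V x) : F := (trivializationAt F V x₀ ⟨x, b⟩).2

/-- The section with constant coordinates `k` in the preferred trivialization around `x₀`. -/
noncomputable def constSec (F : Type*) [NormedAddCommGroup F] [NormedSpace ℝ F] (V : B → Type*)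
    [TopologicalSpace (TotalSpace F V)] [∀ x, AddCommGroup (V x)] [∀ x, Module ℝ (V x)]
    [∀ x, TopologicalSpace (V x)] [FiberBundle F V] [VectorBundle ℝ F V]
    (x₀ : B) (k : F) (x : B) : V x := (trivializationAt F V x₀).symm x k

variable (I F V) in
/-- The coordinates of a point of the total space in the preferred trivialization and the preferred
chart of the base around `x₀`. -/
noncomputable def tcoord (x₀ : B) (w : TotalSpace F V) : EB × F :=
  (extChartAt I x₀ w.proj, (trivializationAt F V x₀ w).2)

theorem fcoord_constSec {x₀ x : B} (hx : x ∈ (trivializationAt F V x₀).baseSet) (k : F) :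
    fcoord F x₀ (constSec F V x₀ k x) = k := by
  unfold fcoord constSec
  rw [(trivializationAt F V x₀).apply_mk_symm hx]

theorem constSec_fcoord {x₀ x : B} (hx : x ∈ (trivializationAt F V x₀).baseSet) (b : V x) :
    constSec F V x₀ (fcoord F x₀ b) x = b := by
  unfold fcoord constSec
  exact (trivializationAt F V x₀).symm_apply_apply_mk hx b

theorem fcoord_add {x₀ x : B} (hx : x ∈ (trivializationAt F V x₀).baseSet) (b c : V x) :
    fcoord F x₀ (b + c) = fcoord F x₀ b + fcoord F x₀ c :=
  ((trivializationAt F V x₀).linear ℝ hx).map_add b c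

theorem fcoord_smul {x₀ x : B} (hx : x ∈ (trivializationAt F V x₀).baseSet) (r : ℝ) (b : V x) :
    fcoord F x₀ (r • b) = r • fcoord F x₀ b :=
  ((trivializationAt F V x₀).linear ℝ hx).map_smul r b

theorem fcoord_zero {x₀ x : B} (hx : x ∈ (trivializationAt F V x₀).baseSet) :
    fcoord F x₀ (0 : V x) = 0 := by
  have := fcoord_smul hx 0 (0 : V x)
  rwa [zero_smul, zero_smul] at this

theorem fcoord_neg {x₀ x : B} (hx : x ∈ (trivializationAt F V x₀).baseSet) (b : V x) :
    fcoord F x₀ (-b) = -fcoord F x₀ b := by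
  have := fcoord_smul hx (-1) b
  rwa [neg_smul, neg_smul, one_smul, one_smul] at this

theorem fcoord_sum {x₀ x : B} (hx : x ∈ (trivializationAt F V x₀).baseSet) {ι : Type*}
    (s : Finset ι) (b : ι → V x) :
    fcoord F x₀ (∑ i ∈ s, b i) = ∑ i ∈ s, fcoord F x₀ (b i) := by
  classical
  induction s using Finset.induction_on with
  | empty => simp [fcoord_zero hx]
  | insert a s ha ih => rw [Finset.sum_insert ha, Finset.sum_insert ha, fcoord_add hx, ih]

theorem fcoord_inj {x₀ x : B} (hx : x ∈ (trivializationAt F V x₀).baseSet) {b c : V x} :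
    fcoord F x₀ b = fcoord F x₀ c ↔ b = c := by
  refine ⟨fun h => ?_, fun h => by rw [h]⟩
  rw [← constSec_fcoord hx b, h, constSec_fcoord hx]

theorem extend_eq_constSec {x : B} (b : V x) :
    FiberBundle.extend F b = constSec F V x (fcoord F x b) := by
  funext y
  rfl

variable [IsManifold I ∞ B] [ContMDiffVectorBundle ∞ F V I]

theorem tcoord_eventuallyEq {x₀ : B} {w : TotalSpace F V} (hw : w.proj ∈ coordDomain H F V x₀)
    (w₀ : TotalSpace F V) (hw₀ : w₀.proj = x₀) :
    w ∈ (chartAt (ModelProd H F) w₀).source ∧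
    tcoord I F V x₀ =ᶠ[𝓝 w] extChartAt (I.prod 𝓘(ℝ, F)) w₀ := by
  subst hw₀
  have h1 : w ∈ (chartAt (ModelProd H F) w₀).source := (mem_chart_source_total w₀ w).2 hw
  refine ⟨h1, ?_⟩
  filter_upwards [(chartAt (ModelProd H F) w₀).open_source.mem_nhds h1] with y hy
  rw [FiberBundle.extChartAt]
  change (_, _) = (extChartAt I w₀.proj (trivializationAt F V w₀.proj y).1, _)
  rw [Trivialization.coe_fst' _ ((mem_chart_source_total w₀ y).1 hy).1]
  rfl

theorem isCoordAt_tcoord {x₀ : B} {w : TotalSpace F V} (hw : w.proj ∈ coordDomain H F V x₀) :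
    IsCoordAt (I.prod 𝓘(ℝ, F)) (tcoord I F V x₀) w :=
  ⟨⟨x₀, 0⟩, tcoord_eventuallyEq hw ⟨x₀, 0⟩ rfl⟩

theorem mdifferentiableAt_proj (w : TotalSpace F V) :
    MDifferentiableAt (I.prod 𝓘(ℝ, F)) I (π F V) w :=
  ((contMDiff_proj V (n := ∞) (IB := I)).mdifferentiable (by simp)) w

theorem dirDeriv_tcoord_fst {x₀ : B} {w : TotalSpace F V} (hw : w.proj ∈ coordDomain H F V x₀)
    (v : TangentSpace (I.prod 𝓘(ℝ, F)) w) :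
    (dirDeriv (I.prod 𝓘(ℝ, F)) (tcoord I F V x₀) w v).1 =
      dirDeriv I (extChartAt I x₀) w.proj (mfderiv (I.prod 𝓘(ℝ, F)) I (π F V) w v) := by
  have : IsManifold I 1 B := .of_le (n := ∞) (by simp)
  have h1 := dirDeriv_mfderiv (J' := I.prod 𝓘(ℝ, F)) (c := π F V) (t := w)
    (mdifferentiableAt_extChartAt (I := I) hw.2) (mdifferentiableAt_proj w) v
  refine Eq.trans ?_ h1.symm
  have h2 := (isCoordAt_tcoord hw).dirDeriv_eq (g := (Prod.fst : EB × F → EB))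
    (f := fun s : TotalSpace F V => extChartAt I x₀ s.proj)
    (Filter.Eventually.of_forall fun q => rfl) differentiableAt_fst v
  rw [h2, fderiv_fst]
  rfl

theorem eventually_mem_coordDomain {x₀ : B} {w : TotalSpace F V} {F' : Type*}
    [NormedAddCommGroup F'] [NormedSpace ℝ F'] {V' : B → Type*}
    [TopologicalSpace (TotalSpace F' V')] [∀ x, AddCommGroup (V' x)] [∀ x, Module ℝ (V' x)]
    [∀ x, TopologicalSpace (V' x)] [FiberBundle F' V'] [VectorBundle ℝ F' V']
    (hw : w.proj ∈ coordDomain H F' V' x₀) :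
    ∀ᶠ q : TotalSpace F V in 𝓝 w, q.proj ∈ coordDomain H F' V' x₀ :=
  (FiberBundle.continuous_proj F V).continuousAt.eventually
    ((isOpen_coordDomain H F' V' x₀).mem_nhds hw)

theorem mdifferentiableAt_vcurve (p : TotalSpace F V) (k : V p.proj) :
    MDifferentiableAt 𝓘(ℝ, ℝ) (I.prod 𝓘(ℝ, F))
      (fun t : ℝ => TotalSpace.mk' F p.proj (p.2 + t • k)) 0 := by
  rw [mdifferentiableAt_totalSpace]
  refine ⟨mdifferentiableAt_const, ?_⟩
  have : (fun t : ℝ => (trivializationAt F V p.proj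
      (TotalSpace.mk' F p.proj (p.2 + t • k))).2) = fun t : ℝ =>
        fcoord F p.proj p.2 + t • fcoord F p.proj k := by
    funext t
    have hb := mem_baseSet_trivializationAt F V p.proj
    exact (fcoord_add hb _ _).trans (congrArg _ (fcoord_smul hb _ _))
  rw [mdifferentiableAt_iff_differentiableAt]
  change DifferentiableAt ℝ (fun t : ℝ => (trivializationAt F V p.proj
      (TotalSpace.mk' F p.proj (p.2 + t • k))).2) 0
  rw [this]
  fun_prop

theorem dirDeriv_tcoord_vlift {x₀ : B} {p : TotalSpace F V} (hp : p.proj ∈ coordDomain H F V x₀)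
    (k : V p.proj) :
    dirDeriv (I.prod 𝓘(ℝ, F)) (tcoord I F V x₀) p (vlift p k) = (0, fcoord F x₀ k) := by
  have h0 : (fun t : ℝ => TotalSpace.mk' F p.proj (p.2 + t • k)) 0 = p := by simp
  have hκ : MDifferentiableAt (I.prod 𝓘(ℝ, F)) 𝓘(ℝ, EB × F) (tcoord I F V x₀)
    ((fun t : ℝ => TotalSpace.mk' F p.proj (p.2 + t • k)) 0) := by
    rw [h0]; exact (isCoordAt_tcoord hp).mdifferentiableAt
  have h := mfderiv_comp_apply_of_eq (I := 𝓘(ℝ, ℝ)) (I' := I.prod 𝓘(ℝ, F)) (I'' := 𝓘(ℝ, EB × F))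
    (0 : ℝ) (isCoordAt_tcoord hp).mdifferentiableAt (mdifferentiableAt_vcurve p k) h0 (1 : ℝ)
  refine h.symm.trans ?_
  have h2 : (tcoord I F V x₀ ∘ fun t : ℝ => TotalSpace.mk' F p.proj (p.2 + t • k)) =
      fun t : ℝ => (extChartAt I x₀ p.proj, fcoord F x₀ p.2 + t • fcoord F x₀ k) := by
    funext t
    exact Prod.ext rfl ((fcoord_add hp.1 _ _).trans (congrArg _ (fcoord_smul hp.1 _ _)))
  rw [h2, mfderiv_eq_fderiv]
  have h3 : HasDerivAt (fun t : ℝ => (extChartAt I x₀ p.proj,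
      fcoord F x₀ p.2 + t • fcoord F x₀ k)) (0, (1 : ℝ) • fcoord F x₀ k) 0 :=
    (hasDerivAt_const _ _).prodMk (((hasDerivAt_id (0 : ℝ)).smul_const _).const_add _)
  rw [one_smul] at h3
  exact (congrArg (fun M : ℝ →L[ℝ] EB × F => M 1) h3.hasFDerivAt.fderiv).trans
    ((ContinuousLinearMap.toSpanSingleton_apply ℝ _ _).trans (one_smul ℝ _))

end bundle

/-! ### The local bracket of a Lie algebroid -/

section localBracket
variable {EB : Type*} [NormedAddCommGroup EB] [NormedSpace ℝ EB]
  {H : Type*} [TopologicalSpace H]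
  {I : ModelWithCorners ℝ EB H} {B : Type*} [TopologicalSpace B]
  [ChartedSpace H B]
  {F : Type*} [NormedAddCommGroup F] [NormedSpace ℝ F] {V : B → Type*}
  [TopologicalSpace (TotalSpace F V)] [∀ x, AddCommGroup (V x)] [∀ x, Module ℝ (V x)]
  [∀ x, TopologicalSpace (V x)] [FiberBundle F V] [VectorBundle ℝ F V]

variable (I) in
/-- Near `x`, the section `X` has the coordinates `h` in the preferred chart and trivialization
around `x₀`, and `h` is smooth. -/
def IsRep (x₀ x : B) (X : ∀ y, V y) (h : EB → F) : Prop :=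
  (∀ᶠ y in 𝓝 x, fcoord F x₀ (X y) = h (extChartAt I x₀ y)) ∧
    ∀ᶠ z in 𝓝 (extChartAt I x₀ x), ContDiffAt ℝ ∞ h z

theorem eventually_extChartAt {x₀ x : B} (hx : x ∈ (chartAt H x₀).source) {P : EB → Prop}
    (h : ∀ᶠ z in 𝓝 (extChartAt I x₀ x), P z) : ∀ᶠ y in 𝓝 x, P (extChartAt I x₀ y) :=
  (continuousAt_extChartAt' (I := I) (by simpa using hx)).eventually h

theorem IsRep.eventually {x₀ x : B} (hx : x ∈ (chartAt H x₀).source) {X : ∀ y, V y} {h : EB → F}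
    (hX : IsRep I x₀ x X h) : ∀ᶠ y in 𝓝 x, IsRep I x₀ y X h := by
  filter_upwards [hX.1.eventually_nhds, eventually_extChartAt hx hX.2.eventually_nhds] with y h1 h2
  exact ⟨h1, h2⟩

theorem IsRep.self {x₀ x : B} {X : ∀ y, V y} {h : EB → F} (hX : IsRep I x₀ x X h) :
    fcoord F x₀ (X x) = h (extChartAt I x₀ x) := hX.1.self_of_nhds

theorem IsRep.contDiffAt {x₀ x : B} {X : ∀ y, V y} {h : EB → F} (hX : IsRep I x₀ x X h) :
    ContDiffAt ℝ ∞ h (extChartAt I x₀ x) := hX.2.self_of_nhds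

theorem isRep_constSec {x₀ x : B} (hx : x ∈ (trivializationAt F V x₀).baseSet) (k : F) :
    IsRep I x₀ x (constSec F V x₀ k) (fun _ => k) := by
  refine ⟨?_, Filter.Eventually.of_forall fun z => contDiffAt_const⟩
  filter_upwards [(trivializationAt F V x₀).open_baseSet.mem_nhds hx] with y hy
  exact fcoord_constSec hy k

theorem isRep_of_contDiffAt {x₀ x : B} (hx : x ∈ (trivializationAt F V x₀).baseSet) {h : EB → F}
    (hh : ∀ᶠ z in 𝓝 (extChartAt I x₀ x), ContDiffAt ℝ ∞ h z) :
    IsRep I x₀ x (fun y => constSec F V x₀ (h (extChartAt I x₀ y)) y) h := by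
  refine ⟨?_, hh⟩
  filter_upwards [(trivializationAt F V x₀).open_baseSet.mem_nhds hx] with y hy
  exact fcoord_constSec hy _

theorem IsRep.congr {x₀ x : B} {X Y : ∀ y, V y} {h : EB → F} (hX : IsRep I x₀ x X h)
    (hXY : ∀ᶠ y in 𝓝 x, Y y = X y) : IsRep I x₀ x Y h := by
  refine ⟨?_, hX.2⟩
  filter_upwards [hX.1, hXY] with y h1 h2
  rw [h2, h1]

variable [IsManifold I ∞ B] [ContMDiffVectorBundle ∞ F V I]

theorem IsRep.eventually_contMDiffAt {x₀ x : B} (hx : x ∈ coordDomain H F V x₀) {X : ∀ y, V y}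
    {h : EB → F} (hX : IsRep I x₀ x X h) : ∀ᶠ y in 𝓝 x,
      ContMDiffAt I (I.prod 𝓘(ℝ, F)) ∞ (fun y => TotalSpace.mk' F y (X y)) y := by
  filter_upwards [hX.eventually hx.2, (isOpen_coordDomain H F V x₀).mem_nhds hx] with y h1 h2
  rw [(trivializationAt F V x₀).contMDiffAt_section_iff h2.1]
  have h3 : ContMDiffAt I 𝓘(ℝ, F) ∞ (fun y => h (extChartAt I x₀ y)) y :=
    h1.contDiffAt.contMDiffAt.comp y (contMDiffAt_extChartAt' h2.2)
  exact h3.congr_of_eventuallyEq h1.1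

variable [I.Boundaryless]

theorem contDiffAt_comp_extChartAt_symm {G : Type*} [NormedAddCommGroup G] [NormedSpace ℝ G]
    {x₀ x : B} (hx : x ∈ (chartAt H x₀).source) {f : B → G} (hf : ContMDiffAt I 𝓘(ℝ, G) ∞ f x) :
    ContDiffAt ℝ ∞ (fun z => f ((extChartAt I x₀).symm z)) (extChartAt I x₀ x) := by
  have hx' : x ∈ (extChartAt I x₀).source := by simpa using hx
  rw [← contMDiffAt_iff_contDiffAt]
  have hs : ContMDiffAt 𝓘(ℝ, EB) I ∞ (extChartAt I x₀).symm (extChartAt I x₀ x) :=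
    (contMDiffOn_extChartAt_symm x₀).contMDiffAt
      ((isOpen_extChartAt_target x₀).mem_nhds ((extChartAt I x₀).map_source hx'))
  exact ContMDiffAt.comp_of_eq hf hs ((extChartAt I x₀).left_inv hx')

theorem isRep_section {x₀ x : B} (hx : x ∈ coordDomain H F V x₀) (X : Cₛ^∞⟮I; F, V⟯) :
    IsRep I x₀ x X (fun z => fcoord F x₀ (X ((extChartAt I x₀).symm z))) := by
  have h0 : ∀ᶠ y in 𝓝 x, y ∈ coordDomain H F V x₀ := (isOpen_coordDomain H F V x₀).mem_nhds hx
  have hx' : x ∈ (extChartAt I x₀).source := by simpa using hx.2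
  constructor
  · filter_upwards [h0] with y hy
    rw [(extChartAt I x₀).left_inv (by simpa using hy.2)]
  · have h1 : ∀ y ∈ coordDomain H F V x₀, ContDiffAt ℝ ∞
        (fun z => fcoord F x₀ (X ((extChartAt I x₀).symm z))) (extChartAt I x₀ y) := by
      intro y hy
      exact contDiffAt_comp_extChartAt_symm (f := fun y => fcoord F x₀ (X y)) hy.2
        (((trivializationAt F V x₀).contMDiffAt_section_iff hy.1).1 X.contMDiff.contMDiffAt)
    have hc : Filter.Tendsto (extChartAt I x₀).symm (𝓝 (extChartAt I x₀ x)) (𝓝 x) := by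
      have := (continuousAt_extChartAt_symm' (I := I) hx').tendsto
      rwa [(extChartAt I x₀).left_inv hx'] at this
    filter_upwards [hc.eventually h0, (isOpen_extChartAt_target x₀).mem_nhds
      ((extChartAt I x₀).map_source hx')] with z h2 h3
    have := h1 _ h2
    rwa [(extChartAt I x₀).right_inv h3] at this

variable [FiniteDimensional ℝ EB] [T2Space B]

/-- A section that is smooth near `x` has the same germ at `x` as a global smooth section. -/
theorem exists_section_eventuallyEq {x : B} {X : ∀ y, V y}
    (h : ∀ᶠ y in 𝓝 x, ContMDiffAt I (I.prod 𝓘(ℝ, F)) ∞ (fun y => TotalSpace.mk' F y (X y)) y) :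
    ∃ X' : Cₛ^∞⟮I; F, V⟯, ∀ᶠ y in 𝓝 x, X' y = X y := by
  obtain ⟨u, hu, huo, hxu⟩ := eventually_nhds_iff.1 h
  obtain ⟨ψ, -, hψ⟩ := (SmoothBumpFunction.nhds_basis_tsupport (I := I) x).mem_iff.1
    (huo.mem_nhds hxu)
  refine ⟨⟨_, ContMDiffOn.smul_section_of_tsupport (ψ := ψ) ψ.contMDiff.contMDiffOn huo hψ
    (fun y hy => (hu y hy).contMDiffWithinAt)⟩, ?_⟩
  filter_upwards [ψ.eventuallyEq_one] with y hy
  change ψ y • X y = X y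
  rw [hy]
  exact one_smul _ _

theorem IsRep.exists_section {x₀ x : B} (hx : x ∈ coordDomain H F V x₀) {X : ∀ y, V y}
    {h : EB → F} (hX : IsRep I x₀ x X h) :
    ∃ X' : Cₛ^∞⟮I; F, V⟯, ∀ᶠ y in 𝓝 x, X' y = X y :=
  exists_section_eventuallyEq (hX.eventually_contMDiffAt hx)

/-- A function that is smooth near `x` has the same germ at `x` as a global smooth function. -/
theorem exists_function_eventuallyEq {x : B} {f : B → ℝ}
    (h : ∀ᶠ y in 𝓝 x, ContMDiffAt I 𝓘(ℝ, ℝ) ∞ f y) :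
    ∃ f' : C^∞⟮I, B; ℝ⟯, ∀ᶠ y in 𝓝 x, f' y = f y := by
  obtain ⟨u, hu, huo, hxu⟩ := eventually_nhds_iff.1 h
  obtain ⟨ψ, -, hψ⟩ := (SmoothBumpFunction.nhds_basis_tsupport (I := I) x).mem_iff.1
    (huo.mem_nhds hxu)
  refine ⟨⟨fun y => ψ y • f y, contMDiff_of_tsupport fun y hy => ?_⟩, ?_⟩
  · exact ψ.contMDiffAt.smul (hu y (hψ (tsupport_smul_subset_left _ _ hy)))
  filter_upwards [ψ.eventuallyEq_one] with y hy
  change ψ y • f y = f y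
  rw [hy]
  exact one_smul _ _

namespace LieAlgebroid
variable (A : LieAlgebroid I F V)

theorem bracket_swap (X Y : Cₛ^∞⟮I; F, V⟯) : A.bracket X Y = -A.bracket Y X := by
  have h := A.bracket_self (X + Y)
  rw [map_add, map_add, LinearMap.add_apply, LinearMap.add_apply, A.bracket_self,
    A.bracket_self] at h
  rw [zero_add, add_zero] at h
  rw [eq_neg_iff_add_eq_zero, add_comm]
  exact h

theorem bracket_eq_zero_of_eventually {x : B} (X Y : Cₛ^∞⟮I; F, V⟯)
    (h : ∀ᶠ y in 𝓝 x, Y y = 0) : A.bracket X Y x = 0 := by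
  obtain ⟨ψ, -, hψ⟩ := (SmoothBumpFunction.nhds_basis_tsupport (I := I) x).mem_iff.1 h
  let χ : C^∞⟮I, B; ℝ⟯ := ⟨ψ, ψ.contMDiff⟩
  have h0 : ∀ y, (0 : Cₛ^∞⟮I; F, V⟯) y = χ y • Y y := by
    intro y
    change (0 : V y) = ψ y • Y y
    by_cases hy : y ∈ tsupport ψ
    · rw [show Y y = 0 from hψ hy, smul_zero]
    · rw [image_eq_zero_of_notMem_tsupport hy, zero_smul]
  have h1 := A.leibniz χ X Y 0 h0 x
  rw [show Y x = 0 from h.self_of_nhds, smul_zero, add_zero, map_zero] at h1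
  have h2 : χ x = 1 := ψ.eq_one
  rw [h2, one_smul] at h1
  exact h1.symm

/-- The value of the bracket at a point depends only on the germs of the sections there. -/
theorem bracket_congr {x : B} {X X' Y Y' : Cₛ^∞⟮I; F, V⟯} (hX : ∀ᶠ y in 𝓝 x, X y = X' y)
    (hY : ∀ᶠ y in 𝓝 x, Y y = Y' y) : A.bracket X Y x = A.bracket X' Y' x := by
  have h1 : A.bracket X (Y - Y') x = 0 := A.bracket_eq_zero_of_eventually _ _ (by
    filter_upwards [hY] with y hy
    change Y y - Y' y = 0
    rw [hy, sub_self])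
  have h2 : A.bracket Y' (X - X') x = 0 := A.bracket_eq_zero_of_eventually _ _ (by
    filter_upwards [hX] with y hy
    change X y - X' y = 0
    rw [hy, sub_self])
  rw [map_sub] at h1 h2
  have h1' : A.bracket X Y x - A.bracket X Y' x = 0 := h1
  have h2' : A.bracket Y' X x - A.bracket Y' X' x = 0 := h2
  rw [sub_eq_zero] at h1' h2'
  rw [h1', A.bracket_swap X Y', A.bracket_swap X' Y']
  exact congrArg Neg.neg h2'

theorem raw_bracket_eq {x : B} {X Y : ∀ y, V y} {X' Y' : Cₛ^∞⟮I; F, V⟯}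
    (hX : ∀ᶠ y in 𝓝 x, X' y = X y) (hY : ∀ᶠ y in 𝓝 x, Y' y = Y y) :
    A.raw.bracket X Y x = A.bracket X' Y' x := by
  have h : (∃ X' : Cₛ^∞⟮I; F, V⟯, ∀ᶠ y in 𝓝 x, X' y = X y) ∧
    (∃ Y' : Cₛ^∞⟮I; F, V⟯, ∀ᶠ y in 𝓝 x, Y' y = Y y) := ⟨⟨X', hX⟩, ⟨Y', hY⟩⟩
  refine (dif_pos h).trans (A.bracket_congr ?_ ?_)
  · filter_upwards [h.1.choose_spec, hX] with y h1 h2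
    rw [h1, h2]
  · filter_upwards [h.2.choose_spec, hY] with y h1 h2
    rw [h1, h2]

theorem raw_bracket_eventuallyEq {x : B} {X Y : ∀ y, V y} {X' Y' : Cₛ^∞⟮I; F, V⟯}
    (hX : ∀ᶠ y in 𝓝 x, X' y = X y) (hY : ∀ᶠ y in 𝓝 x, Y' y = Y y) :
    ∀ᶠ y in 𝓝 x, A.bracket X' Y' y = A.raw.bracket X Y y := by
  filter_upwards [hX.eventually_nhds, hY.eventually_nhds] with y h1 h2
  exact (A.raw_bracket_eq h1 h2).symm

end LieAlgebroid
end localBracket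

/-! ### Structure functions of a Lie algebroid -/

section structureFunctions
variable {EB : Type*} [NormedAddCommGroup EB] [NormedSpace ℝ EB] [FiniteDimensional ℝ EB]
  {H : Type*} [TopologicalSpace H]
  {I : ModelWithCorners ℝ EB H} [I.Boundaryless] {B : Type*} [TopologicalSpace B] [T2Space B]
  [ChartedSpace H B] [IsManifold I ∞ B]
  {F : Type*} [NormedAddCommGroup F] [NormedSpace ℝ F] [FiniteDimensional ℝ F] {V : B → Type*}
  [TopologicalSpace (TotalSpace F V)] [∀ x, AddCommGroup (V x)] [∀ x, Module ℝ (V x)]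
  [∀ x, TopologicalSpace (V x)] [FiberBundle F V] [VectorBundle ℝ F V]
  [ContMDiffVectorBundle ∞ F V I]

namespace LieAlgebroid
variable (A : LieAlgebroid I F V)

/-- The anchor in the preferred chart and trivialization around `x₀`. -/
noncomputable def anchorFun (x₀ : B) (z : EB) : F →L[ℝ] EB :=
  ((trivializationAt EB (TangentSpace I) x₀).continuousLinearMapAt ℝ
      ((extChartAt I x₀).symm z)).comp
    ((A.anchor ((extChartAt I x₀).symm z)).comp
      ((trivializationAt F V x₀).symmL ℝ ((extChartAt I x₀).symm z)))

/-- The coordinates, in the preferred trivialization around `x₀`, of the bracket of two sections of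
the frame given by a basis of the model fibre. -/
noncomputable def structCoeff (x₀ : B) (i j : Fin (Module.finrank ℝ F)) (x : B) : F :=
  fcoord F x₀ (A.raw.bracket (constSec F V x₀ (Module.finBasis ℝ F i))
    (constSec F V x₀ (Module.finBasis ℝ F j)) x)

/-- The coordinate functionals of the basis of the model fibre. -/
noncomputable def basisCoord (F : Type*) [NormedAddCommGroup F] [NormedSpace ℝ F]
    [FiniteDimensional ℝ F] (i : Fin (Module.finrank ℝ F)) : F →L[ℝ] ℝ :=
  LinearMap.toContinuousLinearMap ((Module.finBasis ℝ F).coord i)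

theorem sum_basisCoord (a : F) : ∑ i, basisCoord F i a • Module.finBasis ℝ F i = a :=
  (Module.finBasis ℝ F).sum_repr a

/-- The structure functions `C` of the Lie algebroid in the preferred chart and trivialization around
`x₀`: the coordinates of the bracket of the sections with the constant coordinates `a` and `b` are
`C a b`. -/
noncomputable def structFun (x₀ : B) (z : EB) : F →L[ℝ] F →L[ℝ] F :=
  ∑ i, ∑ j, (basisCoord F i).smulRight
    ((basisCoord F j).smulRight (A.structCoeff x₀ i j ((extChartAt I x₀).symm z)))

theorem structFun_apply (x₀ : B) (z : EB) (a b : F) : A.structFun x₀ z a b =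
    ∑ i, ∑ j, basisCoord F i a • basisCoord F j b •
      A.structCoeff x₀ i j ((extChartAt I x₀).symm z) := by
  simp [structFun]

/-- The bracket of two sections in coordinates. -/
noncomputable def coordBracket (x₀ : B) (h s : EB → F) (z : EB) : F :=
  A.structFun x₀ z (h z) (s z) + fderiv ℝ s z (A.anchorFun x₀ z (h z)) -
    fderiv ℝ h z (A.anchorFun x₀ z (s z))

theorem dirDeriv_anchor {x₀ x : B} (hx : x ∈ coordDomain H F V x₀) (b : V x) :
    dirDeriv I (extChartAt I x₀) x (A.anchor x b) =
      A.anchorFun x₀ (extChartAt I x₀ x) (fcoord F x₀ b) := by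
  have : IsManifold I 1 B := .of_le (n := ∞) (by simp)
  unfold anchorFun
  rw [(extChartAt I x₀).left_inv (by simpa using hx.2),
    TangentBundle.continuousLinearMapAt_trivializationAt hx.2]
  have hb : (trivializationAt F V x₀).symmL ℝ x (fcoord F x₀ b) = b :=
    (Trivialization.symmL_apply _ hx.1 _).trans (constSec_fcoord hx.1 b)
  exact congrArg (fun c => dirDeriv I (extChartAt I x₀) x (A.anchor x c)) hb.symm

theorem contDiffAt_anchorFun {x₀ x : B} (hx : x ∈ coordDomain H F V x₀) :
    ContDiffAt ℝ ∞ (A.anchorFun x₀) (extChartAt I x₀ x) := by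
  have h := ((Bundle.Trivialization.contMDiffOn_section_baseSet_iff (IB := I) (n := ∞)
    (s := fun x => A.anchor x) (trivializationAt (F →L[ℝ] EB)
      (fun x => V x →L[ℝ] TangentSpace I x) x₀)).1 A.anchor.contMDiff.contMDiffOn).contMDiffAt
    ((trivializationAt (F →L[ℝ] EB) (fun x => V x →L[ℝ] TangentSpace I x)
      x₀).open_baseSet.mem_nhds (x := x) ⟨hx.1, hx.2⟩)
  exact contDiffAt_comp_extChartAt_symm hx.2 h

theorem contMDiffAt_structCoeff {x₀ x : B} (hx : x ∈ coordDomain H F V x₀)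
    (i j : Fin (Module.finrank ℝ F)) :
    ContMDiffAt I 𝓘(ℝ, F) ∞ (A.structCoeff x₀ i j) x := by
  obtain ⟨X, hX⟩ := (isRep_constSec (I := I) hx.1 (Module.finBasis ℝ F i)).exists_section hx
  obtain ⟨Y, hY⟩ := (isRep_constSec (I := I) hx.1 (Module.finBasis ℝ F j)).exists_section hx
  have h := ((trivializationAt F V x₀).contMDiffAt_section_iff (IB := I) hx.1).1
    (A.bracket X Y).contMDiff.contMDiffAt
  refine h.congr_of_eventuallyEq ?_
  filter_upwards [A.raw_bracket_eventuallyEq hX hY] with y hy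
  unfold structCoeff fcoord
  rw [← hy]

theorem contDiffAt_structFun {x₀ x : B} (hx : x ∈ coordDomain H F V x₀) :
    ContDiffAt ℝ ∞ (A.structFun x₀) (extChartAt I x₀ x) := by
  unfold structFun
  refine ContDiffAt.sum fun i _ => ContDiffAt.sum fun j _ => ?_
  have h := contDiffAt_comp_extChartAt_symm hx.2 (A.contMDiffAt_structCoeff hx i j)
  exact (contDiff_const.smulRight (contDiff_const.smulRight contDiff_id)).contDiffAt.comp _ h

/-- A property that holds on the whole coordinate domain holds near each of its points, in
coordinates. -/
theorem _root_.eventually_coord_of_coordDomain {x₀ x : B} (hx : x ∈ coordDomain H F V x₀)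
    {P : EB → Prop} (h : ∀ y ∈ coordDomain H F V x₀, P (extChartAt I x₀ y)) :
    ∀ᶠ z in 𝓝 (extChartAt I x₀ x), P z := by
  have hx' : x ∈ (extChartAt I x₀).source := by simpa using hx.2
  have hc : Filter.Tendsto (extChartAt I x₀).symm (𝓝 (extChartAt I x₀ x)) (𝓝 x) := by
    have := (continuousAt_extChartAt_symm' (I := I) hx').tendsto
    rwa [(extChartAt I x₀).left_inv hx'] at this
  filter_upwards [hc.eventually ((isOpen_coordDomain H F V x₀).mem_nhds hx),
    (isOpen_extChartAt_target x₀).mem_nhds ((extChartAt I x₀).map_source hx')] with z h2 h3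
  have := h _ h2
  rwa [(extChartAt I x₀).right_inv h3] at this

end LieAlgebroid

section bracketFormula
variable {x₀ x : B}

/-- A section that is smooth near `x` is, near `x`, a combination of global sections that are
constant in coordinates near `x`. -/
theorem IsRep.exists_decomposition (hx : x ∈ coordDomain H F V x₀) {X : ∀ y, V y} {h : EB → F}
    (hX : IsRep I x₀ x X h) {e : Fin (Module.finrank ℝ F) → Cₛ^∞⟮I; F, V⟯}
    (he : ∀ i, ∀ᶠ y in 𝓝 x, e i y = constSec F V x₀ (Module.finBasis ℝ F i) y) :
    ∃ (f : Fin (Module.finrank ℝ F) → C^∞⟮I, B; ℝ⟯)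
      (Z : Fin (Module.finrank ℝ F) → Cₛ^∞⟮I; F, V⟯),
      (∀ i, ∀ᶠ y in 𝓝 x, f i y = LieAlgebroid.basisCoord F i (h (extChartAt I x₀ y))) ∧
      (∀ i y, Z i y = f i y • e i y) ∧ ∀ᶠ y in 𝓝 x, (∑ i, Z i) y = X y := by
  have h1 : ∀ i, ∃ f : C^∞⟮I, B; ℝ⟯, ∀ᶠ y in 𝓝 x,
      f y = LieAlgebroid.basisCoord F i (h (extChartAt I x₀ y)) := by
    intro i
    refine exists_function_eventuallyEq ?_
    filter_upwards [hX.eventually hx.2, (isOpen_coordDomain H F V x₀).mem_nhds hx] with y h1 h2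
    have h3 : ContDiffAt ℝ ∞ (fun z => LieAlgebroid.basisCoord F i (h z)) (extChartAt I x₀ y) :=
      (LieAlgebroid.basisCoord F i).contDiff.contDiffAt.comp _ h1.contDiffAt
    exact h3.contMDiffAt.comp y (contMDiffAt_extChartAt' h2.2)
  choose f hf using h1
  refine ⟨f, fun i => ⟨fun y => f i y • e i y, (f i).contMDiff.smul_section (e i).contMDiff⟩, hf,
    fun i y => rfl, ?_⟩
  filter_upwards [Filter.eventually_all.2 hf, Filter.eventually_all.2 he, hX.1,
    (isOpen_coordDomain H F V x₀).mem_nhds hx] with y h1 h2 h3 h4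
  rw [show (∑ i, (⟨fun y => f i y • e i y, (f i).contMDiff.smul_section (e i).contMDiff⟩ :
    Cₛ^∞⟮I; F, V⟯)) y = ∑ i, f i y • e i y by
      rw [← ContMDiffSection.coeAddHom_apply, map_sum, Finset.sum_apply]; rfl]
  rw [← fcoord_inj h4.1, fcoord_sum h4.1, h3, ← LieAlgebroid.sum_basisCoord (h (extChartAt I x₀ y))]
  refine Finset.sum_congr rfl fun i _ => ?_
  rw [fcoord_smul h4.1, h1, h2, fcoord_constSec h4.1]

variable (A : LieAlgebroid I F V)

theorem LieAlgebroid.bracket_sum_right_apply {ι : Type*} [Fintype ι] (X : Cₛ^∞⟮I; F, V⟯)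
    (f : ι → C^∞⟮I, B; ℝ⟯) (e Z : ι → Cₛ^∞⟮I; F, V⟯) (hZ : ∀ i y, Z i y = f i y • e i y) (x : B) :
    A.bracket X (∑ i, Z i) x =
      ∑ i, (f i x • A.bracket X (e i) x + dirDeriv I (f i) x (A.anchor x (X x)) • e i x) := by
  rw [map_sum, ← ContMDiffSection.coeAddHom_apply, map_sum, Finset.sum_apply]
  exact Finset.sum_congr rfl fun i _ => A.leibniz (f i) X (e i) (Z i) (hZ i) x

/-- The local bracket in coordinates: `C(h, s) + Ds(ρ h) - Dh(ρ s)`.  The centre `x₀` of the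
coordinates is arbitrary. -/
theorem LieAlgebroid.fcoord_raw_bracket (hx : x ∈ coordDomain H F V x₀) {X Y : ∀ y, V y}
    {h s : EB → F} (hX : IsRep I x₀ x X h) (hY : IsRep I x₀ x Y s) :
    fcoord F x₀ (A.raw.bracket X Y x) = A.coordBracket x₀ h s (extChartAt I x₀ x) := by
  choose e he using fun i =>
    (isRep_constSec (I := I) hx.1 (Module.finBasis ℝ F i)).exists_section hx
  obtain ⟨f, Z, hf, hZ, hXZ⟩ := hX.exists_decomposition hx he
  obtain ⟨g, T, hg, hT, hYT⟩ := hY.exists_decomposition hx he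
  have hκ := isCoordAt_extChartAt (J := I) hx.2
  have hd : ∀ (k : EB → F) (_ : ContDiffAt ℝ ∞ k (extChartAt I x₀ x))
      (φ : Fin (Module.finrank ℝ F) → C^∞⟮I, B; ℝ⟯) (_ : ∀ i, ∀ᶠ y in 𝓝 x, φ i y =
        LieAlgebroid.basisCoord F i (k (extChartAt I x₀ y))) (i) (b : V x),
      dirDeriv I (φ i) x (A.anchor x b) = LieAlgebroid.basisCoord F i
        (fderiv ℝ k (extChartAt I x₀ x) (A.anchorFun x₀ (extChartAt I x₀ x) (fcoord F x₀ b))) := by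
    intro k hk φ hφ i b
    have hk' := hk.differentiableAt (by simp)
    rw [hκ.dirDeriv_eq (hφ i) ((LieAlgebroid.basisCoord F i).differentiableAt.comp _ hk'),
      A.dirDeriv_anchor hx]
    have := fderiv_comp (extChartAt I x₀ x) (LieAlgebroid.basisCoord F i).differentiableAt hk'
    change fderiv ℝ (LieAlgebroid.basisCoord F i ∘ k) _ _ = _
    rw [this, ContinuousLinearMap.fderiv]
    rfl
  have hex : ∀ i, fcoord F x₀ (e i x) = Module.finBasis ℝ F i := fun i => by
    rw [(he i).self_of_nhds, fcoord_constSec hx.1]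
  have hee : ∀ i j, fcoord F x₀ (A.bracket (e i) (e j) x) = A.structCoeff x₀ i j x := fun i j => by
    unfold LieAlgebroid.structCoeff
    rw [A.raw_bracket_eq (he i) (he j)]
  have hXv : (∑ i, Z i) x = X x := hXZ.self_of_nhds
  have hXe : ∀ j, fcoord F x₀ (A.bracket (∑ i, Z i) (e j) x) =
      ∑ i, LieAlgebroid.basisCoord F i (h (extChartAt I x₀ x)) • A.structCoeff x₀ i j x
        - fderiv ℝ h (extChartAt I x₀ x) (A.anchorFun x₀ (extChartAt I x₀ x)
          (Module.finBasis ℝ F j)) := by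
    intro j
    have h1 : A.bracket (∑ i, Z i) (e j) x = -A.bracket (e j) (∑ i, Z i) x := by
      rw [A.bracket_swap]; rfl
    rw [h1, A.bracket_sum_right_apply _ f e Z hZ, fcoord_neg hx.1, fcoord_sum hx.1]
    have h2 := LieAlgebroid.sum_basisCoord (fderiv ℝ h (extChartAt I x₀ x)
      (A.anchorFun x₀ (extChartAt I x₀ x) (Module.finBasis ℝ F j)))
    rw [← h2, ← Finset.sum_sub_distrib, ← Finset.sum_neg_distrib]
    refine Finset.sum_congr rfl fun i _ => ?_
    rw [fcoord_add hx.1, fcoord_smul hx.1, fcoord_smul hx.1, hd h hX.contDiffAt f hf, hex, hex,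
      (hf i).self_of_nhds, A.bracket_swap]
    change -(_ • fcoord F x₀ (-(A.bracket (e i) (e j) x)) + _) = _
    rw [fcoord_neg hx.1, hee, smul_neg]
    abel
  rw [A.raw_bracket_eq hXZ hYT, A.bracket_sum_right_apply _ g e T hT, fcoord_sum hx.1]
  have h3 : ∀ j, fcoord F x₀ (g j x • A.bracket (∑ i, Z i) (e j) x +
      dirDeriv I (g j) x (A.anchor x ((∑ i, Z i) x)) • e j x) =
      ∑ i, LieAlgebroid.basisCoord F i (h (extChartAt I x₀ x)) •
        LieAlgebroid.basisCoord F j (s (extChartAt I x₀ x)) • A.structCoeff x₀ i j x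
      + LieAlgebroid.basisCoord F j (fderiv ℝ s (extChartAt I x₀ x) (A.anchorFun x₀
        (extChartAt I x₀ x) (h (extChartAt I x₀ x)))) • Module.finBasis ℝ F j
      - LieAlgebroid.basisCoord F j (s (extChartAt I x₀ x)) •
        fderiv ℝ h (extChartAt I x₀ x) (A.anchorFun x₀ (extChartAt I x₀ x)
          (Module.finBasis ℝ F j)) := by
    intro j
    rw [fcoord_add hx.1, fcoord_smul hx.1, fcoord_smul hx.1, hXe, hd s hY.contDiffAt g hg, hXv,
      hX.self, hex, (hg j).self_of_nhds, smul_sub, Finset.smul_sum]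
    rw [Finset.sum_congr rfl fun i _ => smul_comm _ _ _]
    abel
  rw [Finset.sum_congr rfl fun j _ => h3 j, Finset.sum_sub_distrib, Finset.sum_add_distrib,
    LieAlgebroid.sum_basisCoord, Finset.sum_comm]
  unfold LieAlgebroid.coordBracket
  rw [A.structFun_apply, (extChartAt I x₀).left_inv (by simpa using hx.2)]
  congr 1
  have h4 := congrArg (fun c => fderiv ℝ h (extChartAt I x₀ x)
    (A.anchorFun x₀ (extChartAt I x₀ x) c)) (LieAlgebroid.sum_basisCoord (s (extChartAt I x₀ x)))
  refine Eq.trans ?_ h4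
  simp only [map_sum, map_smul]

end bracketFormula
end structureFunctions

/-! ### The structure equations -/

section structureEquations
variable {EB : Type*} [NormedAddCommGroup EB] [NormedSpace ℝ EB] [FiniteDimensional ℝ EB]
  {H : Type*} [TopologicalSpace H]
  {I : ModelWithCorners ℝ EB H} [I.Boundaryless] {B : Type*} [TopologicalSpace B] [T2Space B]
  [ChartedSpace H B] [IsManifold I ∞ B]
  {F : Type*} [NormedAddCommGroup F] [NormedSpace ℝ F] [FiniteDimensional ℝ F] {V : B → Type*}
  [TopologicalSpace (TotalSpace F V)] [∀ x, AddCommGroup (V x)] [∀ x, Module ℝ (V x)]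
  [∀ x, TopologicalSpace (V x)] [FiberBundle F V] [VectorBundle ℝ F V]
  [ContMDiffVectorBundle ∞ F V I]

namespace LieAlgebroid
variable (A : LieAlgebroid I F V) {x₀ x : B}

theorem contDiffAt_coordBracket (hx : x ∈ coordDomain H F V x₀) {h s : EB → F}
    (hh : ContDiffAt ℝ ∞ h (extChartAt I x₀ x)) (hs : ContDiffAt ℝ ∞ s (extChartAt I x₀ x)) :
    ContDiffAt ℝ ∞ (A.coordBracket x₀ h s) (extChartAt I x₀ x) := by
  have h1 := A.contDiffAt_structFun hx
  have h2 := A.contDiffAt_anchorFun hx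
  have h3 : ContDiffAt ℝ ∞ (fderiv ℝ h) (extChartAt I x₀ x) := hh.fderiv_right (m := ∞) (by simp)
  have h4 : ContDiffAt ℝ ∞ (fderiv ℝ s) (extChartAt I x₀ x) := hs.fderiv_right (m := ∞) (by simp)
  exact (((h1.clm_apply hh).clm_apply hs).add (h4.clm_apply (h2.clm_apply hh))).sub
    (h3.clm_apply (h2.clm_apply hs))

theorem _root_.IsRep.bracket (hx : x ∈ coordDomain H F V x₀) {X Y : ∀ y, V y} {h s : EB → F}
    (hX : IsRep I x₀ x X h) (hY : IsRep I x₀ x Y s) :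
    IsRep I x₀ x (A.raw.bracket X Y) (A.coordBracket x₀ h s) := by
  constructor
  · filter_upwards [hX.eventually hx.2, hY.eventually hx.2,
      (isOpen_coordDomain H F V x₀).mem_nhds hx] with y h1 h2 h3
    exact A.fcoord_raw_bracket h3 h1 h2
  · filter_upwards [hX.2, hY.2, eventually_coord_of_coordDomain (I := I) hx (P := fun z =>
      ∃ y ∈ coordDomain H F V x₀, z = extChartAt I x₀ y) fun y hy => ⟨y, hy, rfl⟩] with z h1 h2 h3
    obtain ⟨y, hy, rfl⟩ := h3
    exact A.contDiffAt_coordBracket hy h1 h2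

theorem coordBracket_swap (hx : x ∈ coordDomain H F V x₀) {h s : EB → F}
    (hh : ∀ᶠ z in 𝓝 (extChartAt I x₀ x), ContDiffAt ℝ ∞ h z)
    (hs : ∀ᶠ z in 𝓝 (extChartAt I x₀ x), ContDiffAt ℝ ∞ s z) :
    A.coordBracket x₀ h s (extChartAt I x₀ x) = -A.coordBracket x₀ s h (extChartAt I x₀ x) := by
  have hX := isRep_of_contDiffAt (V := V) hx.1 hh
  have hY := isRep_of_contDiffAt (V := V) hx.1 hs
  rw [← A.fcoord_raw_bracket hx hX hY, ← A.fcoord_raw_bracket hx hY hX, ← fcoord_neg hx.1]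
  obtain ⟨X', hX'⟩ := hX.exists_section hx
  obtain ⟨Y', hY'⟩ := hY.exists_section hx
  rw [A.raw_bracket_eq hX' hY', A.raw_bracket_eq hY' hX', A.bracket_swap]
  rfl

/-- The Jacobi identity for the bracket in coordinates. -/
theorem coordBracket_jacobi (hx : x ∈ coordDomain H F V x₀) {h s r : EB → F}
    (hh : ∀ᶠ z in 𝓝 (extChartAt I x₀ x), ContDiffAt ℝ ∞ h z)
    (hs : ∀ᶠ z in 𝓝 (extChartAt I x₀ x), ContDiffAt ℝ ∞ s z)
    (hr : ∀ᶠ z in 𝓝 (extChartAt I x₀ x), ContDiffAt ℝ ∞ r z) :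
    A.coordBracket x₀ h (A.coordBracket x₀ s r) (extChartAt I x₀ x) +
    A.coordBracket x₀ s (A.coordBracket x₀ r h) (extChartAt I x₀ x) +
    A.coordBracket x₀ r (A.coordBracket x₀ h s) (extChartAt I x₀ x) = 0 := by
  have hX := isRep_of_contDiffAt (V := V) hx.1 hh
  have hY := isRep_of_contDiffAt (V := V) hx.1 hs
  have hZ := isRep_of_contDiffAt (V := V) hx.1 hr
  rw [← A.fcoord_raw_bracket hx hX (hY.bracket A hx hZ),
    ← A.fcoord_raw_bracket hx hY (hZ.bracket A hx hX),
    ← A.fcoord_raw_bracket hx hZ (hX.bracket A hx hY), ← fcoord_add hx.1, ← fcoord_add hx.1]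
  obtain ⟨X', hX'⟩ := hX.exists_section hx
  obtain ⟨Y', hY'⟩ := hY.exists_section hx
  obtain ⟨Z', hZ'⟩ := hZ.exists_section hx
  rw [A.raw_bracket_eq hX' (A.raw_bracket_eventuallyEq hY' hZ'),
    A.raw_bracket_eq hY' (A.raw_bracket_eventuallyEq hZ' hX'),
    A.raw_bracket_eq hZ' (A.raw_bracket_eventuallyEq hX' hY')]
  have := congrArg (fun S : Cₛ^∞⟮I; F, V⟯ => S x) (A.jacobi X' Y' Z')
  refine (congrArg (fcoord F x₀) this).trans (fcoord_zero hx.1)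

theorem coordBracket_const_left (x₀ : B) (a : F) (s : EB → F) (z : EB) :
    A.coordBracket x₀ (fun _ => a) s z =
      A.structFun x₀ z a (s z) + fderiv ℝ s z (A.anchorFun x₀ z a) := by
  simp [coordBracket]

theorem coordBracket_const_const (x₀ : B) (a b : F) :
    A.coordBracket x₀ (fun _ => a) (fun _ => b) = fun z => A.structFun x₀ z a b := by
  funext z
  simp [coordBracket]

theorem structFun_swap (hx : x ∈ coordDomain H F V x₀) (a b : F) :
    A.structFun x₀ (extChartAt I x₀ x) a b = -A.structFun x₀ (extChartAt I x₀ x) b a := by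
  have h := A.coordBracket_swap hx (h := fun _ => a) (s := fun _ => b)
    (Filter.Eventually.of_forall fun z => contDiffAt_const)
    (Filter.Eventually.of_forall fun z => contDiffAt_const)
  rwa [coordBracket_const_const, coordBracket_const_const] at h

theorem hasFDerivAt_structFun (hx : x ∈ coordDomain H F V x₀) :
    HasFDerivAt (A.structFun x₀) (fderiv ℝ (A.structFun x₀) (extChartAt I x₀ x))
      (extChartAt I x₀ x) :=
  ((A.contDiffAt_structFun hx).differentiableAt (by simp)).hasFDerivAt

theorem hasFDerivAt_anchorFun (hx : x ∈ coordDomain H F V x₀) :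
    HasFDerivAt (A.anchorFun x₀) (fderiv ℝ (A.anchorFun x₀) (extChartAt I x₀ x))
      (extChartAt I x₀ x) :=
  ((A.contDiffAt_anchorFun hx).differentiableAt (by simp)).hasFDerivAt

set_option synthInstance.maxHeartbeats 200000 in
theorem fderiv_structFun_apply (hx : x ∈ coordDomain H F V x₀) (a b : F) (v : EB) :
    fderiv ℝ (fun z => A.structFun x₀ z a b) (extChartAt I x₀ x) v =
      fderiv ℝ (A.structFun x₀) (extChartAt I x₀ x) v a b := by
  have h := ((A.hasFDerivAt_structFun hx).clm_apply (hasFDerivAt_const a _)).clm_apply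
    (hasFDerivAt_const b _)
  rw [h.fderiv]
  simp

theorem fderiv_structFun_swap (hx : x ∈ coordDomain H F V x₀) (v : EB) (a b : F) :
    fderiv ℝ (A.structFun x₀) (extChartAt I x₀ x) v a b =
      -fderiv ℝ (A.structFun x₀) (extChartAt I x₀ x) v b a := by
  rw [← A.fderiv_structFun_apply hx, ← A.fderiv_structFun_apply hx, ← neg_apply, ← fderiv_fun_neg]
  congr 1
  exact Filter.EventuallyEq.fderiv_eq
    (eventually_coord_of_coordDomain hx fun y hy => A.structFun_swap hy a b)

/-- The structure equation for the bracket, which is the Jacobi identity in coordinates. -/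
theorem structFun_jacobi (hx : x ∈ coordDomain H F V x₀) (a b c : F) :
    let z := extChartAt I x₀ x
    let C := A.structFun x₀ z
    let ρ := A.anchorFun x₀ z
    let C' := fderiv ℝ (A.structFun x₀) z
    C a (C b c) + C' (ρ a) b c + (C b (C c a) + C' (ρ b) c a) + (C c (C a b) + C' (ρ c) a b) = 0 := by
  have h := A.coordBracket_jacobi hx (h := fun _ => a) (s := fun _ => b) (r := fun _ => c)
    (Filter.Eventually.of_forall fun z => contDiffAt_const)
    (Filter.Eventually.of_forall fun z => contDiffAt_const)
    (Filter.Eventually.of_forall fun z => contDiffAt_const)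
  rw [coordBracket_const_const, coordBracket_const_const, coordBracket_const_const] at h
  simp only [coordBracket_const_left, A.fderiv_structFun_apply hx] at h
  exact h

set_option synthInstance.maxHeartbeats 200000 in
/-- The anchor is compatible with the brackets.  This follows from the Jacobi identity for
`a`, `b` and `f c`, where `f` is a function that vanishes at the point. -/
theorem anchorFun_structFun (hx : x ∈ coordDomain H F V x₀) (a b : F) :
    let z := extChartAt I x₀ x
    let ρ' := fderiv ℝ (A.anchorFun x₀) z
    A.anchorFun x₀ z (A.structFun x₀ z a b) =
      ρ' (A.anchorFun x₀ z a) b - ρ' (A.anchorFun x₀ z b) a := by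
  intro z ρ'
  rcases subsingleton_or_nontrivial F with hF | hF
  · rw [Subsingleton.elim a 0, Subsingleton.elim b 0]; simp
  obtain ⟨c, hc⟩ := exists_ne (0 : F)
  rw [← sub_eq_zero]
  refine SeparatingDual.eq_zero_of_forall_dual_eq_zero (R := ℝ) fun l => ?_
  let r : EB → F := fun y => l (y - z) • c
  have hr : ∀ y, HasFDerivAt r (l.smulRight c) y := fun y =>
    (l.hasFDerivAt.comp y ((hasFDerivAt_id y).sub_const z)).smul_const c
  have hr0 : r z = 0 := by simp [r]
  have hrs : ∀ᶠ y in 𝓝 z, ContDiffAt ℝ ∞ r y := Filter.Eventually.of_forall fun y =>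
    ((l.contDiff.comp (contDiff_id.sub contDiff_const)).smul contDiff_const).contDiffAt
  have hcst : ∀ k : F, ∀ᶠ y in 𝓝 z, ContDiffAt ℝ ∞ (fun _ : EB => k) y := fun k =>
    Filter.Eventually.of_forall fun y => contDiffAt_const
  -- the derivative at `z` of the bracket of the constant section `k` and `f c`
  have hd : ∀ k k' : F, A.coordBracket x₀ (fun _ => k') (A.coordBracket x₀ (fun _ => k) r) z =
      l (A.anchorFun x₀ z k) • A.structFun x₀ z k' c +
      (l (A.anchorFun x₀ z k') • A.structFun x₀ z k c + l (ρ' (A.anchorFun x₀ z k') k) • c) := by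
    intro k k'
    have h1 : A.coordBracket x₀ (fun _ => k) r =
        fun y => A.structFun x₀ y k (r y) + l (A.anchorFun x₀ y k) • c := by
      funext y
      rw [coordBracket_const_left, (hr y).fderiv]
      rfl
    have h2 := ((A.hasFDerivAt_structFun hx).clm_apply (hasFDerivAt_const k _)).clm_apply (hr z)
    rw [show r (extChartAt I x₀ x) = 0 from hr0] at h2
    have h3 := ((l.hasFDerivAt.comp z ((A.hasFDerivAt_anchorFun hx).clm_apply
      (hasFDerivAt_const k _))).smul_const c)
    have h4 := h2.add h3
    rw [coordBracket_const_left, h1]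
    rw [HasFDerivAt.fderiv (f := fun y => A.structFun x₀ y k (r y) +
      l (A.anchorFun x₀ y k) • c) h4]
    simp only [hr0]
    simp [z, ρ']
  have hrab : A.coordBracket x₀ r (A.coordBracket x₀ (fun _ => a) (fun _ => b)) z =
      -(l (A.anchorFun x₀ z (A.structFun x₀ z a b)) • c) := by
    rw [coordBracket_const_const]
    unfold coordBracket
    rw [hr0, (hr z).fderiv]
    simp
  have hswap : A.coordBracket x₀ (fun _ => b) (A.coordBracket x₀ r (fun _ => a)) z =
      -A.coordBracket x₀ (fun _ => b) (A.coordBracket x₀ (fun _ => a) r) z := by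
    have h5 : ∀ᶠ y in 𝓝 z, A.coordBracket x₀ r (fun _ => a) y =
        -A.coordBracket x₀ (fun _ => a) r y := by
      refine eventually_coord_of_coordDomain (I := I) hx fun y hy => ?_
      exact A.coordBracket_swap hy (Filter.Eventually.of_forall fun y =>
        ((l.contDiff.comp (contDiff_id.sub contDiff_const)).smul contDiff_const).contDiffAt)
        (Filter.Eventually.of_forall fun y => contDiffAt_const)
    have h6 : A.coordBracket x₀ r (fun _ => a) =ᶠ[𝓝 z] fun y =>
        -A.coordBracket x₀ (fun _ => a) r y := h5
    rw [coordBracket_const_left, coordBracket_const_left, h6.fderiv_eq, h6.eq_of_nhds, fderiv_fun_neg]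
    simp only [map_neg, neg_apply]
    abel
  have hj := A.coordBracket_jacobi hx (hcst a) (hcst b) hrs
  change A.coordBracket x₀ (fun _ => a) (A.coordBracket x₀ (fun _ => b) r) z +
    A.coordBracket x₀ (fun _ => b) (A.coordBracket x₀ r (fun _ => a)) z +
    A.coordBracket x₀ r (A.coordBracket x₀ (fun _ => a) (fun _ => b)) z = 0 at hj
  rw [hswap, hrab, hd, hd] at hj
  have h7 : l (A.anchorFun x₀ z (A.structFun x₀ z a b) -
      (ρ' (A.anchorFun x₀ z a) b - ρ' (A.anchorFun x₀ z b) a)) • c = 0 := by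
    rw [← neg_eq_zero, ← hj]
    simp only [map_sub, sub_smul]
    abel
  exact (smul_eq_zero.1 h7).resolve_right hc

end LieAlgebroid
end structureEquations

/-! ### Lie brackets of vector fields in coordinates -/

section lieBracket
variable {E : Type*} [NormedAddCommGroup E] [NormedSpace ℝ E] {K : Type*} [TopologicalSpace K]
  {J : ModelWithCorners ℝ E K} [J.Boundaryless] {N : Type*} [TopologicalSpace N] [ChartedSpace K N]
  [IsManifold J ∞ N]

/-- The Lie bracket of two vector fields in the preferred chart around the point. -/
theorem dirDeriv_extChartAt_mlieBracket {w : N} {X Y : ∀ q : N, TangentSpace J q} {h s : E → E}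
    (hX : ∀ᶠ q in 𝓝 w, dirDeriv J (extChartAt J w) q (X q) = h (extChartAt J w q))
    (hY : ∀ᶠ q in 𝓝 w, dirDeriv J (extChartAt J w) q (Y q) = s (extChartAt J w q)) :
    dirDeriv J (extChartAt J w) w (VectorField.mlieBracket J X Y w) =
      VectorField.lieBracket ℝ h s (extChartAt J w w) := by
  have : IsManifold J 1 N := .of_le (n := ∞) (by simp)
  have key : ∀ {X : ∀ q : N, TangentSpace J q} {h : E → E},
      (∀ᶠ q in 𝓝 w, dirDeriv J (extChartAt J w) q (X q) = h (extChartAt J w q)) →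
      (VectorField.mpullbackWithin 𝓘(ℝ, E) J (extChartAt J w).symm X (Set.range J) : E → E)
        =ᶠ[𝓝 (extChartAt J w w)] h := by
    intro X h hX
    have hc : Filter.Tendsto (extChartAt J w).symm (𝓝 (extChartAt J w w)) (𝓝 w) := by
      have := (continuousAt_extChartAt_symm (I := J) w).tendsto
      rwa [extChartAt_to_inv] at this
    filter_upwards [hc.eventually hX, (isOpen_extChartAt_target w).mem_nhds
      (mem_extChartAt_target w)] with z h1 h2
    rw [(extChartAt J w).right_inv h2] at h1
    rw [← h1]
    have h3 := ContinuousLinearMap.inverse_eq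
      (mfderivWithin_extChartAt_symm_comp_mfderiv_extChartAt (I := J) h2)
      (mfderiv_extChartAt_comp_mfderivWithin_extChartAt_symm (I := J) h2)
    exact congrArg (fun M => M (X ((extChartAt J w).symm z))) h3
  let p : (∀ q : N, TangentSpace J q) → E → E := fun X =>
    VectorField.mpullbackWithin 𝓘(ℝ, E) J (extChartAt J w).symm X (Set.range J)
  let b : E := VectorField.lieBracketWithin ℝ (p X) (p Y)
    ((extChartAt J w).symm ⁻¹' Set.univ ∩ Set.range J) (extChartAt J w w)
  have h1 : VectorField.mlieBracket J X Y w =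
      (mfderiv J 𝓘(ℝ, E) (extChartAt J w) w).inverse b := VectorField.mlieBracketWithin_apply
  have h2 : b = VectorField.lieBracket ℝ h s (extChartAt J w w) := by
    have h3 : (extChartAt J w).symm ⁻¹' Set.univ ∩ Set.range J = Set.univ := by
      rw [J.range_eq_univ, Set.preimage_univ, Set.univ_inter]
    change VectorField.lieBracketWithin ℝ (p X) (p Y) _ _ = _
    rw [h3, VectorField.lieBracketWithin_univ]
    exact Filter.EventuallyEq.lieBracket_vectorField_eq (key hX) (key hY)
  rw [h1]
  refine Eq.trans ?_ h2
  obtain ⟨M, hM⟩ := isInvertible_mfderiv_extChartAt (I := J) (x := w) (y := w) (by simp)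
  unfold dirDeriv
  rw [← hM, ContinuousLinearMap.inverse_equiv]
  exact M.apply_symm_apply _

end lieBracket

/-! ### Coordinates on the dual bundle -/

section dual
variable {EB : Type*} [NormedAddCommGroup EB] [NormedSpace ℝ EB] {H : Type*} [TopologicalSpace H]
  {I : ModelWithCorners ℝ EB H} {B : Type*} [TopologicalSpace B] [ChartedSpace H B]
  {F : Type*} [NormedAddCommGroup F] [NormedSpace ℝ F] {V : B → Type*}
  [TopologicalSpace (TotalSpace F V)] [∀ x, AddCommGroup (V x)] [∀ x, Module ℝ (V x)]
  [∀ x, TopologicalSpace (V x)] [FiberBundle F V] [VectorBundle ℝ F V]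

theorem coordDomain_dual (x₀ : B) :
    coordDomain H (F →L[ℝ] ℝ) (DualFiber V) x₀ = coordDomain H F V x₀ := by
  unfold coordDomain
  rw [hom_trivializationAt_baseSet]
  simp

theorem fcoord_dual_apply {x₀ x : B} (hx : x ∈ (trivializationAt F V x₀).baseSet)
    (φ : DualFiber V x) (k : F) :
    fcoord (F →L[ℝ] ℝ) (V := DualFiber V) x₀ φ k = φ (constSec F V x₀ k x) := by
  have h : fcoord (F →L[ℝ] ℝ) (V := DualFiber V) x₀ φ =
      ((trivializationAt ℝ (Bundle.Trivial B ℝ) x₀).continuousLinearMapAt ℝ x).comp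
        (φ.comp ((trivializationAt F V x₀).symmL ℝ x)) := rfl
  rw [h]
  have h2 : (trivializationAt F V x₀).symmL ℝ x k = constSec F V x₀ k x :=
    Trivialization.symmL_apply _ hx _
  change (trivializationAt ℝ (Bundle.Trivial B ℝ) x₀).continuousLinearMapAt ℝ x
    (φ ((trivializationAt F V x₀).symmL ℝ x k)) = _
  rw [h2]
  simp

/-- The coordinates on the dual bundle are dual to those on the bundle: they compute the pairing. -/
theorem fcoord_dual_fcoord {x₀ x : B} (hx : x ∈ (trivializationAt F V x₀).baseSet)
    (φ : DualFiber V x) (b : V x) :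
    fcoord (F →L[ℝ] ℝ) (V := DualFiber V) x₀ φ (fcoord F x₀ b) = φ b := by
  rw [fcoord_dual_apply hx, constSec_fcoord hx]

end dual

/-! ### Coordinates on prolongations -/

section prolongation
variable {EB : Type*} [NormedAddCommGroup EB] [NormedSpace ℝ EB]
  {H : Type*} [TopologicalSpace H]
  {I : ModelWithCorners ℝ EB H} {B : Type*} [TopologicalSpace B]
  [ChartedSpace H B] [IsManifold I ∞ B]
  {F : Type*} [NormedAddCommGroup F] [NormedSpace ℝ F] {V : B → Type*}
  [TopologicalSpace (TotalSpace F V)] [∀ x, AddCommGroup (V x)] [∀ x, Module ℝ (V x)]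
  [∀ x, TopologicalSpace (V x)] [FiberBundle F V] [VectorBundle ℝ F V]
  [ContMDiffVectorBundle ∞ F V I]
  {FW : Type*} [NormedAddCommGroup FW] [NormedSpace ℝ FW] {W : B → Type*}
  [TopologicalSpace (TotalSpace FW W)] [∀ x, AddCommGroup (W x)] [∀ x, Module ℝ (W x)]
  [∀ x, TopologicalSpace (W x)] [FiberBundle FW W] [VectorBundle ℝ FW W]
  [ContMDiffVectorBundle ∞ FW W I]

namespace Prol
variable {ρ : Cₛ^∞⟮I; F →L[ℝ] EB, fun x => V x →L[ℝ] TangentSpace I x⟯}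

/-- The coordinates `(b, ξ)` of an element `(b, v)` of the prolongation around `x₀`: the coordinates of
`b`, and the vertical coordinates of `v`. -/
noncomputable def coord (x₀ : B) {w : TotalSpace FW W} (u : Prol FW W ρ w) : F × FW :=
  (fcoord F x₀ u.fst, (dirDeriv (I.prod 𝓘(ℝ, FW)) (tcoord I FW W x₀) w u.snd).2)

theorem anchor_fst {w : TotalSpace FW W} (u : Prol FW W ρ w) : ρ w.proj u.fst =
    mfderiv (I.prod 𝓘(ℝ, FW)) I (π FW W) w u.snd := u.2

theorem ext' {w : TotalSpace FW W} {u u' : Prol FW W ρ w} (h1 : u.fst = u'.fst)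
    (h2 : u.snd = u'.snd) : u = u' := Subtype.ext (Prod.ext h1 h2)

variable (ρ) in
theorem mem_baseSet {w₀ w : TotalSpace FW W} :
    w ∈ (trivializationAt (F × FW) (Prol FW W ρ) w₀).baseSet ↔
      w.proj ∈ coordDomain H F V w₀.proj ∧ w.proj ∈ coordDomain H FW W w₀.proj := by
  change w.proj ∈ (trivializationAt F V w₀.proj).baseSet ∧ w ∈ (chartAt (ModelProd H FW) w₀).source ↔ _
  rw [mem_chart_source_total]
  unfold coordDomain
  simp only [Set.mem_inter_iff]
  tauto

variable (ρ) in
theorem mem_coordDomain {w₀ w : TotalSpace FW W} :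
    w ∈ coordDomain (ModelProd H FW) (F × FW) (Prol FW W ρ) w₀ ↔
      w.proj ∈ coordDomain H F V w₀.proj ∧ w.proj ∈ coordDomain H FW W w₀.proj := by
  unfold coordDomain
  rw [Set.mem_inter_iff, mem_baseSet, mem_chart_source_total]
  unfold coordDomain
  simp only [Set.mem_inter_iff]
  tauto

theorem fcoord_eq_coord {x₀ : B} {w : TotalSpace FW W} (hV : w.proj ∈ coordDomain H F V x₀)
    (hw : w.proj ∈ coordDomain H FW W x₀)
    (w₀ : TotalSpace FW W) (hw₀ : w₀.proj = x₀) (u : Prol FW W ρ w) :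
    fcoord (F × FW) (V := Prol FW W ρ) w₀ u = coord x₀ u := by
  obtain ⟨h1, h2⟩ := tcoord_eventuallyEq (I := I) hw w₀ hw₀
  subst hw₀
  change toCoord (F := F) (V := V) w₀ w u.1 = _
  have : IsManifold (I.prod 𝓘(ℝ, FW)) 1 (TotalSpace FW W) := .of_le (n := ∞) (by simp)
  refine Prod.ext ?_ ?_
  · exact congrFun (Trivialization.coe_linearMapAt_of_mem _ hV.1) u.1.1
  · unfold toCoord coord
    rw [TangentBundle.continuousLinearMapAt_trivializationAt h1, dirDeriv_congr h2]
    rfl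

variable [FiniteDimensional ℝ EB] [FiniteDimensional ℝ F] [I.Boundaryless] [T2Space B]
variable {A : LieAlgebroid I F V} {x₀ : B} {w : TotalSpace FW W}

theorem dirDeriv_tcoord_snd (hV : w.proj ∈ coordDomain H F V x₀)
    (hW : w.proj ∈ coordDomain H FW W x₀) (u : Prol FW W A.anchor w) :
    dirDeriv (I.prod 𝓘(ℝ, FW)) (tcoord I FW W x₀) w u.snd =
      (A.anchorFun x₀ (extChartAt I x₀ w.proj) (coord x₀ u).1, (coord x₀ u).2) := by
  refine Prod.ext ?_ rfl
  rw [dirDeriv_tcoord_fst hW, ← u.anchor_fst, A.dirDeriv_anchor hV]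
  rfl

theorem coord_inj (hV : w.proj ∈ coordDomain H F V x₀)
    (hW : w.proj ∈ coordDomain H FW W x₀) {u u' : Prol FW W A.anchor w} :
    coord x₀ u = coord x₀ u' ↔ u = u' := by
  refine ⟨fun h => ext' ?_ ?_, fun h => by rw [h]⟩
  · exact (fcoord_inj hV.1).1 (congrArg Prod.fst h)
  · rw [← (isCoordAt_tcoord hW).dirDeriv_inj, dirDeriv_tcoord_snd hV hW,
      dirDeriv_tcoord_snd hV hW, h]

theorem exists_coord_eq (A : LieAlgebroid I F V) (hV : w.proj ∈ coordDomain H F V x₀)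
    (hW : w.proj ∈ coordDomain H FW W x₀) (k : F × FW) :
    ∃ u : Prol FW W A.anchor w, coord x₀ u = k := by
  obtain ⟨v, hv⟩ := (isCoordAt_tcoord (I := I) hW).exists_dirDeriv_eq
    (A.anchorFun x₀ (extChartAt I x₀ w.proj) k.1, k.2)
  have h1 : fcoord F x₀ (constSec F V x₀ k.1 w.proj) = k.1 := fcoord_constSec hV.1 k.1
  refine ⟨Prol.mk (constSec F V x₀ k.1 w.proj) v ?_, Prod.ext h1 (by
    have h3 := congrArg Prod.snd hv
    exact h3)⟩
  have h2 := congrArg Prod.fst hv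
  rw [dirDeriv_tcoord_fst hW] at h2
  rw [← (isCoordAt_extChartAt (J := I) hV.2).dirDeriv_inj, h2, A.dirDeriv_anchor hV, h1]

end Prol

variable (ρ : Cₛ^∞⟮I; F →L[ℝ] EB, fun x => V x →L[ℝ] TangentSpace I x⟯) in
/-- The coordinates of a point of the total space of a prolongation: the coordinates of its base
point and its fibre coordinates. -/
noncomputable def pcoord (x₀ : B) (p : TotalSpace (F × FW) (Prol FW W ρ)) : (EB × FW) × (F × FW) :=
  (tcoord I FW W x₀ p.proj, Prol.coord x₀ p.2)

end prolongation

/-! ### The differential on prolongations -/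

section prolongationBracket
variable {EB : Type*} [NormedAddCommGroup EB] [NormedSpace ℝ EB] [FiniteDimensional ℝ EB]
  {H : Type*} [TopologicalSpace H]
  {I : ModelWithCorners ℝ EB H} [I.Boundaryless] {B : Type*} [TopologicalSpace B] [T2Space B]
  [ChartedSpace H B] [IsManifold I ∞ B]
  {F : Type*} [NormedAddCommGroup F] [NormedSpace ℝ F] [FiniteDimensional ℝ F] {V : B → Type*}
  [TopologicalSpace (TotalSpace F V)] [∀ x, AddCommGroup (V x)] [∀ x, Module ℝ (V x)]
  [∀ x, TopologicalSpace (V x)] [FiberBundle F V] [VectorBundle ℝ F V]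
  [ContMDiffVectorBundle ∞ F V I]
  {FW : Type*} [NormedAddCommGroup FW] [NormedSpace ℝ FW] {W : B → Type*}
  [TopologicalSpace (TotalSpace FW W)] [∀ x, AddCommGroup (W x)] [∀ x, Module ℝ (W x)]
  [∀ x, TopologicalSpace (W x)] [FiberBundle FW W] [VectorBundle ℝ FW W]
  [ContMDiffVectorBundle ∞ FW W I]
  (A : LieAlgebroid I F V)

theorem isRep_extend {x₀ x : B} (hx : x ∈ coordDomain H F V x₀) (b : V x) :
    ∃ h : EB → F, IsRep I x₀ x (FiberBundle.extend F b) h ∧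
      h (extChartAt I x₀ x) = fcoord F x₀ b := by
  obtain ⟨X, hX⟩ := (isRep_constSec (I := I) (mem_coordDomain_self H F V x).1
    (fcoord F x b)).exists_section (mem_coordDomain_self H F V x)
  have h1 := isRep_section hx X
  have h2 : X x = b := hX.self_of_nhds.trans
    (constSec_fcoord (mem_coordDomain_self H F V x).1 b)
  refine ⟨_, h1.congr (hX.mono fun y hy => hy.symm), ?_⟩
  rw [← h1.self, h2]

namespace Prol
variable {A} {w : TotalSpace FW W}

theorem extend_self (u : Prol FW W A.anchor w) :
    FiberBundle.extend (F × FW) u w = u := FiberBundle.extend_apply_self (F × FW) u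

theorem eventually_mem_coordDomain' (w : TotalSpace FW W) : ∀ᶠ y : TotalSpace FW W in 𝓝 w,
    y.proj ∈ coordDomain H F V w.proj ∧ y.proj ∈ coordDomain H FW W w.proj :=
  (eventually_mem_coordDomain (mem_coordDomain_self H F V w.proj)).and
    (eventually_mem_coordDomain (mem_coordDomain_self H FW W w.proj))

theorem eventually_coord_extend (u : Prol FW W A.anchor w) :
    ∀ᶠ y in 𝓝 w, coord w.proj (FiberBundle.extend (F × FW) u y : Prol FW W A.anchor y) =
      coord w.proj u := by
  filter_upwards [eventually_mem_coordDomain' (H := H) (F := F) (V := V) w] with y hy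
  rw [← fcoord_eq_coord hy.1 hy.2 w rfl, extend_eq_constSec,
    fcoord_constSec ((mem_baseSet (H := H) A.anchor).2 hy)]
  exact fcoord_eq_coord (mem_coordDomain_self H F V _) (mem_coordDomain_self H FW W _) w rfl u

theorem eventually_fst_extend (u : Prol FW W A.anchor w) :
    ∀ᶠ y in 𝓝 w, (FiberBundle.extend (F × FW) u y : Prol FW W A.anchor y).fst =
      FiberBundle.extend F u.fst y.proj := by
  filter_upwards [eventually_mem_coordDomain' (H := H) (F := F) (V := V) w,
    eventually_coord_extend u] with y hy h1
  rw [← fcoord_inj hy.1.1, extend_eq_constSec u.fst, fcoord_constSec hy.1.1]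
  exact congrArg Prod.fst h1

end Prol

namespace LieAlgebroid
variable {w : TotalSpace FW W}

theorem prolBracketFst_extend (u u' : Prol FW W A.anchor w) :
    A.prolBracketFst FW W (FiberBundle.extend (F × FW) u) (FiberBundle.extend (F × FW) u') w =
      A.raw.bracket (FiberBundle.extend F u.fst) (FiberBundle.extend F u'.fst) w.proj := by
  have h0 : ∀ (u : Prol FW W A.anchor w) (v), dirDeriv (I.prod 𝓘(ℝ, FW))
      (fun q : TotalSpace FW W => (trivializationAt F V w.proj
        ⟨q.proj, (FiberBundle.extend (F × FW) u q : Prol FW W A.anchor q).fst⟩).2) w v = 0 := by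
    intro u v
    rw [dirDeriv_congr (g := fun _ => (Prol.coord w.proj u).1), dirDeriv_const]
    filter_upwards [Prol.eventually_coord_extend u] with y hy
    exact congrArg Prod.fst hy
  unfold prolBracketFst
  rw [h0, h0, Prol.extend_self, Prol.extend_self, sub_zero]
  have h1 : (trivializationAt F V w.proj).symm w.proj 0 = 0 := by
    rw [← Trivialization.symmL_apply (R := ℝ) _ (mem_baseSet_trivializationAt F V w.proj), map_zero]
  rw [h1, add_zero]

theorem fcoord_raw_bracket_extend {x : B} (a b : V x) :
    fcoord F x (A.raw.bracket (FiberBundle.extend F a) (FiberBundle.extend F b) x) =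
      A.structFun x (extChartAt I x x) (fcoord F x a) (fcoord F x b) := by
  have hx := mem_coordDomain_self H F V x
  rw [extend_eq_constSec, extend_eq_constSec, A.fcoord_raw_bracket hx
    (isRep_constSec hx.1 _) (isRep_constSec hx.1 _), coordBracket_const_const]

/-- In the preferred coordinates around the point, the bracket of the vector fields of two sections
with constant coordinates. -/
theorem dirDeriv_tcoord_mlieBracket_extend (u u' : Prol FW W A.anchor w) :
    dirDeriv (I.prod 𝓘(ℝ, FW)) (tcoord I FW W w.proj) w
      (VectorField.mlieBracket (I.prod 𝓘(ℝ, FW))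
        (fun q => (FiberBundle.extend (F × FW) u q : Prol FW W A.anchor q).snd)
        (fun q => (FiberBundle.extend (F × FW) u' q : Prol FW W A.anchor q).snd) w) =
      (A.anchorFun w.proj (extChartAt I w.proj w.proj)
        (A.structFun w.proj (extChartAt I w.proj w.proj) (Prol.coord w.proj u).1
          (Prol.coord w.proj u').1), 0) := by
  have hx := mem_coordDomain_self H F V w.proj
  have hw := mem_coordDomain_self H FW W w.proj
  have he := (tcoord_eventuallyEq (I := I) hw w rfl).2
  let X : F × FW → EB × FW → EB × FW := fun k z => (A.anchorFun w.proj z.1 k.1, k.2)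
  have h1 : ∀ u : Prol FW W A.anchor w, ∀ᶠ q in 𝓝 w, dirDeriv (I.prod 𝓘(ℝ, FW))
      (extChartAt (I.prod 𝓘(ℝ, FW)) w) q (FiberBundle.extend (F × FW) u q :
        Prol FW W A.anchor q).snd = X (Prol.coord w.proj u) (extChartAt (I.prod 𝓘(ℝ, FW)) w q) := by
    intro u
    filter_upwards [Prol.eventually_coord_extend u, he.eventually_nhds,
      Prol.eventually_mem_coordDomain' (H := H) (F := F) (V := V) w] with q h2 h3 h4
    have h3 : tcoord I FW W w.proj =ᶠ[𝓝 q] extChartAt (I.prod 𝓘(ℝ, FW)) w := h3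
    rw [dirDeriv_congr h3.symm, Prol.dirDeriv_tcoord_snd h4.1 h4.2, h2, ← h3.eq_of_nhds]
    rfl
  rw [dirDeriv_congr he, dirDeriv_extChartAt_mlieBracket (h1 u) (h1 u'), ← he.eq_of_nhds]
  have h5 : ∀ k : F × FW, HasFDerivAt (X k)
      ((((fderiv ℝ (A.anchorFun w.proj) (extChartAt I w.proj w.proj)).flip k.1).comp
        (ContinuousLinearMap.fst ℝ EB FW)).prod 0) (tcoord I FW W w.proj w) := by
    intro k
    have h6 := (A.hasFDerivAt_anchorFun hx).clm_apply (hasFDerivAt_const k.1 _)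
    have h7 := HasFDerivAt.comp (tcoord I FW W w.proj w) (g := fun z => A.anchorFun w.proj z k.1)
      (f := Prod.fst) h6 hasFDerivAt_fst
    have h8 := h7.prodMk (hasFDerivAt_const k.2 (tcoord I FW W w.proj w))
    refine h8.congr_fderiv ?_
    ext <;> simp
  rw [VectorField.lieBracket_eq]
  simp only []
  rw [(h5 _).fderiv, (h5 _).fderiv, A.anchorFun_structFun hx]
  refine Prod.ext ?_ ?_
  · rfl
  · change (0 : FW) - 0 = 0
    rw [sub_zero]

theorem prol_bracket_extend_aux (u u' : Prol FW W A.anchor w) :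
    A.anchor w.proj (A.prolBracketFst FW W (FiberBundle.extend (F × FW) u)
      (FiberBundle.extend (F × FW) u') w) =
        mfderiv (I.prod 𝓘(ℝ, FW)) I (π FW W) w
          (VectorField.mlieBracket (I.prod 𝓘(ℝ, FW))
            (fun q => (FiberBundle.extend (F × FW) u q : Prol FW W A.anchor q).snd)
            (fun q => (FiberBundle.extend (F × FW) u' q : Prol FW W A.anchor q).snd) w) := by
  have hx := mem_coordDomain_self H F V w.proj
  have hw := mem_coordDomain_self H FW W w.proj
  rw [← (isCoordAt_extChartAt (J := I) hx.2).dirDeriv_inj, ← dirDeriv_tcoord_fst hw,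
    dirDeriv_tcoord_mlieBracket_extend, A.dirDeriv_anchor hx, prolBracketFst_extend,
    fcoord_raw_bracket_extend]
  rfl

theorem prol_bracket_extend_fst (u u' : Prol FW W A.anchor w) :
    ((A.prol FW W).bracket (FiberBundle.extend (F × FW) u) (FiberBundle.extend (F × FW) u') w :
      Prol FW W A.anchor w).fst =
      A.raw.bracket (FiberBundle.extend F u.fst) (FiberBundle.extend F u'.fst) w.proj := by
  rw [← A.prolBracketFst_extend]
  exact congrArg (Prol.fst (w := w)) (dif_pos (A.prol_bracket_extend_aux u u'))

theorem coord_prol_bracket_extend (u u' : Prol FW W A.anchor w) :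
    Prol.coord w.proj ((A.prol FW W).bracket (FiberBundle.extend (F × FW) u)
      (FiberBundle.extend (F × FW) u') w : Prol FW W A.anchor w) =
      (A.structFun w.proj (extChartAt I w.proj w.proj) (Prol.coord w.proj u).1
        (Prol.coord w.proj u').1, 0) := by
  refine Prod.ext ?_ ?_
  · exact (congrArg _ (A.prol_bracket_extend_fst u u')).trans (A.fcoord_raw_bracket_extend _ _)
  · have h1 : ((A.prol FW W).bracket (FiberBundle.extend (F × FW) u)
      (FiberBundle.extend (F × FW) u') w : Prol FW W A.anchor w).snd = _ :=
      congrArg (Prol.snd (w := w)) (dif_pos (A.prol_bracket_extend_aux u u'))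
    have h2 := congrArg Prod.snd (A.dirDeriv_tcoord_mlieBracket_extend u u')
    change (dirDeriv (I.prod 𝓘(ℝ, FW)) (tcoord I FW W w.proj) w _).2 = 0
    rw [h1]
    exact h2

theorem prol_d0 (f : TotalSpace FW W → ℝ) (u : Prol FW W A.anchor w) :
    (A.prol FW W).d0 f w u = dirDeriv (I.prod 𝓘(ℝ, FW)) f w u.snd := rfl

/-- The differential of a 1-section on the prolongation, in the preferred coordinates around the
point. -/
theorem prol_d1 {μ : ∀ y, Prol FW W A.anchor y → ℝ} {m : EB × FW → (F × FW) →L[ℝ] ℝ}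
    (hμ : ∀ᶠ y in 𝓝 w, ∀ a : Prol FW W A.anchor y,
      μ y a = m (tcoord I FW W w.proj y) (Prol.coord w.proj a))
    (hm : DifferentiableAt ℝ m (tcoord I FW W w.proj w)) (u u' : Prol FW W A.anchor w) :
    (A.prol FW W).d1 (F × FW) μ w u u' =
      fderiv ℝ m (tcoord I FW W w.proj w)
        (dirDeriv (I.prod 𝓘(ℝ, FW)) (tcoord I FW W w.proj) w u.snd) (Prol.coord w.proj u')
      - fderiv ℝ m (tcoord I FW W w.proj w)
        (dirDeriv (I.prod 𝓘(ℝ, FW)) (tcoord I FW W w.proj) w u'.snd) (Prol.coord w.proj u)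
      - m (tcoord I FW W w.proj w)
        (A.structFun w.proj (extChartAt I w.proj w.proj) (Prol.coord w.proj u).1
          (Prol.coord w.proj u').1, 0) := by
  have hw := mem_coordDomain_self H FW W w.proj
  have h1 : ∀ u u' : Prol FW W A.anchor w, (A.prol FW W).d0
      (fun y => μ y (FiberBundle.extend (F × FW) u' y)) w u =
      fderiv ℝ m (tcoord I FW W w.proj w)
        (dirDeriv (I.prod 𝓘(ℝ, FW)) (tcoord I FW W w.proj) w u.snd) (Prol.coord w.proj u') := by
    intro u u'
    rw [prol_d0, (isCoordAt_tcoord hw).dirDeriv_eq (g := fun z => m z (Prol.coord w.proj u'))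
      ?_ (hm.clm_apply (differentiableAt_const _))]
    · rw [(hm.hasFDerivAt.clm_apply (hasFDerivAt_const _ _)).fderiv]
      simp
    · filter_upwards [hμ, Prol.eventually_coord_extend u'] with y h2 h3
      rw [h2, h3]
  unfold RawAlgebroid.d1
  rw [h1, h1, hμ.self_of_nhds, coord_prol_bracket_extend]

end LieAlgebroid

end prolongationBracket

/-! ### Linear functions on vector bundles -/

section hat
variable {EB : Type*} [NormedAddCommGroup EB] [NormedSpace ℝ EB]
  {H : Type*} [TopologicalSpace H]
  {I : ModelWithCorners ℝ EB H} [I.Boundaryless] {B : Type*} [TopologicalSpace B]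
  [ChartedSpace H B] [IsManifold I ∞ B]
  {F : Type*} [NormedAddCommGroup F] [NormedSpace ℝ F] {V : B → Type*}
  [TopologicalSpace (TotalSpace F V)] [∀ x, AddCommGroup (V x)] [∀ x, Module ℝ (V x)]
  [∀ x, TopologicalSpace (V x)] [FiberBundle F V] [VectorBundle ℝ F V]
  [ContMDiffVectorBundle ∞ F V I]

/-- The coordinate representation of a section of the dual bundle. -/
noncomputable def dualRep (I : ModelWithCorners ℝ EB H) (x₀ : B) (θ : ∀ y, DualFiber V y) (z : EB) :
    F →L[ℝ] ℝ :=
  fcoord (F →L[ℝ] ℝ) (V := DualFiber V) x₀ (θ ((extChartAt I x₀).symm z))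

theorem eventually_dualRep {x₀ x : B} (hx : x ∈ coordDomain H F V x₀)
    (θ : ∀ y, DualFiber V y) : ∀ᶠ y in 𝓝 x, ∀ b : V y,
      θ y b = dualRep I x₀ θ (extChartAt I x₀ y) (fcoord F x₀ b) := by
  filter_upwards [(isOpen_coordDomain H F V x₀).mem_nhds hx] with y hy b
  unfold dualRep
  rw [(extChartAt I x₀).left_inv (by simpa using hy.2), fcoord_dual_fcoord hy.1]

theorem contDiffAt_dualRep {x₀ x : B} (hx : x ∈ coordDomain H F V x₀)
    {θ : ∀ y, DualFiber V y} (hθ : ContMDiffAt I (I.prod 𝓘(ℝ, F →L[ℝ] ℝ)) ∞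
      (fun y => TotalSpace.mk' (F →L[ℝ] ℝ) y (θ y)) x) :
    ContDiffAt ℝ ∞ (dualRep (F := F) (V := V) I x₀ θ) (extChartAt I x₀ x) := by
  have hx' : x ∈ coordDomain H (F →L[ℝ] ℝ) (DualFiber V) x₀ := by rwa [coordDomain_dual]
  exact contDiffAt_comp_extChartAt_symm hx.2
    (((trivializationAt (F →L[ℝ] ℝ) (DualFiber V) x₀).contMDiffAt_section_iff hx'.1).1 hθ)

/-- The derivative of the fibrewise linear function given by a section of the dual bundle. -/
theorem dirDeriv_hat {x₀ : B} {p : TotalSpace F V} (hp : p.proj ∈ coordDomain H F V x₀)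
    {θ : ∀ y, DualFiber V y} (hθ : ContMDiffAt I (I.prod 𝓘(ℝ, F →L[ℝ] ℝ)) ∞
      (fun y => TotalSpace.mk' (F →L[ℝ] ℝ) y (θ y)) p.proj)
    (v : TangentSpace (I.prod 𝓘(ℝ, F)) p) :
    dirDeriv (I.prod 𝓘(ℝ, F)) (fun q : TotalSpace F V => (θ q.proj q.2 : ℝ)) p v =
      fderiv ℝ (dualRep I x₀ θ) (extChartAt I x₀ p.proj)
        (dirDeriv (I.prod 𝓘(ℝ, F)) (tcoord I F V x₀) p v).1 (fcoord F x₀ p.2) +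
      dualRep I x₀ θ (extChartAt I x₀ p.proj)
        (dirDeriv (I.prod 𝓘(ℝ, F)) (tcoord I F V x₀) p v).2 := by
  have h1 := ((contDiffAt_dualRep hp hθ).differentiableAt (by simp)).hasFDerivAt
  have h2 : HasFDerivAt (fun z : EB × F => dualRep I x₀ θ z.1) _ (tcoord I F V x₀ p) :=
    HasFDerivAt.comp (tcoord I F V x₀ p) (g := dualRep I x₀ θ) (f := Prod.fst) h1 hasFDerivAt_fst
  have h3 := h2.clm_apply (hasFDerivAt_snd (𝕜 := ℝ) (p := tcoord I F V x₀ p))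
  rw [(isCoordAt_tcoord hp).dirDeriv_eq (g := fun z => dualRep I x₀ θ z.1 z.2) ?_
    h3.differentiableAt, h3.fderiv]
  · simp only [add_apply, ContinuousLinearMap.comp_apply, ContinuousLinearMap.flip_apply]
    rw [add_comm]
    rfl
  · have h4 := (FiberBundle.continuous_proj F V).continuousAt.eventually
      (eventually_dualRep (I := I) hp θ)
    filter_upwards [h4] with q hq
    exact hq q.2

theorem contMDiffAt_constSec_dual {x₀ x : B} (hx : x ∈ coordDomain H F V x₀) (k : F →L[ℝ] ℝ) :
    ContMDiffAt I (I.prod 𝓘(ℝ, F →L[ℝ] ℝ)) ∞ (fun y => TotalSpace.mk' (F →L[ℝ] ℝ) y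
      (constSec (F →L[ℝ] ℝ) (DualFiber V) x₀ k y)) x := by
  have hx' : x ∈ coordDomain H (F →L[ℝ] ℝ) (DualFiber V) x₀ := by rwa [coordDomain_dual]
  exact ((isRep_constSec (I := I) hx'.1 k).eventually_contMDiffAt hx').self_of_nhds

theorem dualRep_constSec {x₀ x : B} (hx : x ∈ coordDomain H F V x₀) (k : F →L[ℝ] ℝ) :
    dualRep I x₀ (constSec (F →L[ℝ] ℝ) (DualFiber V) x₀ k) (extChartAt I x₀ x) = k := by
  have hx' : x ∈ coordDomain H (F →L[ℝ] ℝ) (DualFiber V) x₀ := by rwa [coordDomain_dual]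
  unfold dualRep
  rw [(extChartAt I x₀).left_inv (by simpa using hx.2), fcoord_constSec hx'.1]

end hat

/-! ### The canonical symplectic section and the canonical involution in coordinates -/

section canonical
variable {EB : Type*} [NormedAddCommGroup EB] [NormedSpace ℝ EB] [FiniteDimensional ℝ EB]
  {H : Type*} [TopologicalSpace H]
  {I : ModelWithCorners ℝ EB H} [I.Boundaryless] {B : Type*} [TopologicalSpace B] [T2Space B]
  [ChartedSpace H B] [IsManifold I ∞ B]
  {F : Type*} [NormedAddCommGroup F] [NormedSpace ℝ F] [FiniteDimensional ℝ F] {V : B → Type*}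
  [TopologicalSpace (TotalSpace F V)] [∀ x, AddCommGroup (V x)] [∀ x, Module ℝ (V x)]
  [∀ x, TopologicalSpace (V x)] [FiberBundle F V] [VectorBundle ℝ F V]
  [ContMDiffVectorBundle ∞ F V I]

namespace LieAlgebroid
variable (A : LieAlgebroid I F V)

/-- The differential of a section of the dual bundle in coordinates; the centre `x₀` of the
coordinates is arbitrary. -/
theorem raw_d1 {x₀ x : B} (hx : x ∈ coordDomain H F V x₀)
    {θ : ∀ y, DualFiber V y} (hθ : ContMDiffAt I (I.prod 𝓘(ℝ, F →L[ℝ] ℝ)) ∞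
      (fun y => TotalSpace.mk' (F →L[ℝ] ℝ) y (θ y)) x) (b c : V x) :
    A.raw.d1 F (fun y e => θ y e) x b c =
      fderiv ℝ (dualRep I x₀ θ) (extChartAt I x₀ x)
        (A.anchorFun x₀ (extChartAt I x₀ x) (fcoord F x₀ b)) (fcoord F x₀ c) -
      fderiv ℝ (dualRep I x₀ θ) (extChartAt I x₀ x)
        (A.anchorFun x₀ (extChartAt I x₀ x) (fcoord F x₀ c)) (fcoord F x₀ b) -
      dualRep I x₀ θ (extChartAt I x₀ x)
        (A.structFun x₀ (extChartAt I x₀ x) (fcoord F x₀ b) (fcoord F x₀ c)) := by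
  obtain ⟨h, hX, hb⟩ := isRep_extend (I := I) hx b
  obtain ⟨s, hY, hc⟩ := isRep_extend (I := I) hx c
  have ht := ((contDiffAt_dualRep hx hθ).differentiableAt (by simp)).hasFDerivAt
  have h1 : ∀ {Z : ∀ y, V y} {r : EB → F} (_ : IsRep I x₀ x Z r) (a : V x),
      A.raw.d0 (fun y => θ y (Z y)) x a =
      fderiv ℝ (dualRep I x₀ θ) (extChartAt I x₀ x)
        (A.anchorFun x₀ (extChartAt I x₀ x) (fcoord F x₀ a)) (r (extChartAt I x₀ x)) +
      dualRep I x₀ θ (extChartAt I x₀ x) (fderiv ℝ r (extChartAt I x₀ x)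
        (A.anchorFun x₀ (extChartAt I x₀ x) (fcoord F x₀ a))) := by
    intro Z r hZ a
    have h2 := ht.clm_apply (hZ.contDiffAt.differentiableAt (by simp)).hasFDerivAt
    change dirDeriv I _ x (A.anchor x a) = _
    rw [(isCoordAt_extChartAt (J := I) hx.2).dirDeriv_eq (g := fun z => dualRep I x₀ θ z (r z)) ?_
      h2.differentiableAt, h2.fderiv, A.dirDeriv_anchor hx]
    · simp only [add_apply, ContinuousLinearMap.comp_apply, ContinuousLinearMap.flip_apply]
      rw [add_comm]
    · filter_upwards [eventually_dualRep (I := I) hx θ, hZ.1] with y h3 h4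
      rw [h3, h4]
  unfold RawAlgebroid.d1
  rw [h1 hX, h1 hY]
  change _ - _ - θ x (A.raw.bracket (FiberBundle.extend F b) (FiberBundle.extend F c) x) = _
  rw [(eventually_dualRep (I := I) hx θ).self_of_nhds, A.fcoord_raw_bracket hx hX hY]
  unfold coordBracket
  rw [hb, hc]
  simp only [map_add, map_sub]
  ring

/-- The canonical symplectic section in coordinates; the centre `x₀` of the coordinates is
arbitrary. -/
theorem canonicalTwo_eq {x₀ : B} {w : TotalSpace (F →L[ℝ] ℝ) (DualFiber V)}
    (hx : w.proj ∈ coordDomain H F V x₀) (u u' : Prol (F →L[ℝ] ℝ) (DualFiber V) A.anchor w) :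
    A.canonicalTwo w u u' = (Prol.coord x₀ u').2 (Prol.coord x₀ u).1
      - (Prol.coord x₀ u).2 (Prol.coord x₀ u').1
      + (tcoord I (F →L[ℝ] ℝ) (DualFiber V) x₀ w).2
        (A.structFun x₀ (extChartAt I x₀ w.proj) (Prol.coord x₀ u).1 (Prol.coord x₀ u').1) := by
  have hx' : w.proj ∈ coordDomain H (F →L[ℝ] ℝ) (DualFiber V) x₀ := by rwa [coordDomain_dual]
  obtain ⟨h, hX, hb⟩ := isRep_extend (I := I) hx u.fst
  obtain ⟨s, hY, hc⟩ := isRep_extend (I := I) hx u'.fst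
  have h1 : ∀ (u u' : Prol (F →L[ℝ] ℝ) (DualFiber V) A.anchor w) {r : EB → F}
      (_ : IsRep I x₀ w.proj (FiberBundle.extend F u'.fst) r),
      (A.prol (F →L[ℝ] ℝ) (DualFiber V)).d0 (fun y => A.liouvilleOne y
        (FiberBundle.extend (F × (F →L[ℝ] ℝ)) u' y)) w u =
      (Prol.coord x₀ u).2 (r (extChartAt I x₀ w.proj)) +
      (tcoord I (F →L[ℝ] ℝ) (DualFiber V) x₀ w).2 (fderiv ℝ r (extChartAt I x₀ w.proj)
        (A.anchorFun x₀ (extChartAt I x₀ w.proj) (Prol.coord x₀ u).1)) := by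
    intro u u' r hr
    have h2 : HasFDerivAt (fun z : EB × (F →L[ℝ] ℝ) => r z.1) _
        (tcoord I (F →L[ℝ] ℝ) (DualFiber V) x₀ w) :=
      HasFDerivAt.comp (tcoord I (F →L[ℝ] ℝ) (DualFiber V) x₀ w) (g := r) (f := Prod.fst)
        (hr.contDiffAt.differentiableAt (by simp)).hasFDerivAt hasFDerivAt_fst
    have h3 := (hasFDerivAt_snd (𝕜 := ℝ)
      (p := tcoord I (F →L[ℝ] ℝ) (DualFiber V) x₀ w)).clm_apply h2
    rw [prol_d0, (isCoordAt_tcoord hx').dirDeriv_eq (g := fun z => z.2 (r z.1)) ?_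
      h3.differentiableAt, h3.fderiv, Prol.dirDeriv_tcoord_snd hx hx']
    · simp only [add_apply, ContinuousLinearMap.comp_apply, ContinuousLinearMap.flip_apply]
      rw [add_comm]
      rfl
    · have h4 := (FiberBundle.continuous_proj (F →L[ℝ] ℝ) (DualFiber V)).continuousAt.eventually
        hr.1
      filter_upwards [Prol.eventually_fst_extend u', h4,
        eventually_mem_coordDomain hx] with y h5 h6 h7
      unfold liouvilleOne
      rw [h5]
      change _ = (tcoord I (F →L[ℝ] ℝ) (DualFiber V) x₀ y).2 (r (extChartAt I x₀ y.proj))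
      rw [← h6]
      exact (fcoord_dual_fcoord h7.1 y.2 _).symm
  have h8 : A.liouvilleOne w ((A.prol (F →L[ℝ] ℝ) (DualFiber V)).bracket
      (FiberBundle.extend (F × (F →L[ℝ] ℝ)) u) (FiberBundle.extend (F × (F →L[ℝ] ℝ)) u') w) =
      (tcoord I (F →L[ℝ] ℝ) (DualFiber V) x₀ w).2
        (A.coordBracket x₀ h s (extChartAt I x₀ w.proj)) := by
    rw [← A.fcoord_raw_bracket hx hX hY, ← A.prol_bracket_extend_fst u u']
    exact (fcoord_dual_fcoord hx.1 w.2 _).symm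
  unfold canonicalTwo RawAlgebroid.d1
  rw [h1 u u' hY, h1 u' u hX, h8]
  unfold coordBracket
  rw [hb, hc]
  change -(_ - _ - (tcoord I (F →L[ℝ] ℝ) (DualFiber V) x₀ w).2 (A.structFun x₀ _ (Prol.coord x₀ u).1
    (Prol.coord x₀ u').1 + fderiv ℝ s _ (A.anchorFun x₀ _ (Prol.coord x₀ u).1) -
      fderiv ℝ h _ (A.anchorFun x₀ _ (Prol.coord x₀ u').1))) = _
  simp only [map_add, map_sub]
  change -((Prol.coord x₀ u).2 (Prol.coord x₀ u').1 + _ - ((Prol.coord x₀ u').2 (Prol.coord x₀ u).1 + _)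
    - _) = _
  ring

/-- The canonical involution in coordinates. -/
theorem isInvolutionVec_iff {x₀ : B} {w : TotalSpace F V} (hx : w.proj ∈ coordDomain H F V x₀)
    (u : Prol F V A.anchor w)
    (v : TangentSpace (I.prod 𝓘(ℝ, F)) (TotalSpace.mk' F w.proj u.fst)) :
    A.IsInvolutionVec w u v ↔
      dirDeriv (I.prod 𝓘(ℝ, F)) (tcoord I F V x₀) (TotalSpace.mk' F w.proj u.fst) v =
        (A.anchorFun x₀ (extChartAt I x₀ w.proj) (fcoord F x₀ w.2),
          (Prol.coord x₀ u).2 -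
            A.structFun x₀ (extChartAt I x₀ w.proj) (fcoord F x₀ w.2) (Prol.coord x₀ u).1) := by
  have h1 : ∀ f : B → ℝ, ContMDiffAt I 𝓘(ℝ, ℝ) ∞ f w.proj →
      dirDeriv (I.prod 𝓘(ℝ, F)) (fun q : TotalSpace F V => f q.proj) (TotalSpace.mk' F w.proj u.fst) v
      = dirDeriv I f w.proj (mfderiv (I.prod 𝓘(ℝ, F)) I (π F V) (TotalSpace.mk' F w.proj u.fst) v) :=
    fun f hf => (dirDeriv_mfderiv (c := π F V) (t := TotalSpace.mk' F w.proj u.fst)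
      (hf.mdifferentiableAt (by simp)) (_root_.mdifferentiableAt_proj _) v).symm
  have hy : (TotalSpace.mk' F w.proj u.fst).proj ∈ coordDomain H F V x₀ := hx
  have hκ := isCoordAt_extChartAt (J := I) hx.2
  have h2 : ∀ {θ : ∀ y, DualFiber V y} (_ : ContMDiffAt I (I.prod 𝓘(ℝ, F →L[ℝ] ℝ)) ∞
      (fun y => TotalSpace.mk' (F →L[ℝ] ℝ) y (θ y)) w.proj),
      mfderiv (I.prod 𝓘(ℝ, F)) I (π F V) (TotalSpace.mk' F w.proj u.fst) v = A.anchor w.proj w.2 →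
      (dirDeriv (I.prod 𝓘(ℝ, F)) (fun q : TotalSpace F V => (θ q.proj q.2 : ℝ))
        (TotalSpace.mk' F w.proj u.fst) v
      = dirDeriv (I.prod 𝓘(ℝ, F)) (fun q : TotalSpace F V => (θ q.proj q.2 : ℝ)) w u.snd +
        A.raw.d1 F (fun y e => θ y e) w.proj w.2 u.fst ↔
      dualRep I x₀ θ (extChartAt I x₀ w.proj) (dirDeriv (I.prod 𝓘(ℝ, F)) (tcoord I F V x₀)
        (TotalSpace.mk' F w.proj u.fst) v).2 =
      dualRep I x₀ θ (extChartAt I x₀ w.proj) ((Prol.coord x₀ u).2 -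
        A.structFun x₀ (extChartAt I x₀ w.proj) (fcoord F x₀ w.2) (Prol.coord x₀ u).1)) := by
    intro θ hθ hv
    rw [dirDeriv_hat hy hθ, dirDeriv_hat hx hθ, A.raw_d1 hx hθ, dirDeriv_tcoord_fst hy, hv,
      Prol.dirDeriv_tcoord_snd hx hx]
    rw [show dirDeriv I (extChartAt I x₀) (TotalSpace.mk' F w.proj u.fst).proj
      (A.anchor w.proj w.2) = _ from A.dirDeriv_anchor hx w.2]
    rw [map_sub, show (Prol.coord x₀ u).1 = fcoord F x₀ u.fst from rfl]
    dsimp only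
    constructor <;> intro h <;> linarith
  constructor
  · rintro ⟨h3, h4⟩
    have hv : mfderiv (I.prod 𝓘(ℝ, F)) I (π F V) (TotalSpace.mk' F w.proj u.fst) v =
        A.anchor w.proj w.2 := by
      rw [← hκ.dirDeriv_inj, SeparatingDual.eq_iff_forall_dual_eq (R := ℝ)]
      intro l
      have hl : ContMDiffAt I 𝓘(ℝ, ℝ) ∞ (fun y => l (extChartAt I x₀ y)) w.proj :=
        l.contDiff.contDiffAt.contMDiffAt.comp w.proj hκ.contMDiffAt
      have h5 := h3 _ hl
      rw [h1 _ hl] at h5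
      have h6 : ∀ v, dirDeriv I (fun y => l (extChartAt I x₀ y)) w.proj v =
          l (dirDeriv I (extChartAt I x₀) w.proj v) := fun v => by
        rw [hκ.dirDeriv_eq (g := l) (Filter.Eventually.of_forall fun q => rfl)
          l.differentiableAt, ContinuousLinearMap.fderiv]
      rw [h6] at h5
      exact h5.trans (h6 _)
    refine Prod.ext ?_ ?_
    · rw [dirDeriv_tcoord_fst hy, hv]
      exact A.dirDeriv_anchor hx w.2
    · rw [SeparatingDual.eq_iff_forall_dual_eq (R := ℝ)]
      intro k
      have hk := contMDiffAt_constSec_dual (I := I) (V := V) hx k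
      have h5 := (h2 hk hv).1 (h4 _ hk)
      rwa [dualRep_constSec hx] at h5
  · intro h3
    have hv : mfderiv (I.prod 𝓘(ℝ, F)) I (π F V) (TotalSpace.mk' F w.proj u.fst) v =
        A.anchor w.proj w.2 := by
      rw [← hκ.dirDeriv_inj, A.dirDeriv_anchor hx]
      exact (dirDeriv_tcoord_fst hy v).symm.trans (congrArg Prod.fst h3)
    refine ⟨fun f hf => ?_, fun θ hθ => (h2 hθ hv).2 (by rw [h3])⟩
    rw [h1 f hf, hv]
    rfl

theorem dirDeriv_involutionVec {x₀ : B} {w : TotalSpace F V} (hx : w.proj ∈ coordDomain H F V x₀)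
    (u : Prol F V A.anchor w) :
    dirDeriv (I.prod 𝓘(ℝ, F)) (tcoord I F V x₀) (TotalSpace.mk' F w.proj u.fst)
      (A.involutionVec w u) =
        (A.anchorFun x₀ (extChartAt I x₀ w.proj) (fcoord F x₀ w.2),
          (Prol.coord x₀ u).2 -
            A.structFun x₀ (extChartAt I x₀ w.proj) (fcoord F x₀ w.2) (Prol.coord x₀ u).1) := by
  rw [← A.isInvolutionVec_iff hx]
  have hy : (TotalSpace.mk' F w.proj u.fst).proj ∈ coordDomain H F V x₀ := hx
  have h : ∃ v, A.IsInvolutionVec w u v := by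
    obtain ⟨v, hv⟩ := (isCoordAt_tcoord (I := I) hy).exists_dirDeriv_eq _
    exact ⟨v, (A.isInvolutionVec_iff hx u v).2 hv⟩
  unfold involutionVec
  rw [dif_pos h]
  exact h.choose_spec

end LieAlgebroid
end canonical

/-! ### Curves with a given velocity -/

section curves
variable {E : Type*} [NormedAddCommGroup E] [NormedSpace ℝ E] {K : Type*} [TopologicalSpace K]
  {J : ModelWithCorners ℝ E K} {N : Type*} [TopologicalSpace N] [ChartedSpace K N]
  {G : Type*} [NormedAddCommGroup G] [NormedSpace ℝ G]

/-- The derivative of a function along a curve, for a velocity given as a point of the tangent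
bundle. -/
theorem dirDeriv_eq_deriv {f : N → G} {γ : ℝ → N} {p : N} {v : TangentSpace J p}
    (hγ : MDifferentiableAt 𝓘(ℝ, ℝ) J γ 0)
    (e : (⟨γ 0, mfderiv 𝓘(ℝ, ℝ) J γ 0 (1 : ℝ)⟩ : TangentBundle J N) = ⟨p, v⟩)
    (hf : MDifferentiableAt J 𝓘(ℝ, G) f p) :
    dirDeriv J f p v = deriv (fun t => f (γ t)) 0 := by
  obtain rfl : γ 0 = p := congrArg TotalSpace.proj e
  obtain rfl := TotalSpace.mk_injective _ e
  refine (dirDeriv_mfderiv hf hγ (1 : ℝ)).trans ?_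
  unfold dirDeriv
  rw [mfderiv_eq_fderiv]
  rfl

/-- The velocity of a curve in a product is the pair of the velocities of its components. -/
theorem tangent_prod_eq {E' : Type*} [NormedAddCommGroup E'] [NormedSpace ℝ E'] {K' : Type*}
    [TopologicalSpace K'] {J' : ModelWithCorners ℝ E' K'} {N' : Type*} [TopologicalSpace N']
    [ChartedSpace K' N'] {γ : ℝ → N} {γ' : ℝ → N'} {p : N} {p' : N'} {v : TangentSpace J p}
    {v' : TangentSpace J' p'} (hγ : MDifferentiableAt 𝓘(ℝ, ℝ) J γ 0)
    (hγ' : MDifferentiableAt 𝓘(ℝ, ℝ) J' γ' 0)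
    (e : (⟨γ 0, mfderiv 𝓘(ℝ, ℝ) J γ 0 (1 : ℝ)⟩ : TangentBundle J N) = ⟨p, v⟩)
    (e' : (⟨γ' 0, mfderiv 𝓘(ℝ, ℝ) J' γ' 0 (1 : ℝ)⟩ : TangentBundle J' N') = ⟨p', v'⟩) :
    (⟨(γ 0, γ' 0), mfderiv 𝓘(ℝ, ℝ) (J.prod J') (fun t => (γ t, γ' t)) 0 (1 : ℝ)⟩ :
      TangentBundle (J.prod J') (N × N')) = ⟨(p, p'), (v, v')⟩ := by
  obtain rfl : γ 0 = p := congrArg TotalSpace.proj e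
  obtain rfl := TotalSpace.mk_injective _ e
  obtain rfl : γ' 0 = p' := congrArg TotalSpace.proj e'
  obtain rfl := TotalSpace.mk_injective _ e'
  rw [mfderiv_prodMk hγ hγ']
  rfl

namespace IsCoordAt
variable [IsManifold J ∞ N] {κ : N → E} {p : N}

theorem tangent_eq (h : IsCoordAt J κ p) {q : N} (hq : q = p) {w : TangentSpace J q}
    {v : TangentSpace J p} (hv : dirDeriv J κ q w = dirDeriv J κ p v) :
    (⟨q, w⟩ : TangentBundle J N) = ⟨p, v⟩ := by
  subst hq
  rw [h.dirDeriv_inj.1 hv]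

/-- Every curve in coordinates is a curve in the manifold. -/
theorem exists_curve [J.Boundaryless] (h : IsCoordAt J κ p) {δ : ℝ → E} (hδ : ContDiffAt ℝ ∞ δ 0)
    (h0 : δ 0 = κ p) {v : TangentSpace J p} (hv : deriv δ 0 = dirDeriv J κ p v) :
    ∃ γ : ℝ → N, ContMDiffAt 𝓘(ℝ, ℝ) J ∞ γ 0 ∧
      (⟨γ 0, mfderiv 𝓘(ℝ, ℝ) J γ 0 (1 : ℝ)⟩ : TangentBundle J N) = ⟨p, v⟩ ∧
      ∀ᶠ t in 𝓝 0, κ (γ t) = δ t := by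
  obtain ⟨σ, h1, h2, -, h4⟩ := h.exists_inverse
  rw [← h0] at h1 h2 h4
  have hγ : ContMDiffAt 𝓘(ℝ, ℝ) J ∞ (fun t => σ (δ t)) 0 := h2.comp (0 : ℝ) hδ.contMDiffAt
  have h5 : ∀ᶠ t in 𝓝 0, κ (σ (δ t)) = δ t := hδ.continuousAt.eventually h4
  refine ⟨fun t => σ (δ t), hγ, h.tangent_eq h1 ?_, h5⟩
  rw [← hv]
  refine (dirDeriv_mfderiv (c := fun t => σ (δ t)) (t := (0 : ℝ)) (h1 ▸ h.mdifferentiableAt)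
    (hγ.mdifferentiableAt (by simp)) (1 : ℝ)).trans ?_
  refine (dirDeriv_congr h5 _).trans ?_
  unfold dirDeriv
  rw [mfderiv_eq_fderiv]
  rfl

end IsCoordAt
end curves

/-! ### The Tulczyjew isomorphism in coordinates -/

section tulczyjew
variable {EB : Type*} [NormedAddCommGroup EB] [NormedSpace ℝ EB] [FiniteDimensional ℝ EB]
  {H : Type*} [TopologicalSpace H]
  {I : ModelWithCorners ℝ EB H} [I.Boundaryless] {B : Type*} [TopologicalSpace B] [T2Space B]
  [ChartedSpace H B] [IsManifold I ∞ B]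
  {F : Type*} [NormedAddCommGroup F] [NormedSpace ℝ F] [FiniteDimensional ℝ F] {V : B → Type*}
  [TopologicalSpace (TotalSpace F V)] [∀ x, AddCommGroup (V x)] [∀ x, Module ℝ (V x)]
  [∀ x, TopologicalSpace (V x)] [FiberBundle F V] [VectorBundle ℝ F V]
  [ContMDiffVectorBundle ∞ F V I]

theorem mdifferentiableAt_localPairing (x : B)
    {p : TotalSpace F V × TotalSpace (F →L[ℝ] ℝ) (DualFiber V)}
    (h1 : p.1.proj ∈ coordDomain H F V x) (h2 : p.2.proj ∈ coordDomain H F V x) :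
    MDifferentiableAt ((I.prod 𝓘(ℝ, F)).prod (I.prod 𝓘(ℝ, F →L[ℝ] ℝ))) 𝓘(ℝ, ℝ)
      (localPairing x) p := by
  have h2' : p.2.proj ∈ coordDomain H (F →L[ℝ] ℝ) (DualFiber V) x := by rwa [coordDomain_dual]
  have e1 : MDifferentiableAt ((I.prod 𝓘(ℝ, F)).prod (I.prod 𝓘(ℝ, F →L[ℝ] ℝ))) 𝓘(ℝ, EB × F)
      (fun q : TotalSpace F V × TotalSpace (F →L[ℝ] ℝ) (DualFiber V) => tcoord I F V x q.1) p :=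
    (isCoordAt_tcoord (I := I) h1).mdifferentiableAt.comp p mdifferentiableAt_fst
  have e2 : MDifferentiableAt ((I.prod 𝓘(ℝ, F)).prod (I.prod 𝓘(ℝ, F →L[ℝ] ℝ)))
      𝓘(ℝ, EB × (F →L[ℝ] ℝ)) (fun q : TotalSpace F V × TotalSpace (F →L[ℝ] ℝ) (DualFiber V) =>
        tcoord I (F →L[ℝ] ℝ) (DualFiber V) x q.2) p :=
    (isCoordAt_tcoord (I := I) h2').mdifferentiableAt.comp p mdifferentiableAt_snd
  have e3 := e1.prodMk_space e2
  have e4 : DifferentiableAt ℝ (fun z : (EB × F) × (EB × (F →L[ℝ] ℝ)) => z.2.2 z.1.2)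
      (tcoord I F V x p.1, tcoord I (F →L[ℝ] ℝ) (DualFiber V) x p.2) := by fun_prop
  refine (MDifferentiableAt.comp p e4.mdifferentiableAt e3).congr_of_eventuallyEq ?_
  filter_upwards [continuousAt_snd.eventually (eventually_mem_coordDomain h2)] with q hq
  unfold localPairing
  have h3 := fcoord_dual_fcoord hq.1 q.2.2 (constSec F V x (fcoord F x q.1.2) q.2.proj)
  rw [fcoord_constSec hq.1] at h3
  exact h3.symm

theorem hasDerivAt_line {G : Type*} [NormedAddCommGroup G] [NormedSpace ℝ G] (g k : G) :
    HasDerivAt (fun t : ℝ => g + t • k) k 0 := by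
  simpa using ((hasDerivAt_id (0 : ℝ)).smul_const k).const_add g

theorem localPairing_eq {x x₀ : B} {w : TotalSpace F V} {w' : TotalSpace (F →L[ℝ] ℝ) (DualFiber V)}
    (h : w.proj = w'.proj) (h1 : w.proj ∈ coordDomain H F V x₀) (h2 : w.proj ∈ coordDomain H F V x) :
    localPairing x (w, w') = (tcoord I (F →L[ℝ] ℝ) (DualFiber V) x₀ w').2 (tcoord I F V x₀ w).2 := by
  obtain ⟨y, e⟩ := w
  obtain ⟨y', ψ⟩ := w'
  obtain rfl : y = y' := h
  change ψ (constSec F V x (fcoord F x e) y) =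
    fcoord (F →L[ℝ] ℝ) (V := DualFiber V) x₀ ψ (fcoord F x₀ e)
  rw [constSec_fcoord h2.1]
  exact (fcoord_dual_fcoord h1.1 ψ e).symm

/-- The tangent pairing in coordinates; the centre `x₀` of the coordinates is arbitrary. -/
theorem tangentPairing_eq {x₀ x : B} (hx : x ∈ coordDomain H F V x₀) {c : V x} {φ : DualFiber V x}
    {u : TangentSpace (I.prod 𝓘(ℝ, F)) (TotalSpace.mk' F x c)}
    {v : TangentSpace (I.prod 𝓘(ℝ, F →L[ℝ] ℝ)) (TotalSpace.mk' (F →L[ℝ] ℝ) x φ)}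
    {a : EB × F} {b : EB × (F →L[ℝ] ℝ)}
    (ha : dirDeriv (I.prod 𝓘(ℝ, F)) (tcoord I F V x₀) (TotalSpace.mk' F x c) u = a)
    (hb : dirDeriv (I.prod 𝓘(ℝ, F →L[ℝ] ℝ)) (tcoord I (F →L[ℝ] ℝ) (DualFiber V) x₀)
        (TotalSpace.mk' (F →L[ℝ] ℝ) x φ) v = b) (hab : a.1 = b.1) :
    tangentPairing u v =
      fcoord (F →L[ℝ] ℝ) (V := DualFiber V) x₀ φ a.2 + b.2 (fcoord F x₀ c) := by
  have hx' : x ∈ coordDomain H (F →L[ℝ] ℝ) (DualFiber V) x₀ := by rwa [coordDomain_dual]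
  have k1 : IsCoordAt (I.prod 𝓘(ℝ, F)) (tcoord I F V x₀) (TotalSpace.mk' F x c) :=
    isCoordAt_tcoord (w := TotalSpace.mk' F x c) hx
  have k2 : IsCoordAt (I.prod 𝓘(ℝ, F →L[ℝ] ℝ)) (tcoord I (F →L[ℝ] ℝ) (DualFiber V) x₀)
      (TotalSpace.mk' (F →L[ℝ] ℝ) x φ) :=
    isCoordAt_tcoord (w := TotalSpace.mk' (F →L[ℝ] ℝ) x φ) hx'
  obtain ⟨γ, s1, t1, c1⟩ := k1.exists_curve
    (δ := fun t => tcoord I F V x₀ (TotalSpace.mk' F x c) + t • a)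
    (v := u) (by fun_prop) (by simp) ((hasDerivAt_line _ _).deriv.trans ha.symm)
  obtain ⟨η, s2, t2, c2⟩ := k2.exists_curve
    (δ := fun t => tcoord I (F →L[ℝ] ℝ) (DualFiber V) x₀ (TotalSpace.mk' (F →L[ℝ] ℝ) x φ) + t • b)
    (v := v) (by fun_prop) (by simp) ((hasDerivAt_line _ _).deriv.trans hb.symm)
  have s1' := s1.mdifferentiableAt (by simp)
  have s2' := s2.mdifferentiableAt (by simp)
  have hp := tangent_prod_eq s1' s2' t1 t2
  refine (dirDeriv_eq_deriv (s1'.prodMk s2') hp (mdifferentiableAt_localPairing x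
    (mem_coordDomain_self H F V x) (mem_coordDomain_self H F V x))).trans ?_
  have q1 : γ 0 = TotalSpace.mk' F x c := congrArg TotalSpace.proj t1
  have q2 : η 0 = TotalSpace.mk' (F →L[ℝ] ℝ) x φ := congrArg TotalSpace.proj t2
  have n1 : Filter.Tendsto γ (𝓝 0) (𝓝 (TotalSpace.mk' F x c)) := q1 ▸ s1.continuousAt.tendsto
  have n2 : Filter.Tendsto η (𝓝 0) (𝓝 (TotalSpace.mk' (F →L[ℝ] ℝ) x φ)) :=
    q2 ▸ s2.continuousAt.tendsto
  have m1 := n1.eventually (eventually_mem_coordDomain (w := TotalSpace.mk' F x c) hx)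
  have m2 := n2.eventually (eventually_mem_coordDomain
    (w := TotalSpace.mk' (F →L[ℝ] ℝ) x φ) hx)
  have m3 := n1.eventually (eventually_mem_coordDomain (w := TotalSpace.mk' F x c)
    (mem_coordDomain_self H F V x))
  -- Both curves lie over the same curve in the base, so the local pairing is the pairing.
  have key : (fun t => localPairing x (γ t, η t)) =ᶠ[𝓝 0] fun t =>
      (fcoord (F →L[ℝ] ℝ) (V := DualFiber V) x₀ φ + t • b.2) (fcoord F x₀ c + t • a.2) := by
    filter_upwards [c1, c2, m1, m2, m3] with t e1 e2 m1 m2 m3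
    have hbase : (γ t).proj = (η t).proj := by
      refine (extChartAt I x₀).injOn (by simpa using m1.2) (by simpa using m2.2) ?_
      refine (congrArg Prod.fst e1).trans (Eq.trans ?_ (congrArg Prod.fst e2).symm)
      change extChartAt I x₀ x + t • a.1 = extChartAt I x₀ x + t • b.1
      rw [hab]
    rw [localPairing_eq (I := I) hbase m1 m3, e1, e2]
    rfl
  rw [Filter.EventuallyEq.deriv_eq key]
  have h1 := (hasDerivAt_line (fcoord (F →L[ℝ] ℝ) (V := DualFiber V) x₀ φ) b.2).clm_apply
    (hasDerivAt_line (fcoord F x₀ c) a.2)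
  rw [h1.deriv]
  simp [add_comm]

/-- The Lagrangian as a function of the coordinates around `x₀`. -/
noncomputable def coordLagrangian (I : ModelWithCorners ℝ EB H) (L : TotalSpace F V → ℝ) (x₀ : B)
    (z : EB × F) : ℝ :=
  L ((extChartAt (I.prod 𝓘(ℝ, F)) (⟨x₀, 0⟩ : TotalSpace F V)).symm z)

/-- The momenta `∂ℓ/∂β`, where `ℓ` is the Lagrangian as a function of the coordinates `(x, β)`. -/
noncomputable def momentum (I : ModelWithCorners ℝ EB H) (L : TotalSpace F V → ℝ) (x₀ : B)
    (z : EB × F) : F →L[ℝ] ℝ :=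
  (fderiv ℝ (coordLagrangian I L x₀) z).comp (ContinuousLinearMap.inr ℝ EB F)

/-- The derivatives of the momenta along the admissible solutions of the Euler-Lagrange equations:
`∂ℓ/∂x ∘ ρ + ∂ℓ/∂β ∘ C(β, ·)`. -/
noncomputable def LieAlgebroid.force (A : LieAlgebroid I F V) (L : TotalSpace F V → ℝ) (x₀ : B)
    (z : EB × F) : F →L[ℝ] ℝ :=
  (fderiv ℝ (coordLagrangian I L x₀) z).comp
    ((A.anchorFun x₀ z.1).prod (A.structFun x₀ z.1 z.2))

theorem momentum_apply (L : TotalSpace F V → ℝ) (x₀ : B) (z : EB × F) (c : F) :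
    momentum I L x₀ z c = fderiv ℝ (coordLagrangian I L x₀) z (0, c) := rfl

theorem LieAlgebroid.force_apply (A : LieAlgebroid I F V) (L : TotalSpace F V → ℝ) (x₀ : B)
    (z : EB × F) (c : F) : A.force L x₀ z c =
      fderiv ℝ (coordLagrangian I L x₀) z (A.anchorFun x₀ z.1 c, A.structFun x₀ z.1 z.2 c) := rfl

theorem contDiffAt_clm_prod {G E₁ E₂ E₃ : Type*} [NormedAddCommGroup G] [NormedSpace ℝ G]
    [NormedAddCommGroup E₁] [NormedSpace ℝ E₁] [NormedAddCommGroup E₂] [NormedSpace ℝ E₂]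
    [NormedAddCommGroup E₃] [NormedSpace ℝ E₃] {f : G → E₁ →L[ℝ] E₂} {g : G → E₁ →L[ℝ] E₃} {z : G}
    (hf : ContDiffAt ℝ ∞ f z) (hg : ContDiffAt ℝ ∞ g z) :
    ContDiffAt ℝ ∞ (fun y => (f y).prod (g y)) z :=
  (ContinuousLinearMap.prodₗᵢ (𝕜 := ℝ) (E := E₁) (F := E₂) (G := E₃) ℝ).contDiff.contDiffAt.comp z
    (hf.prodMk hg)

section
variable {L : TotalSpace F V → ℝ} {x₀ : B} {a : TotalSpace F V}

theorem eventually_coordLagrangian (L : TotalSpace F V → ℝ) (ha : a.proj ∈ coordDomain H F V x₀) :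
    ∀ᶠ y in 𝓝 a, L y = coordLagrangian I L x₀ (tcoord I F V x₀ y) := by
  obtain ⟨h1, h2⟩ := tcoord_eventuallyEq (I := I) ha (⟨x₀, 0⟩ : TotalSpace F V) rfl
  filter_upwards [h2, (chartAt (ModelProd H F) (⟨x₀, 0⟩ : TotalSpace F V)).open_source.mem_nhds h1]
    with y h3 h4
  unfold coordLagrangian
  rw [h3, (extChartAt (I.prod 𝓘(ℝ, F)) (⟨x₀, 0⟩ : TotalSpace F V)).left_inv
    (by rwa [extChartAt_source])]

theorem contDiffAt_coordLagrangian (hL : ContMDiff (I.prod 𝓘(ℝ, F)) 𝓘(ℝ, ℝ) ∞ L)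
    (ha : a.proj ∈ coordDomain H F V x₀) :
    ContDiffAt ℝ ∞ (coordLagrangian I L x₀) (tcoord I F V x₀ a) := by
  obtain ⟨h1, h2⟩ := tcoord_eventuallyEq (I := I) ha (⟨x₀, 0⟩ : TotalSpace F V) rfl
  rw [h2.eq_of_nhds]
  exact contDiffAt_comp_extChartAt_symm h1 hL.contMDiffAt

theorem dirDeriv_lagrangian (hL : ContMDiff (I.prod 𝓘(ℝ, F)) 𝓘(ℝ, ℝ) ∞ L)
    (ha : a.proj ∈ coordDomain H F V x₀) (v : TangentSpace (I.prod 𝓘(ℝ, F)) a) :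
    dirDeriv (I.prod 𝓘(ℝ, F)) L a v = fderiv ℝ (coordLagrangian I L x₀) (tcoord I F V x₀ a)
      (dirDeriv (I.prod 𝓘(ℝ, F)) (tcoord I F V x₀) a v) :=
  (isCoordAt_tcoord ha).dirDeriv_eq (eventually_coordLagrangian L ha)
    ((contDiffAt_coordLagrangian hL ha).differentiableAt (by simp)) v

theorem contDiffAt_momentum (hL : ContMDiff (I.prod 𝓘(ℝ, F)) 𝓘(ℝ, ℝ) ∞ L)
    (ha : a.proj ∈ coordDomain H F V x₀) :
    ContDiffAt ℝ ∞ (momentum I L x₀) (tcoord I F V x₀ a) :=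
  ((contDiffAt_coordLagrangian hL ha).fderiv_right (m := ∞) (by simp)).clm_comp contDiffAt_const

set_option synthInstance.maxHeartbeats 200000 in
theorem LieAlgebroid.contDiffAt_force (A : LieAlgebroid I F V)
    (hL : ContMDiff (I.prod 𝓘(ℝ, F)) 𝓘(ℝ, ℝ) ∞ L) (ha : a.proj ∈ coordDomain H F V x₀) :
    ContDiffAt ℝ ∞ (A.force L x₀) (tcoord I F V x₀ a) := by
  have h1 : ContDiffAt ℝ ∞ (fun z : EB × F => A.structFun x₀ z.1) (tcoord I F V x₀ a) :=
    ContDiffAt.comp (g := A.structFun x₀) (f := Prod.fst) (tcoord I F V x₀ a)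
      (A.contDiffAt_structFun ha) contDiffAt_fst
  have h2 : ContDiffAt ℝ ∞ (fun z : EB × F => A.anchorFun x₀ z.1) (tcoord I F V x₀ a) :=
    ContDiffAt.comp (g := A.anchorFun x₀) (f := Prod.fst) (tcoord I F V x₀ a)
      (A.contDiffAt_anchorFun ha) contDiffAt_fst
  have h3 := (contDiffAt_coordLagrangian hL ha).fderiv_right (m := ∞) (by simp)
  have h4 : ContDiffAt ℝ ∞ (fun z : EB × F => (A.anchorFun x₀ z.1).prod (A.structFun x₀ z.1 z.2))
      (tcoord I F V x₀ a) := by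
    exact contDiffAt_clm_prod h2 (h1.clm_apply contDiffAt_snd)
  exact h3.clm_comp h4

end

namespace LieAlgebroid
variable (A : LieAlgebroid I F V)

/-- The map `A_E` in coordinates. -/
theorem tulczyjew_snd {x₀ : B}
    {p : TotalSpace (F × (F →L[ℝ] ℝ)) (Prol (F →L[ℝ] ℝ) (DualFiber V) A.anchor)}
    (hx : p.proj.proj ∈ coordDomain H F V x₀) (u : Prol F V A.anchor (⟨p.proj.proj, p.2.fst⟩ : TotalSpace F V)) :
    (A.tulczyjew p).2 u = (pcoord A.anchor x₀ p).1.2 ((Prol.coord x₀ u).2 -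
        A.structFun x₀ (pcoord A.anchor x₀ p).1.1 (pcoord A.anchor x₀ p).2.1 (Prol.coord x₀ u).1) +
      (pcoord A.anchor x₀ p).2.2 (Prol.coord x₀ u).1 := by
  have hx' : p.proj.proj ∈ coordDomain H (F →L[ℝ] ℝ) (DualFiber V) x₀ := by rwa [coordDomain_dual]
  have h1 := A.dirDeriv_involutionVec (w := (⟨p.proj.proj, p.2.fst⟩ : TotalSpace F V)) hx u
  have h2 := Prol.dirDeriv_tcoord_snd hx hx' p.2
  exact tangentPairing_eq hx (φ := p.proj.2) (u := A.involutionVec _ u) (v := p.2.snd) h1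
    (b := (A.anchorFun x₀ (extChartAt I x₀ p.proj.proj) (Prol.coord x₀ p.2).1,
      (Prol.coord x₀ p.2).2)) h2 rfl

theorem mem_lagrangianSet_iff {L : TotalSpace F V → ℝ}
    {p : TotalSpace (F × (F →L[ℝ] ℝ)) (Prol (F →L[ℝ] ℝ) (DualFiber V) A.anchor)} :
    p ∈ A.lagrangianSet L ↔
      A.tulczyjew p = A.dLagrangian L (⟨p.proj.proj, p.2.fst⟩ : TotalSpace F V) := by
  constructor
  · rintro ⟨a, ha⟩
    have h1 : a = ⟨p.proj.proj, p.2.fst⟩ := congrArg Sigma.fst ha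
    rw [← ha, ← h1]
  · intro h
    exact ⟨_, h.symm⟩

/-- The set `S_L` in coordinates: `φ = ∂ℓ/∂β` and `ζ = ∂ℓ/∂x ∘ ρ + ∂ℓ/∂β ∘ C(β, ·)` at `(x, β)`. -/
theorem mem_lagrangianSet_iff_coord {L : TotalSpace F V → ℝ}
    (hL : ContMDiff (I.prod 𝓘(ℝ, F)) 𝓘(ℝ, ℝ) ∞ L) {x₀ : B}
    {p : TotalSpace (F × (F →L[ℝ] ℝ)) (Prol (F →L[ℝ] ℝ) (DualFiber V) A.anchor)}
    (hx : p.proj.proj ∈ coordDomain H F V x₀) :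
    p ∈ A.lagrangianSet L ↔
      (pcoord A.anchor x₀ p).1.2 =
        momentum I L x₀ ((pcoord A.anchor x₀ p).1.1, (pcoord A.anchor x₀ p).2.1) ∧
      (pcoord A.anchor x₀ p).2.2 =
        A.force L x₀ ((pcoord A.anchor x₀ p).1.1, (pcoord A.anchor x₀ p).2.1) := by
  rw [mem_lagrangianSet_iff]
  have h1 : A.tulczyjew p = A.dLagrangian L (⟨p.proj.proj, p.2.fst⟩ : TotalSpace F V) ↔
      ∀ u : Prol F V A.anchor (⟨p.proj.proj, p.2.fst⟩ : TotalSpace F V),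
        (A.tulczyjew p).2 u = dirDeriv (I.prod 𝓘(ℝ, F)) L _ u.snd := by
    constructor
    · intro h u
      exact congrFun (eq_of_heq (Sigma.mk.inj h).2) u
    · intro h
      exact Sigma.ext rfl (heq_of_eq (funext h))
  rw [h1]
  have h2 : ∀ u : Prol F V A.anchor (⟨p.proj.proj, p.2.fst⟩ : TotalSpace F V),
      dirDeriv (I.prod 𝓘(ℝ, F)) L _ u.snd =
      fderiv ℝ (coordLagrangian I L x₀) ((pcoord A.anchor x₀ p).1.1, (pcoord A.anchor x₀ p).2.1)
        (A.anchorFun x₀ (pcoord A.anchor x₀ p).1.1 (Prol.coord x₀ u).1, (Prol.coord x₀ u).2) := by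
    intro u
    rw [dirDeriv_lagrangian hL (a := (⟨p.proj.proj, p.2.fst⟩ : TotalSpace F V)) hx,
      Prol.dirDeriv_tcoord_snd (w := (⟨p.proj.proj, p.2.fst⟩ : TotalSpace F V)) hx hx]
    rfl
  set q := pcoord A.anchor x₀ p
  set D := fderiv ℝ (coordLagrangian I L x₀) (q.1.1, q.2.1) with hD
  have h3 : ∀ a b, D (a, b) = D (a, 0) + D (0, b) := fun a b => by
    rw [← map_add]; simp
  constructor
  · intro h
    have h4 : ∀ k : F × F, q.1.2 (k.2 - A.structFun x₀ q.1.1 q.2.1 k.1) + q.2.2 k.1 =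
        D (A.anchorFun x₀ q.1.1 k.1, k.2) := by
      intro k
      obtain ⟨u, hu⟩ := Prol.exists_coord_eq A
        (w := (⟨p.proj.proj, p.2.fst⟩ : TotalSpace F V)) hx hx k
      have h5 := h u
      rw [A.tulczyjew_snd hx, h2, hu] at h5
      exact h5
    have h5 : ∀ b, q.1.2 b = D (0, b) := fun b => by simpa using h4 (0, b)
    refine ⟨ContinuousLinearMap.ext h5, ContinuousLinearMap.ext fun c => ?_⟩
    have h6 := h4 (c, 0)
    rw [zero_sub, map_neg] at h6
    rw [force_apply, ← hD, h3, ← h5, ← h6]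
    dsimp only
    ring
  · rintro ⟨h4, h5⟩ u
    have h6 : ∀ b, q.1.2 b = D (0, b) := fun b => by rw [h4]; rfl
    rw [A.tulczyjew_snd hx, h2, h3, map_sub]
    change q.1.2 _ - q.1.2 _ + q.2.2 _ = _
    rw [h5, force_apply, ← hD, h3 (A.anchorFun x₀ _ _) (A.structFun x₀ _ _ _), ← h6, ← h6]
    ring

end LieAlgebroid
end tulczyjew

/-! ### The complete lift in coordinates -/

section completeLift
variable {EB : Type*} [NormedAddCommGroup EB] [NormedSpace ℝ EB]
  {H : Type*} [TopologicalSpace H]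
  {I : ModelWithCorners ℝ EB H} [I.Boundaryless] {B : Type*} [TopologicalSpace B]
  [ChartedSpace H B] [IsManifold I ∞ B]
  {F : Type*} [NormedAddCommGroup F] [NormedSpace ℝ F] {V : B → Type*}
  [TopologicalSpace (TotalSpace F V)] [∀ x, AddCommGroup (V x)] [∀ x, Module ℝ (V x)]
  [∀ x, TopologicalSpace (V x)] [FiberBundle F V] [VectorBundle ℝ F V]
  [ContMDiffVectorBundle ∞ F V I]

namespace RawAlgebroid
variable (D : RawAlgebroid I V)

/-- The complete lift of a section that is constant in the preferred trivialization: its vertical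
component at `p` is `-⟦X, Y⟧`, where `Y` is the section with constant coordinates through `p`. -/
theorem isCompleteLiftVec_iff (p : TotalSpace F V) (b : V p.proj)
    (v : TangentSpace (I.prod 𝓘(ℝ, F)) p) :
    D.IsCompleteLiftVec p b v ↔
      mfderiv (I.prod 𝓘(ℝ, F)) I (π F V) p v = D.anchor p.proj b ∧
      (dirDeriv (I.prod 𝓘(ℝ, F)) (tcoord I F V p.proj) p v).2 =
        -fcoord F p.proj (D.bracket (FiberBundle.extend F b) (FiberBundle.extend F p.2) p.proj) := by
  have hx := mem_coordDomain_self H F V p.proj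
  refine and_congr_right fun hv => ?_
  have h1 : ∀ {α : ∀ y, DualFiber V y} (_ : ContMDiffAt I (I.prod 𝓘(ℝ, F →L[ℝ] ℝ)) ∞
      (fun y => TotalSpace.mk' (F →L[ℝ] ℝ) y (α y)) p.proj),
      dirDeriv (I.prod 𝓘(ℝ, F)) (fun q : TotalSpace F V => (α q.proj q.2 : ℝ)) p v =
        D.d1 F (fun y e => α y e) p.proj b p.2 +
        D.d0 (fun y => (α y (FiberBundle.extend F b y) : ℝ)) p.proj p.2 ↔
      dualRep I p.proj α (extChartAt I p.proj p.proj)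
        (dirDeriv (I.prod 𝓘(ℝ, F)) (tcoord I F V p.proj) p v).2 =
      dualRep I p.proj α (extChartAt I p.proj p.proj)
        (-fcoord F p.proj (D.bracket (FiberBundle.extend F b) (FiberBundle.extend F p.2) p.proj)) := by
    intro α hα
    have h2 : D.d0 (fun y => (α y (FiberBundle.extend F p.2 y) : ℝ)) p.proj b =
        fderiv ℝ (dualRep I p.proj α) (extChartAt I p.proj p.proj)
          (dirDeriv I (extChartAt I p.proj) p.proj (D.anchor p.proj b)) (fcoord F p.proj p.2) := by
      have h3 := ((contDiffAt_dualRep hx hα).differentiableAt (by simp)).hasFDerivAt.clm_apply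
        (hasFDerivAt_const (fcoord F p.proj p.2) _)
      change dirDeriv I _ p.proj (D.anchor p.proj b) = _
      rw [(isCoordAt_extChartAt (J := I) hx.2).dirDeriv_eq
        (g := fun z => dualRep I p.proj α z (fcoord F p.proj p.2)) ?_ h3.differentiableAt, h3.fderiv]
      · simp
      · filter_upwards [eventually_dualRep (I := I) hx α,
          (isOpen_coordDomain H F V p.proj).mem_nhds hx] with y h4 h5
        rw [h4, extend_eq_constSec, fcoord_constSec h5.1]
    unfold d1
    rw [dirDeriv_hat hx hα, dirDeriv_tcoord_fst hx, hv, h2]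
    change _ ↔ _ = dualRep I p.proj α _ (-_)
    rw [map_neg, ← (eventually_dualRep (I := I) hx α).self_of_nhds]
    constructor <;> intro h <;> linarith
  constructor
  · intro h
    rw [SeparatingDual.eq_iff_forall_dual_eq (R := ℝ)]
    intro k
    have hk := contMDiffAt_constSec_dual (I := I) (V := V) hx k
    have h5 := (h1 hk).1 (h _ hk)
    rwa [dualRep_constSec hx] at h5
  · intro h α hα
    rw [h1 hα, h]

/-- The vertical part of an element of the prolongation, in the preferred coordinates. -/
theorem fcoord_verticalPart (p : TotalSpace F V) (u : prolFiber (FW := F) (W := V) D.anchor p) :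
    fcoord F p.proj (D.verticalPart p u) =
      (dirDeriv (I.prod 𝓘(ℝ, F)) (tcoord I F V p.proj) p u.1.2).2 + fcoord F p.proj
        (D.bracket (FiberBundle.extend F u.1.1) (FiberBundle.extend F p.2) p.proj) := by
  have hx := mem_coordDomain_self H F V p.proj
  have h1 : ∀ κ : V p.proj, D.IsCompleteLiftVec p u.1.1 (u.1.2 - vlift p κ) ↔
      fcoord F p.proj κ = (dirDeriv (I.prod 𝓘(ℝ, F)) (tcoord I F V p.proj) p u.1.2).2 +
        fcoord F p.proj
        (D.bracket (FiberBundle.extend F u.1.1) (FiberBundle.extend F p.2) p.proj) := by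
    intro κ
    have h2 : mfderiv (I.prod 𝓘(ℝ, F)) I (π F V) p (u.1.2 - vlift p κ) = D.anchor p.proj u.1.1 := by
      refine (map_sub (mfderiv (I.prod 𝓘(ℝ, F)) I (π F V) p) _ _).trans ?_
      rw [mfderiv_proj_vlift, sub_zero]
      exact (mem_prolFiber.1 u.2).symm
    rw [isCompleteLiftVec_iff, and_iff_right h2, dirDeriv_sub, dirDeriv_tcoord_vlift hx,
      Prod.snd_sub, sub_eq_iff_eq_add, neg_add_eq_sub, eq_sub_iff_add_eq, eq_comm]
  have h3 : ∃ κ : V p.proj, D.IsCompleteLiftVec p u.1.1 (u.1.2 - vlift p κ) :=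
    ⟨constSec F V p.proj _ p.proj, (h1 _).2 (fcoord_constSec hx.1 _)⟩
  unfold verticalPart
  rw [dif_pos h3]
  exact (h1 _).1 h3.choose_spec

end RawAlgebroid
end completeLift

section prolongationCoord
variable {EB : Type*} [NormedAddCommGroup EB] [NormedSpace ℝ EB]
  {H : Type*} [TopologicalSpace H]
  {I : ModelWithCorners ℝ EB H} {B : Type*} [TopologicalSpace B]
  [ChartedSpace H B] [IsManifold I ∞ B]
  {F : Type*} [NormedAddCommGroup F] [NormedSpace ℝ F] {V : B → Type*}
  [TopologicalSpace (TotalSpace F V)] [∀ x, AddCommGroup (V x)] [∀ x, Module ℝ (V x)]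
  [∀ x, TopologicalSpace (V x)] [FiberBundle F V] [VectorBundle ℝ F V]
  [ContMDiffVectorBundle ∞ F V I]
  {FW : Type*} [NormedAddCommGroup FW] [NormedSpace ℝ FW] {W : B → Type*}
  [TopologicalSpace (TotalSpace FW W)] [∀ x, AddCommGroup (W x)] [∀ x, Module ℝ (W x)]
  [∀ x, TopologicalSpace (W x)] [FiberBundle FW W] [VectorBundle ℝ FW W]
  [ContMDiffVectorBundle ∞ FW W I]

theorem pcoord_eventuallyEq (ρ : Cₛ^∞⟮I; F →L[ℝ] EB, fun x => V x →L[ℝ] TangentSpace I x⟯) {x₀ : B}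
    {p : TotalSpace (F × FW) (Prol FW W ρ)} (hV : p.proj.proj ∈ coordDomain H F V x₀)
    (hW : p.proj.proj ∈ coordDomain H FW W x₀) (w₀ : TotalSpace FW W) (hw₀ : w₀.proj = x₀) :
    pcoord ρ x₀ =ᶠ[𝓝 p] tcoord (I.prod 𝓘(ℝ, FW)) (F × FW) (Prol FW W ρ) w₀ := by
  have h3 := (tcoord_eventuallyEq (I := I) hW w₀ hw₀).2
  filter_upwards [(FiberBundle.continuous_proj (F × FW) (Prol FW W ρ)).continuousAt.eventually h3,
    (FiberBundle.continuous_proj (F × FW) (Prol FW W ρ)).continuousAt.eventually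
      (eventually_mem_coordDomain hW),
    (FiberBundle.continuous_proj (F × FW) (Prol FW W ρ)).continuousAt.eventually
      (eventually_mem_coordDomain hV)] with q h4 h5 h6
  exact Prod.ext h4 (Prol.fcoord_eq_coord h6 h5 w₀ hw₀ q.2).symm

theorem isCoordAt_pcoord (ρ : Cₛ^∞⟮I; F →L[ℝ] EB, fun x => V x →L[ℝ] TangentSpace I x⟯) {x₀ : B}
    {p : TotalSpace (F × FW) (Prol FW W ρ)} (hV : p.proj.proj ∈ coordDomain H F V x₀)
    (hW : p.proj.proj ∈ coordDomain H FW W x₀) :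
    IsCoordAt ((I.prod 𝓘(ℝ, FW)).prod 𝓘(ℝ, F × FW)) (pcoord ρ x₀) p := by
  have hp : p.proj ∈ coordDomain (ModelProd H FW) (F × FW) (Prol FW W ρ) ⟨x₀, 0⟩ :=
    (Prol.mem_coordDomain ρ).2 ⟨hV, hW⟩
  obtain ⟨h1, h2⟩ := tcoord_eventuallyEq (I := I.prod 𝓘(ℝ, FW)) hp ⟨⟨x₀, 0⟩, 0⟩ rfl
  exact ⟨_, h1, (pcoord_eventuallyEq ρ hV hW _ rfl).trans h2⟩

theorem dirDeriv_pcoord_fst (ρ : Cₛ^∞⟮I; F →L[ℝ] EB, fun x => V x →L[ℝ] TangentSpace I x⟯) {x₀ : B}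
    {p : TotalSpace (F × FW) (Prol FW W ρ)} (hV : p.proj.proj ∈ coordDomain H F V x₀)
    (hW : p.proj.proj ∈ coordDomain H FW W x₀)
    (v : TangentSpace ((I.prod 𝓘(ℝ, FW)).prod 𝓘(ℝ, F × FW)) p) :
    (dirDeriv ((I.prod 𝓘(ℝ, FW)).prod 𝓘(ℝ, F × FW)) (pcoord ρ x₀) p v).1 =
      dirDeriv (I.prod 𝓘(ℝ, FW)) (tcoord I FW W x₀) p.proj
        (mfderiv ((I.prod 𝓘(ℝ, FW)).prod 𝓘(ℝ, F × FW)) (I.prod 𝓘(ℝ, FW))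
          (π (F × FW) (Prol FW W ρ)) p v) := by
  have hp : p.proj ∈ coordDomain (ModelProd H FW) (F × FW) (Prol FW W ρ) ⟨x₀, 0⟩ :=
    (Prol.mem_coordDomain ρ).2 ⟨hV, hW⟩
  rw [dirDeriv_congr (pcoord_eventuallyEq ρ hV hW ⟨x₀, 0⟩ rfl), dirDeriv_tcoord_fst hp,
    dirDeriv_congr (tcoord_eventuallyEq (I := I) hW (⟨x₀, 0⟩ : TotalSpace FW W) rfl).2]

end prolongationCoord

section completeLiftCanonical
variable {EB : Type*} [NormedAddCommGroup EB] [NormedSpace ℝ EB] [FiniteDimensional ℝ EB]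
  {H : Type*} [TopologicalSpace H]
  {I : ModelWithCorners ℝ EB H} [I.Boundaryless] {B : Type*} [TopologicalSpace B] [T2Space B]
  [ChartedSpace H B] [IsManifold I ∞ B]
  {F : Type*} [NormedAddCommGroup F] [NormedSpace ℝ F] [FiniteDimensional ℝ F] {V : B → Type*}
  [TopologicalSpace (TotalSpace F V)] [∀ x, AddCommGroup (V x)] [∀ x, Module ℝ (V x)]
  [∀ x, TopologicalSpace (V x)] [FiberBundle F V] [VectorBundle ℝ F V]
  [ContMDiffVectorBundle ∞ F V I]

namespace LieAlgebroid
variable (A : LieAlgebroid I F V)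

/-- The fibre coordinates `((b, ξ), (β', ζ'))` of an element `((b, v), V)` of the prolongation of
`𝓛 = Prol E* E` over itself, in the preferred coordinates around the base point: `b` and `ξ` are the
coordinates of `(b, v)`, and `β'` and `ζ'` are the vertical coordinates of `V`. -/
noncomputable def doubleCoord
    {p : TotalSpace (F × (F →L[ℝ] ℝ)) (Prol (F →L[ℝ] ℝ) (DualFiber V) A.anchor)}
    (u : prolFiber (FW := F × (F →L[ℝ] ℝ)) (W := Prol (F →L[ℝ] ℝ) (DualFiber V) A.anchor)
      (A.prol (F →L[ℝ] ℝ) (DualFiber V)).anchor p) :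
    (F × (F →L[ℝ] ℝ)) × (F × (F →L[ℝ] ℝ)) :=
  (Prol.coord p.proj.proj u.1.1,
    (dirDeriv ((I.prod 𝓘(ℝ, F →L[ℝ] ℝ)).prod 𝓘(ℝ, F × (F →L[ℝ] ℝ)))
      (pcoord A.anchor p.proj.proj) p u.1.2).2)

variable {p : TotalSpace (F × (F →L[ℝ] ℝ)) (Prol (F →L[ℝ] ℝ) (DualFiber V) A.anchor)}

theorem dirDeriv_pcoord_snd
    (u : prolFiber (FW := F × (F →L[ℝ] ℝ)) (W := Prol (F →L[ℝ] ℝ) (DualFiber V) A.anchor)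
      (A.prol (F →L[ℝ] ℝ) (DualFiber V)).anchor p) :
    dirDeriv ((I.prod 𝓘(ℝ, F →L[ℝ] ℝ)).prod 𝓘(ℝ, F × (F →L[ℝ] ℝ)))
      (pcoord A.anchor p.proj.proj) p u.1.2 =
      ((A.anchorFun p.proj.proj (extChartAt I p.proj.proj p.proj.proj) (A.doubleCoord u).1.1,
        (A.doubleCoord u).1.2), (A.doubleCoord u).2) := by
  have hx := mem_coordDomain_self H F V p.proj.proj
  have hx' := mem_coordDomain_self H (F →L[ℝ] ℝ) (DualFiber V) p.proj.proj
  refine Prod.ext ?_ rfl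
  rw [dirDeriv_pcoord_fst A.anchor hx hx', ← mem_prolFiber.1 u.2]
  exact Prol.dirDeriv_tcoord_snd hx hx' u.1.1

theorem exists_doubleCoord_eq (p : TotalSpace (F × (F →L[ℝ] ℝ))
      (Prol (F →L[ℝ] ℝ) (DualFiber V) A.anchor)) (k : (F × (F →L[ℝ] ℝ)) × (F × (F →L[ℝ] ℝ))) :
    ∃ u : prolFiber (FW := F × (F →L[ℝ] ℝ)) (W := Prol (F →L[ℝ] ℝ) (DualFiber V) A.anchor)
      (A.prol (F →L[ℝ] ℝ) (DualFiber V)).anchor p, A.doubleCoord u = k := by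
  have hx := mem_coordDomain_self H F V p.proj.proj
  have hx' := mem_coordDomain_self H (F →L[ℝ] ℝ) (DualFiber V) p.proj.proj
  obtain ⟨b, hb⟩ := Prol.exists_coord_eq A (w := p.proj) hx hx' k.1
  obtain ⟨v, hv⟩ := (isCoordAt_pcoord A.anchor hx hx').exists_dirDeriv_eq
    (dirDeriv (I.prod 𝓘(ℝ, F →L[ℝ] ℝ)) (tcoord I (F →L[ℝ] ℝ) (DualFiber V) p.proj.proj) p.proj b.snd,
      k.2)
  refine ⟨⟨(b, v), ?_⟩, Prod.ext hb (by
    have h3 := congrArg Prod.snd hv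
    exact h3)⟩
  rw [mem_prolFiber, ← (isCoordAt_tcoord (I := I) hx').dirDeriv_inj,
    ← dirDeriv_pcoord_fst A.anchor hx hx']
  exact (congrArg Prod.fst hv).symm

theorem coord_verticalPart
    (u : prolFiber (FW := F × (F →L[ℝ] ℝ)) (W := Prol (F →L[ℝ] ℝ) (DualFiber V) A.anchor)
      (A.prol (F →L[ℝ] ℝ) (DualFiber V)).anchor p) :
    Prol.coord p.proj.proj ((A.prol (F →L[ℝ] ℝ) (DualFiber V)).verticalPart p u) =
      ((A.doubleCoord u).2.1 + A.structFun p.proj.proj (extChartAt I p.proj.proj p.proj.proj)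
        (A.doubleCoord u).1.1 (pcoord A.anchor p.proj.proj p).2.1, (A.doubleCoord u).2.2) := by
  have hx := mem_coordDomain_self H F V p.proj.proj
  have hx' := mem_coordDomain_self H (F →L[ℝ] ℝ) (DualFiber V) p.proj.proj
  have h1 := (A.prol (F →L[ℝ] ℝ) (DualFiber V)).fcoord_verticalPart p u
  rw [Prol.fcoord_eq_coord hx hx' p.proj rfl, Prol.fcoord_eq_coord hx hx' p.proj rfl,
    A.coord_prol_bracket_extend u.1.1 p.2,
    ← dirDeriv_congr (pcoord_eventuallyEq A.anchor hx hx' p.proj rfl)] at h1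
  refine h1.trans (Prod.ext rfl ?_)
  exact add_zero _

set_option synthInstance.maxHeartbeats 400000 in
/-- The complete lift of the canonical symplectic section in coordinates. -/
theorem completeLift_eq
    (u u' : prolFiber (FW := F × (F →L[ℝ] ℝ)) (W := Prol (F →L[ℝ] ℝ) (DualFiber V) A.anchor)
      (A.prol (F →L[ℝ] ℝ) (DualFiber V)).anchor p) {x : EB} {φ ζ ξ ξ' η η' : F →L[ℝ] ℝ}
    {β b b' a a' : F} (hp : pcoord A.anchor p.proj.proj p = ((x, φ), (β, ζ)))
    (hu : A.doubleCoord u = ((b, ξ), (a, η))) (hu' : A.doubleCoord u' = ((b', ξ'), (a', η'))) :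
    (A.prol (F →L[ℝ] ℝ) (DualFiber V)).completeLift A.canonicalTwo p u u' =
      ζ (A.structFun p.proj.proj x b b') +
      φ (fderiv ℝ (A.structFun p.proj.proj) x (A.anchorFun p.proj.proj x β) b b') +
      (ξ' (a + A.structFun p.proj.proj x b β) - η b' +
        φ (A.structFun p.proj.proj x (a + A.structFun p.proj.proj x b β) b')) +
      (η' b - ξ (a' + A.structFun p.proj.proj x b' β) +
        φ (A.structFun p.proj.proj x b (a' + A.structFun p.proj.proj x b' β))) := by
  have hx := mem_coordDomain_self H F V p.proj.proj
  have hx' := mem_coordDomain_self H (F →L[ℝ] ℝ) (DualFiber V) p.proj.proj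
  have e1 : extChartAt I p.proj.proj p.proj.proj = x := congrArg (fun q => q.1.1) hp
  have e2 : (tcoord I (F →L[ℝ] ℝ) (DualFiber V) p.proj.proj p.proj).2 = φ :=
    congrArg (fun q => q.1.2) hp
  have e3 : tcoord I (F →L[ℝ] ℝ) (DualFiber V) p.proj.proj p.proj = (x, φ) := congrArg Prod.fst hp
  have e4 : Prol.coord p.proj.proj p.2 = (β, ζ) := congrArg Prod.snd hp
  have e5 : Prol.coord p.proj.proj u.1.1 = (b, ξ) := congrArg Prod.fst hu
  have e6 : Prol.coord p.proj.proj u'.1.1 = (b', ξ') := congrArg Prod.fst hu'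
  have h1 := A.hasFDerivAt_structFun hx
  rw [e1] at h1
  have h2 : HasFDerivAt (fun z : EB × (F →L[ℝ] ℝ) => A.structFun p.proj.proj z.1 b b') _ (x, φ) :=
    HasFDerivAt.comp (x, φ) (g := fun y => A.structFun p.proj.proj y b b') (f := Prod.fst)
      ((h1.clm_apply (hasFDerivAt_const b x)).clm_apply (hasFDerivAt_const b' x)) hasFDerivAt_fst
  have h3 := (hasFDerivAt_snd (𝕜 := ℝ) (p := (x, φ))).clm_apply h2
  have h4 := (h3.add_const (ξ' b - ξ b'))
  have h5 : (A.prol (F →L[ℝ] ℝ) (DualFiber V)).d0 (fun y => A.canonicalTwo y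
      (FiberBundle.extend (F × (F →L[ℝ] ℝ)) u.1.1 y)
        (FiberBundle.extend (F × (F →L[ℝ] ℝ)) u'.1.1 y)) p.proj p.2 =
      ζ (A.structFun p.proj.proj x b b') +
      φ (fderiv ℝ (A.structFun p.proj.proj) x (A.anchorFun p.proj.proj x β) b b') := by
    rw [prol_d0, (isCoordAt_tcoord hx').dirDeriv_eq
      (g := fun z => z.2 (A.structFun p.proj.proj z.1 b b') + (ξ' b - ξ b')) ?_ (by
        rw [e3]; exact h4.differentiableAt), e3, h4.fderiv, Prol.dirDeriv_tcoord_snd hx hx', e4, e1]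
    · simp only [add_apply, ContinuousLinearMap.comp_apply, ContinuousLinearMap.flip_apply]
      simp [add_comm]
    · filter_upwards [Prol.eventually_coord_extend u.1.1, Prol.eventually_coord_extend u'.1.1,
        eventually_mem_coordDomain hx] with y h6 h7 h8
      rw [A.canonicalTwo_eq h8, h6, h7, e5, e6]
      dsimp only [tcoord]
      ring
  unfold RawAlgebroid.completeLift
  rw [h5, A.canonicalTwo_eq hx, A.canonicalTwo_eq hx, A.coord_verticalPart, A.coord_verticalPart,
    hu, hu', hp, e5, e6, e1, e2]

end LieAlgebroid
end completeLiftCanonical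

/-! ### The Lagrangian submanifold -/

section isotropy
variable {EB : Type*} [NormedAddCommGroup EB] [NormedSpace ℝ EB]
  {F : Type*} [NormedAddCommGroup F] [NormedSpace ℝ F]

set_option synthInstance.maxHeartbeats 400000 in
/-- The algebraic identity behind the isotropy of `S_L`: with `D` and `M` the first and the second
derivative of the Lagrangian, the complete lift vanishes on pairs of tangent vectors because of the
symmetry of `M`, the Jacobi identity and the compatibility of the anchor with the brackets. -/
theorem isotropy_identity {D : EB × F →L[ℝ] ℝ} {M : EB × F →L[ℝ] EB × F →L[ℝ] ℝ}
    {ρ : F →L[ℝ] EB} {ρ' : EB →L[ℝ] F →L[ℝ] EB} {C : F →L[ℝ] F →L[ℝ] F}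
    {C' : EB →L[ℝ] F →L[ℝ] F →L[ℝ] F} (hM : ∀ u v, M u v = M v u)
    (hC : ∀ a b, C a b = -C b a) (hC' : ∀ x a b, C' x a b = -C' x b a)
    (hρ : ∀ a b, ρ (C a b) = ρ' (ρ a) b - ρ' (ρ b) a)
    (hJ : ∀ a b c, C a (C b c) + C' (ρ a) b c + (C b (C c a) + C' (ρ b) c a) +
      (C c (C a b) + C' (ρ c) a b) = 0) (β b b' a a' : F) :
    D (ρ (C b b'), C β (C b b')) + D (0, C' (ρ β) b b') +
      (M (ρ b', a') (0, a + C b β) -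
        (M (ρ b, a) (ρ b', C β b') + D (ρ' (ρ b) b', C' (ρ b) β b' + C a b')) +
        D (0, C (a + C b β) b')) +
      (M (ρ b', a') (ρ b, C β b) + D (ρ' (ρ b') b, C' (ρ b') β b + C a' b) -
        M (ρ b, a) (0, a' + C b' β) + D (0, C b (a' + C b' β))) = 0 := by
  have hD : ∀ x y, D (x, y) = D (x, 0) + D (0, y) := fun x y => by rw [← map_add]; simp
  have hM2 : ∀ u x y, M u (x, y) = M u (x, 0) + M u (0, y) := fun u x y => by
    rw [← map_add]; simp
  have hDa : ∀ y z, D (0, y + z) = D (0, y) + D (0, z) := fun y z => by rw [← map_add]; simp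
  have hDn : ∀ y, D (0, -y) = -D (0, y) := fun y => by rw [← map_neg]; simp
  have hDs : ∀ y z, D (y - z, 0) = D (y, 0) - D (z, 0) := fun y z => by rw [← map_sub]; simp
  have hMa : ∀ u y z, M u (0, y + z) = M u (0, y) + M u (0, z) := fun u y z => by
    rw [← map_add]; simp
  have hMn : ∀ u y, M u (0, -y) = -M u (0, y) := fun u y => by rw [← map_neg]; simp
  have h1 := hM (ρ b', a') (ρ b, a)
  rw [hM2 _ (ρ b), hM2 _ (ρ b')] at h1
  have h2 := congrArg (fun y => D (0, y)) (hJ β b b')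
  have h0 : D (0, 0) = 0 := map_zero D
  simp only [hDa, h0] at h2
  rw [hC b' β, hC' (ρ b) b' β] at h2
  rw [hD (ρ (C b b')) (C β (C b b')), hD (ρ' (ρ b) b') (C' (ρ b) β b' + C a b'),
    hD (ρ' (ρ b') b) (C' (ρ b') β b + C a' b), hρ, hDs, hM2 _ (ρ b') (C β b'),
    hM2 _ (ρ b) (C β b), hC b' β, hC b β, hC a' b, hC (a + -C β b) b']
  have h5 : D (0, C b' a) = -D (0, C a b') := by rw [hC b' a, hDn]
  simp only [map_add, map_neg, hDa, hDn, hMa, hMn] at h2 ⊢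
  linarith

end isotropy

section lagrangian
variable {EB : Type*} [NormedAddCommGroup EB] [NormedSpace ℝ EB] [FiniteDimensional ℝ EB]
  {H : Type*} [TopologicalSpace H]
  {I : ModelWithCorners ℝ EB H} [I.Boundaryless] {B : Type*} [TopologicalSpace B] [T2Space B]
  [ChartedSpace H B] [IsManifold I ∞ B]
  {F : Type*} [NormedAddCommGroup F] [NormedSpace ℝ F] [FiniteDimensional ℝ F] {V : B → Type*}
  [TopologicalSpace (TotalSpace F V)] [∀ x, AddCommGroup (V x)] [∀ x, Module ℝ (V x)]
  [∀ x, TopologicalSpace (V x)] [FiberBundle F V] [VectorBundle ℝ F V]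
  [ContMDiffVectorBundle ∞ F V I]

namespace LieAlgebroid
variable (A : LieAlgebroid I F V) {L : TotalSpace F V → ℝ} {x₀ : B}

theorem fderiv_momentum_apply (hL : ContMDiff (I.prod 𝓘(ℝ, F)) 𝓘(ℝ, ℝ) ∞ L) {a : TotalSpace F V}
    (ha : a.proj ∈ coordDomain H F V x₀) (v : EB × F) (c : F) :
    fderiv ℝ (momentum I L x₀) (tcoord I F V x₀ a) v c =
      fderiv ℝ (fderiv ℝ (coordLagrangian I L x₀)) (tcoord I F V x₀ a) v (0, c) := by
  have h1 := (((contDiffAt_coordLagrangian hL ha).fderiv_right (m := ∞) (by simp)).differentiableAt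
    (by simp)).hasFDerivAt
  have h2 := ((contDiffAt_momentum hL ha).differentiableAt (by simp)).hasFDerivAt.clm_apply
    (hasFDerivAt_const c _)
  have h3 := DFunLike.congr_fun (h2.unique (h1.clm_apply (hasFDerivAt_const (0, c) _))) v
  simpa using h3

set_option synthInstance.maxHeartbeats 400000 in
theorem fderiv_force_apply (hL : ContMDiff (I.prod 𝓘(ℝ, F)) 𝓘(ℝ, ℝ) ∞ L) {a : TotalSpace F V}
    (ha : a.proj ∈ coordDomain H F V x₀) {x : EB} {β : F} (hz : tcoord I F V x₀ a = (x, β))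
    (v : EB × F) (c : F) :
    fderiv ℝ (A.force L x₀) (x, β) v c =
      fderiv ℝ (fderiv ℝ (coordLagrangian I L x₀)) (x, β) v
        (A.anchorFun x₀ x c, A.structFun x₀ x β c) +
      fderiv ℝ (coordLagrangian I L x₀) (x, β)
        (fderiv ℝ (A.anchorFun x₀) x v.1 c,
          fderiv ℝ (A.structFun x₀) x v.1 β c + A.structFun x₀ x v.2 c) := by
  have hx : extChartAt I x₀ a.proj = x := congrArg Prod.fst hz
  have h1 := (((contDiffAt_coordLagrangian hL ha).fderiv_right (m := ∞) (by simp)).differentiableAt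
    (by simp)).hasFDerivAt
  have h2 := ((A.contDiffAt_force hL ha).differentiableAt (by simp)).hasFDerivAt.clm_apply
    (hasFDerivAt_const c _)
  have hρ := A.hasFDerivAt_anchorFun ha
  have hC := A.hasFDerivAt_structFun ha
  rw [hz] at h1 h2
  rw [hx] at hρ hC
  have hfst : HasFDerivAt (Prod.fst : EB × F → EB) (ContinuousLinearMap.fst ℝ EB F) (x, β) :=
    hasFDerivAt_fst
  have hρ' := HasFDerivAt.comp (x, β) hρ hfst
  have hC' : HasFDerivAt (fun z : EB × F => A.structFun x₀ z.1)
      ((fderiv ℝ (A.structFun x₀) x).comp (ContinuousLinearMap.fst ℝ EB F)) (x, β) :=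
    HasFDerivAt.comp (g := A.structFun x₀) (x, β) hC hfst
  have h4 := (hρ'.clm_apply (hasFDerivAt_const c (x, β))).prodMk
    ((hC'.clm_apply hasFDerivAt_snd).clm_apply (hasFDerivAt_const c (x, β)))
  have h3 := DFunLike.congr_fun (h2.unique (h1.clm_apply h4)) v
  simp only [add_apply, ContinuousLinearMap.comp_apply, ContinuousLinearMap.flip_apply,
    ContinuousLinearMap.prod_apply, zero_apply, map_zero, zero_add] at h3
  rw [h3, add_comm]
  congr 2
  refine Prod.ext rfl ?_
  exact add_comm _ _

end LieAlgebroid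
end lagrangian

section lagrangian
variable {EB : Type*} [NormedAddCommGroup EB] [NormedSpace ℝ EB] [FiniteDimensional ℝ EB]
  {H : Type*} [TopologicalSpace H]
  {I : ModelWithCorners ℝ EB H} [I.Boundaryless] {B : Type*} [TopologicalSpace B] [T2Space B]
  [ChartedSpace H B] [IsManifold I ∞ B]
  {F : Type*} [NormedAddCommGroup F] [NormedSpace ℝ F] [FiniteDimensional ℝ F] {V : B → Type*}
  [TopologicalSpace (TotalSpace F V)] [∀ x, AddCommGroup (V x)] [∀ x, Module ℝ (V x)]
  [∀ x, TopologicalSpace (V x)] [FiberBundle F V] [VectorBundle ℝ F V]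
  [ContMDiffVectorBundle ∞ F V I]

namespace LieAlgebroid
variable (A : LieAlgebroid I F V) {L : TotalSpace F V → ℝ} {x₀ : B}

/-- The map whose zero set is `S_L` in coordinates. -/
noncomputable def constraint (L : TotalSpace F V → ℝ) (x₀ : B)
    (k : (EB × (F →L[ℝ] ℝ)) × (F × (F →L[ℝ] ℝ))) : (F →L[ℝ] ℝ) × (F →L[ℝ] ℝ) :=
  (k.1.2 - momentum I L x₀ (k.1.1, k.2.1), k.2.2 - A.force L x₀ (k.1.1, k.2.1))

theorem hasFDerivAt_constraint (hL : ContMDiff (I.prod 𝓘(ℝ, F)) 𝓘(ℝ, ℝ) ∞ L)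
    {a : TotalSpace F V} (ha : a.proj ∈ coordDomain H F V x₀)
    {k : (EB × (F →L[ℝ] ℝ)) × (F × (F →L[ℝ] ℝ))} (hk : tcoord I F V x₀ a = (k.1.1, k.2.1)) :
    ContDiffAt ℝ ∞ (A.constraint L x₀) k ∧ ∀ v, fderiv ℝ (A.constraint L x₀) k v =
      (v.1.2 - fderiv ℝ (momentum I L x₀) (k.1.1, k.2.1) (v.1.1, v.2.1),
        v.2.2 - fderiv ℝ (A.force L x₀) (k.1.1, k.2.1) (v.1.1, v.2.1)) := by
  have h1 := contDiffAt_momentum hL ha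
  have h2 := A.contDiffAt_force hL ha
  rw [hk] at h1 h2
  let m : ((EB × (F →L[ℝ] ℝ)) × (F × (F →L[ℝ] ℝ))) →L[ℝ] EB × F :=
    ((ContinuousLinearMap.fst ℝ EB (F →L[ℝ] ℝ)).comp (ContinuousLinearMap.fst ℝ _ _)).prod
      ((ContinuousLinearMap.fst ℝ F (F →L[ℝ] ℝ)).comp (ContinuousLinearMap.snd ℝ _ _))
  have hm : m k = (k.1.1, k.2.1) := rfl
  have h3 : ContDiffAt ℝ ∞ (fun k => momentum I L x₀ (m k)) k :=
    ContDiffAt.comp k (g := momentum I L x₀) (f := m) h1 m.contDiff.contDiffAt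
  have h4 : ContDiffAt ℝ ∞ (fun k => A.force L x₀ (m k)) k :=
    ContDiffAt.comp k (g := A.force L x₀) (f := m) h2 m.contDiff.contDiffAt
  have h5 : HasFDerivAt (fun k => momentum I L x₀ (m k)) _ k :=
    HasFDerivAt.comp k (g := momentum I L x₀) (f := m)
      (h1.differentiableAt (by simp)).hasFDerivAt m.hasFDerivAt
  have h6 : HasFDerivAt (fun k => A.force L x₀ (m k)) _ k :=
    HasFDerivAt.comp k (g := A.force L x₀) (f := m)
      (h2.differentiableAt (by simp)).hasFDerivAt m.hasFDerivAt
  have e1 : ContDiffAt ℝ ∞ (fun k : (EB × (F →L[ℝ] ℝ)) × (F × (F →L[ℝ] ℝ)) => k.1.2) k := by fun_prop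
  have e2 : ContDiffAt ℝ ∞ (fun k : (EB × (F →L[ℝ] ℝ)) × (F × (F →L[ℝ] ℝ)) => k.2.2) k := by fun_prop
  refine ⟨(e1.sub h3).prodMk (e2.sub h4), fun v => ?_⟩
  have h7 := ((hasFDerivAt_fst (𝕜 := ℝ) (p := k)).snd.sub h5).prodMk
    ((hasFDerivAt_snd (𝕜 := ℝ) (p := k)).snd.sub h6)
  exact DFunLike.congr_fun h7.fderiv v

theorem mem_lagrangianSet_iff_constraint (hL : ContMDiff (I.prod 𝓘(ℝ, F)) 𝓘(ℝ, ℝ) ∞ L)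
    {p : TotalSpace (F × (F →L[ℝ] ℝ)) (Prol (F →L[ℝ] ℝ) (DualFiber V) A.anchor)}
    (hx : p.proj.proj ∈ coordDomain H F V x₀) :
    p ∈ A.lagrangianSet L ↔ A.constraint L x₀ (pcoord A.anchor x₀ p) = 0 := by
  rw [A.mem_lagrangianSet_iff_coord hL hx]
  unfold constraint
  rw [Prod.mk_eq_zero, sub_eq_zero, sub_eq_zero]

variable {p : TotalSpace (F × (F →L[ℝ] ℝ)) (Prol (F →L[ℝ] ℝ) (DualFiber V) A.anchor)}

theorem eventually_mem_coordDomain_proj (hx : p.proj.proj ∈ coordDomain H F V x₀) :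
    ∀ᶠ q : TotalSpace (F × (F →L[ℝ] ℝ)) (Prol (F →L[ℝ] ℝ) (DualFiber V) A.anchor) in 𝓝 p,
      q.proj.proj ∈ coordDomain H F V x₀ :=
  (FiberBundle.continuous_proj (F × (F →L[ℝ] ℝ))
    (Prol (F →L[ℝ] ℝ) (DualFiber V) A.anchor)).continuousAt.eventually
      (eventually_mem_coordDomain hx)

/-- The tangent space of `S_L` in coordinates. -/
theorem mem_tangentSubmodule_iff (hL : ContMDiff (I.prod 𝓘(ℝ, F)) 𝓘(ℝ, ℝ) ∞ L)
    (hp : p ∈ A.lagrangianSet L) (hx : p.proj.proj ∈ coordDomain H F V x₀)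
    (v : TangentSpace ((I.prod 𝓘(ℝ, F →L[ℝ] ℝ)).prod 𝓘(ℝ, F × (F →L[ℝ] ℝ))) p) :
    v ∈ tangentSubmodule ((I.prod 𝓘(ℝ, F →L[ℝ] ℝ)).prod 𝓘(ℝ, F × (F →L[ℝ] ℝ)))
        (A.lagrangianSet L) p ↔
      fderiv ℝ (A.constraint L x₀) (pcoord A.anchor x₀ p)
        (dirDeriv ((I.prod 𝓘(ℝ, F →L[ℝ] ℝ)).prod 𝓘(ℝ, F × (F →L[ℝ] ℝ)))
          (pcoord A.anchor x₀) p v) = 0 := by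
  have hx' : p.proj.proj ∈ coordDomain H (F →L[ℝ] ℝ) (DualFiber V) x₀ := by rwa [coordDomain_dual]
  have hκ := isCoordAt_pcoord A.anchor hx hx'
  obtain ⟨hG, hG'⟩ := A.hasFDerivAt_constraint hL (a := (⟨p.proj.proj, p.2.fst⟩ : TotalSpace F V)) hx
    (k := pcoord A.anchor x₀ p) rfl
  have hGd := hG.differentiableAt (by simp)
  have h1 := fun v => hκ.dirDeriv_eq (f := fun q => A.constraint L x₀ (pcoord A.anchor x₀ q))
    (g := A.constraint L x₀) (Filter.Eventually.of_forall fun q => rfl) hGd v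
  constructor
  · intro h
    rw [← h1]
    refine Submodule.span_induction (p := fun v _ => dirDeriv ((I.prod 𝓘(ℝ, F →L[ℝ] ℝ)).prod
      𝓘(ℝ, F × (F →L[ℝ] ℝ))) (fun q => A.constraint L x₀ (pcoord A.anchor x₀ q)) p v = 0)
      ?_ ?_ ?_ ?_ h
    · rintro v ⟨γ, s, hγ, e⟩
      refine (dirDeriv_eq_deriv (s.mdifferentiableAt (by simp)) e
        (hGd.mdifferentiableAt.comp p hκ.mdifferentiableAt)).trans ?_
      have q1 : γ 0 = p := congrArg TotalSpace.proj e
      have n1 : Filter.Tendsto γ (𝓝 0) (𝓝 p) := q1 ▸ s.continuousAt.tendsto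
      have key : (fun t => A.constraint L x₀ (pcoord A.anchor x₀ (γ t))) =ᶠ[𝓝 0] fun _ => 0 := by
        filter_upwards [hγ, n1.eventually (A.eventually_mem_coordDomain_proj hx)] with t h3 h4
        exact (A.mem_lagrangianSet_iff_constraint hL h4).1 h3
      exact key.deriv_eq.trans (deriv_const _ _)
    · exact (mfderiv _ _ _ p).map_zero
    · intro u v _ _ h3 h4
      rw [dirDeriv_add, h3, h4, add_zero]
    · intro c v _ h3
      rw [dirDeriv_smul, h3, smul_zero]
  · intro h
    refine Submodule.subset_span ?_
    rw [hG'] at h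
    obtain ⟨c1, c2⟩ := Prod.mk_eq_zero.1 h
    have h0 := (A.mem_lagrangianSet_iff_coord hL hx).1 hp
    rw [sub_eq_zero] at c1 c2
    set k := pcoord A.anchor x₀ p with hk
    set d := dirDeriv ((I.prod 𝓘(ℝ, F →L[ℝ] ℝ)).prod 𝓘(ℝ, F × (F →L[ℝ] ℝ)))
          (pcoord A.anchor x₀) p v with hd
    -- The tangent vector is the velocity of the curve in `S_L` over a line in `E`.
    have hline := hasDerivAt_line ((k.1.1, k.2.1) : EB × F) (d.1.1, d.2.1)
    have hc0 : ((k.1.1, k.2.1) : EB × F) + (0 : ℝ) • ((d.1.1, d.2.1) : EB × F) = (k.1.1, k.2.1) := by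
      simp
    have hP := contDiffAt_momentum hL (a := (⟨p.proj.proj, p.2.fst⟩ : TotalSpace F V)) hx
    have hQ := A.contDiffAt_force hL (a := (⟨p.proj.proj, p.2.fst⟩ : TotalSpace F V)) hx
    change ContDiffAt ℝ ∞ _ ((k.1.1, k.2.1) : EB × F) at hP hQ
    rw [← hc0] at hP hQ
    let l : ℝ → EB × F := fun t => (k.1.1, k.2.1) + t • (d.1.1, d.2.1)
    have sl : ContDiffAt ℝ ∞ l 0 := by fun_prop
    have sP : ContDiffAt ℝ ∞ (fun t => momentum I L x₀ (l t)) 0 :=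
      ContDiffAt.comp (0 : ℝ) (g := momentum I L x₀) (f := l) hP sl
    have sQ : ContDiffAt ℝ ∞ (fun t => A.force L x₀ (l t)) 0 :=
      ContDiffAt.comp (0 : ℝ) (g := A.force L x₀) (f := l) hQ sl
    have dP := (hP.differentiableAt (by simp)).hasFDerivAt.comp_hasDerivAt (0 : ℝ) hline
    have dQ := (hQ.differentiableAt (by simp)).hasFDerivAt.comp_hasDerivAt (0 : ℝ) hline
    rw [hc0, ← c1] at dP
    rw [hc0, ← c2] at dQ
    have l1 := hasDerivAt_line k.1.1 d.1.1
    have l2 := hasDerivAt_line k.2.1 d.2.1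
    obtain ⟨γ, s, e, hγ⟩ := hκ.exists_curve
      (δ := fun t => ((k.1.1 + t • d.1.1, momentum I L x₀ (l t)),
        (k.2.1 + t • d.2.1, A.force L x₀ (l t)))) (v := v)
      (ContDiffAt.prodMk (ContDiffAt.prodMk (by fun_prop) sP) (ContDiffAt.prodMk (by fun_prop) sQ))
      (by
        change ((k.1.1 + (0 : ℝ) • d.1.1, momentum I L x₀ ((k.1.1, k.2.1) + (0 : ℝ) • (d.1.1, d.2.1))),
          (k.2.1 + (0 : ℝ) • d.2.1, A.force L x₀ ((k.1.1, k.2.1) + (0 : ℝ) • (d.1.1, d.2.1)))) = k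
        rw [hc0, ← h0.1, ← h0.2]
        simp)
      (by rw [← hd]; exact ((l1.prodMk dP).prodMk (l2.prodMk dQ)).deriv)
    refine ⟨γ, s, ?_, e⟩
    have q1 : γ 0 = p := congrArg TotalSpace.proj e
    have n1 : Filter.Tendsto γ (𝓝 0) (𝓝 p) := q1 ▸ s.continuousAt.tendsto
    filter_upwards [hγ, n1.eventually (A.eventually_mem_coordDomain_proj hx)] with t h3 h4
    rw [A.mem_lagrangianSet_iff_coord hL h4, h3]
    exact ⟨rfl, rfl⟩

theorem isEmbeddedSubmanifold_lagrangianSet (hL : ContMDiff (I.prod 𝓘(ℝ, F)) 𝓘(ℝ, ℝ) ∞ L) :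
    IsEmbeddedSubmanifold ((I.prod 𝓘(ℝ, F →L[ℝ] ℝ)).prod 𝓘(ℝ, F × (F →L[ℝ] ℝ)))
      (A.lagrangianSet L) := by
  intro p _
  set x₀ := p.proj.proj with hx₀
  let T := toEuclidean (E := (F →L[ℝ] ℝ) × (F →L[ℝ] ℝ))
  have hdom : ∀ {q : TotalSpace (F × (F →L[ℝ] ℝ)) (Prol (F →L[ℝ] ℝ) (DualFiber V) A.anchor)},
      q.proj.proj ∈ coordDomain H F V x₀ →
        IsCoordAt ((I.prod 𝓘(ℝ, F →L[ℝ] ℝ)).prod 𝓘(ℝ, F × (F →L[ℝ] ℝ))) (pcoord A.anchor x₀) q ∧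
        ContDiffAt ℝ ∞ (A.constraint L x₀) (pcoord A.anchor x₀ q) ∧ Function.Surjective
          (fderiv ℝ (A.constraint L x₀) (pcoord A.anchor x₀ q)) := by
    intro q hq
    have hq' : q.proj.proj ∈ coordDomain H (F →L[ℝ] ℝ) (DualFiber V) x₀ := by rwa [coordDomain_dual]
    obtain ⟨h1, h2⟩ := A.hasFDerivAt_constraint hL (a := (⟨q.proj.proj, q.2.fst⟩ : TotalSpace F V)) hq
      (k := pcoord A.anchor x₀ q) rfl
    refine ⟨isCoordAt_pcoord A.anchor hq hq', h1, fun k => ⟨((0, k.1), (0, k.2)), ?_⟩⟩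
    rw [h2]
    change (k.1 - fderiv ℝ (momentum I L x₀) _ 0, k.2 - fderiv ℝ (A.force L x₀) _ 0) = k
    rw [map_zero, map_zero, sub_zero, sub_zero]
  refine ⟨{q | q.proj.proj ∈ coordDomain H F V x₀}, _,
    fun q => T (A.constraint L x₀ (pcoord A.anchor x₀ q)), ?_, mem_coordDomain_self H F V x₀, ?_, ?_, ?_⟩
  · exact (isOpen_coordDomain H F V x₀).preimage ((FiberBundle.continuous_proj _ _).comp
      (FiberBundle.continuous_proj _ _))
  · intro q hq
    obtain ⟨h1, h2, -⟩ := hdom hq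
    exact (T.contDiff.contDiffAt.contMDiffAt.comp q
      (h2.contMDiffAt.comp q h1.contMDiffAt)).contMDiffWithinAt
  · intro q hq k
    obtain ⟨h1, h2, h3⟩ := hdom hq
    obtain ⟨a, ha⟩ := h3 (T.symm k)
    obtain ⟨v, hv⟩ := h1.exists_dirDeriv_eq a
    refine ⟨v, ?_⟩
    have h4 : HasFDerivAt (fun z => T (A.constraint L x₀ z)) _ (pcoord A.anchor x₀ q) :=
      T.hasFDerivAt.comp _ (h2.differentiableAt (by simp)).hasFDerivAt
    have h5 := h1.dirDeriv_eq (f := fun q => T (A.constraint L x₀ (pcoord A.anchor x₀ q)))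
      (g := fun z => T (A.constraint L x₀ z)) (Filter.Eventually.of_forall fun q => rfl)
      h4.differentiableAt v
    refine h5.trans ?_
    rw [h4.fderiv, hv]
    change T (fderiv ℝ (A.constraint L x₀) (pcoord A.anchor x₀ q) a) = k
    rw [ha]
    exact T.apply_symm_apply k
  · ext q
    refine and_comm.trans (and_congr_right fun hq => ?_)
    rw [A.mem_lagrangianSet_iff_constraint hL hq, ← T.map_eq_zero_iff]

end LieAlgebroid
end lagrangian

section lagrangian
variable {EB : Type*} [NormedAddCommGroup EB] [NormedSpace ℝ EB] [FiniteDimensional ℝ EB]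
  {H : Type*} [TopologicalSpace H]
  {I : ModelWithCorners ℝ EB H} [I.Boundaryless] {B : Type*} [TopologicalSpace B] [T2Space B]
  [ChartedSpace H B] [IsManifold I ∞ B]
  {F : Type*} [NormedAddCommGroup F] [NormedSpace ℝ F] [FiniteDimensional ℝ F] {V : B → Type*}
  [TopologicalSpace (TotalSpace F V)] [∀ x, AddCommGroup (V x)] [∀ x, Module ℝ (V x)]
  [∀ x, TopologicalSpace (V x)] [FiberBundle F V] [VectorBundle ℝ F V]
  [ContMDiffVectorBundle ∞ F V I]

namespace LieAlgebroid
variable (A : LieAlgebroid I F V) {L : TotalSpace F V → ℝ}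
  {p : TotalSpace (F × (F →L[ℝ] ℝ)) (Prol (F →L[ℝ] ℝ) (DualFiber V) A.anchor)}

theorem snd_mem_tangentSubmodule_iff (hL : ContMDiff (I.prod 𝓘(ℝ, F)) 𝓘(ℝ, ℝ) ∞ L)
    (hp : p ∈ A.lagrangianSet L)
    (u : prolFiber (FW := F × (F →L[ℝ] ℝ)) (W := Prol (F →L[ℝ] ℝ) (DualFiber V) A.anchor)
      (A.prol (F →L[ℝ] ℝ) (DualFiber V)).anchor p) {x : EB} {φ ζ ξ η : F →L[ℝ] ℝ}
    {β b a : F} (hk : pcoord A.anchor p.proj.proj p = ((x, φ), (β, ζ)))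
    (hu : A.doubleCoord u = ((b, ξ), (a, η))) :
    u.1.2 ∈ tangentSubmodule ((I.prod 𝓘(ℝ, F →L[ℝ] ℝ)).prod 𝓘(ℝ, F × (F →L[ℝ] ℝ)))
        (A.lagrangianSet L) p ↔
      ξ = fderiv ℝ (momentum I L p.proj.proj) (x, β) (A.anchorFun p.proj.proj x b, a) ∧
      η = fderiv ℝ (A.force L p.proj.proj) (x, β) (A.anchorFun p.proj.proj x b, a) := by
  have hx := mem_coordDomain_self H F V p.proj.proj
  have e1 : extChartAt I p.proj.proj p.proj.proj = x := congrArg (fun q => q.1.1) hk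
  have e3 : tcoord I F V p.proj.proj (⟨p.proj.proj, p.2.fst⟩ : TotalSpace F V) = (x, β) :=
    congrArg (fun q => (q.1.1, q.2.1)) hk
  rw [A.mem_tangentSubmodule_iff hL hp hx, dirDeriv_pcoord_snd, hk, hu, e1,
    (A.hasFDerivAt_constraint hL (a := (⟨p.proj.proj, p.2.fst⟩ : TotalSpace F V)) hx e3).2,
    Prod.mk_eq_zero, sub_eq_zero, sub_eq_zero]

/-- The tangent spaces of `S_L` are Lagrangian. -/
theorem snd_mem_tangentSubmodule_iff_orthogonal
    (hL : ContMDiff (I.prod 𝓘(ℝ, F)) 𝓘(ℝ, ℝ) ∞ L) (hp : p ∈ A.lagrangianSet L)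
    (u : prolFiber (FW := F × (F →L[ℝ] ℝ)) (W := Prol (F →L[ℝ] ℝ) (DualFiber V) A.anchor)
      (A.prol (F →L[ℝ] ℝ) (DualFiber V)).anchor p) :
    u.1.2 ∈ tangentSubmodule ((I.prod 𝓘(ℝ, F →L[ℝ] ℝ)).prod 𝓘(ℝ, F × (F →L[ℝ] ℝ)))
        (A.lagrangianSet L) p ↔
      ∀ u' : prolFiber (FW := F × (F →L[ℝ] ℝ)) (W := Prol (F →L[ℝ] ℝ) (DualFiber V) A.anchor)
        (A.prol (F →L[ℝ] ℝ) (DualFiber V)).anchor p,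
        u'.1.2 ∈ tangentSubmodule ((I.prod 𝓘(ℝ, F →L[ℝ] ℝ)).prod 𝓘(ℝ, F × (F →L[ℝ] ℝ)))
          (A.lagrangianSet L) p →
        (A.prol (F →L[ℝ] ℝ) (DualFiber V)).completeLift A.canonicalTwo p u u' = 0 := by
  have hx := mem_coordDomain_self H F V p.proj.proj
  rcases hk : pcoord A.anchor p.proj.proj p with ⟨⟨x, φ⟩, ⟨β, ζ⟩⟩
  have e1 : extChartAt I p.proj.proj p.proj.proj = x := congrArg (fun q => q.1.1) hk
  have e3 : tcoord I F V p.proj.proj (⟨p.proj.proj, p.2.fst⟩ : TotalSpace F V) = (x, β) :=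
    congrArg (fun q => (q.1.1, q.2.1)) hk
  obtain ⟨h1, h2⟩ := (A.mem_lagrangianSet_iff_coord hL hx).1 hp
  rw [hk] at h1 h2
  dsimp only at h1 h2
  have hP := fderiv_momentum_apply hL (a := (⟨p.proj.proj, p.2.fst⟩ : TotalSpace F V)) hx
  rw [e3] at hP
  have hQ := A.fderiv_force_apply hL (a := (⟨p.proj.proj, p.2.fst⟩ : TotalSpace F V)) hx e3
  have hsymm : ∀ v w, fderiv ℝ (fderiv ℝ (coordLagrangian I L p.proj.proj)) (x, β) v w =
      fderiv ℝ (fderiv ℝ (coordLagrangian I L p.proj.proj)) (x, β) w v := by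
    have h3 := contDiffAt_coordLagrangian hL (a := (⟨p.proj.proj, p.2.fst⟩ : TotalSpace F V)) hx
    rw [e3] at h3
    exact h3.isSymmSndFDerivAt (by
      rw [minSmoothness_of_isRCLikeNormedField]
      exact WithTop.coe_le_coe.2 (le_top : (2 : ℕ∞) ≤ ⊤))
  have hC := A.structFun_swap hx
  have hC' : ∀ v a b, fderiv ℝ (A.structFun p.proj.proj) (extChartAt I p.proj.proj p.proj.proj) v a b =
      -fderiv ℝ (A.structFun p.proj.proj) (extChartAt I p.proj.proj p.proj.proj) v b a :=
    A.fderiv_structFun_swap hx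
  have hρ := A.anchorFun_structFun hx
  have hJ := A.structFun_jacobi hx
  rw [e1] at hC hC'
  simp only [e1] at hρ hJ
  -- The complete lift of a pair of tangent vectors of `S_L`.
  have key : ∀ b b' a a', ∀ u u' : prolFiber (FW := F × (F →L[ℝ] ℝ))
      (W := Prol (F →L[ℝ] ℝ) (DualFiber V) A.anchor) (A.prol (F →L[ℝ] ℝ) (DualFiber V)).anchor p,
      A.doubleCoord u = ((b, fderiv ℝ (momentum I L p.proj.proj) (x, β)
        (A.anchorFun p.proj.proj x b, a)), (a, fderiv ℝ (A.force L p.proj.proj) (x, β)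
          (A.anchorFun p.proj.proj x b, a))) →
      A.doubleCoord u' = ((b', fderiv ℝ (momentum I L p.proj.proj) (x, β)
        (A.anchorFun p.proj.proj x b', a')), (a', fderiv ℝ (A.force L p.proj.proj) (x, β)
          (A.anchorFun p.proj.proj x b', a'))) →
      (A.prol (F →L[ℝ] ℝ) (DualFiber V)).completeLift A.canonicalTwo p u u' = 0 := by
    intro b b' a a' u u' hu hu'
    rw [A.completeLift_eq u u' hk hu hu', h1, h2]
    simp only [hP, hQ, momentum_apply, force_apply]
    exact isotropy_identity hsymm hC hC' hρ hJ β b b' a a'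
  constructor
  · intro hu u' hu'
    rcases h3 : A.doubleCoord u with ⟨⟨b, ξ⟩, ⟨a, η⟩⟩
    rcases h4 : A.doubleCoord u' with ⟨⟨b', ξ'⟩, ⟨a', η'⟩⟩
    obtain ⟨rfl, rfl⟩ := (A.snd_mem_tangentSubmodule_iff hL hp u hk h3).1 hu
    obtain ⟨rfl, rfl⟩ := (A.snd_mem_tangentSubmodule_iff hL hp u' hk h4).1 hu'
    exact key b b' a a' u u' h3 h4
  · intro hu
    rcases h3 : A.doubleCoord u with ⟨⟨b, ξ⟩, ⟨a, η⟩⟩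
    rw [A.snd_mem_tangentSubmodule_iff hL hp u hk h3]
    -- Compare `u` with the tangent vector of `S_L` with the same components `b` and `a`.
    obtain ⟨u₀, h4⟩ := A.exists_doubleCoord_eq p ((b, fderiv ℝ (momentum I L p.proj.proj) (x, β)
        (A.anchorFun p.proj.proj x b, a)), (a, fderiv ℝ (A.force L p.proj.proj) (x, β)
          (A.anchorFun p.proj.proj x b, a)))
    have h5 : ∀ b' a', η b' + ξ (a' + A.structFun p.proj.proj x b' β) =
        fderiv ℝ (A.force L p.proj.proj) (x, β) (A.anchorFun p.proj.proj x b, a) b' +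
        fderiv ℝ (momentum I L p.proj.proj) (x, β) (A.anchorFun p.proj.proj x b, a)
          (a' + A.structFun p.proj.proj x b' β) := by
      intro b' a'
      obtain ⟨u', h6⟩ := A.exists_doubleCoord_eq p ((b', fderiv ℝ (momentum I L p.proj.proj) (x, β)
        (A.anchorFun p.proj.proj x b', a')), (a', fderiv ℝ (A.force L p.proj.proj) (x, β)
          (A.anchorFun p.proj.proj x b', a')))
      have h7 := hu u' ((A.snd_mem_tangentSubmodule_iff hL hp u' hk h6).2 ⟨rfl, rfl⟩)
      have h8 := key b b' a a' u₀ u' h4 h6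
      rw [A.completeLift_eq u u' hk h3 h6] at h7
      rw [A.completeLift_eq u₀ u' hk h4 h6] at h8
      linarith
    have h6 : ξ = fderiv ℝ (momentum I L p.proj.proj) (x, β) (A.anchorFun p.proj.proj x b, a) := by
      ext c
      simpa using h5 0 c
    refine ⟨h6, ContinuousLinearMap.ext fun c => ?_⟩
    have h7 := h5 c 0
    rw [h6] at h7
    linarith

/-- The first condition on a Lagrangian submanifold: the sum is the whole tangent space, since
`S_L` projects submersively to `B` and the anchor of the prolongation reaches all vertical vectors. -/
theorem range_anchor_sup_tangent (hL : ContMDiff (I.prod 𝓘(ℝ, F)) 𝓘(ℝ, ℝ) ∞ L)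
    (hp : p ∈ A.lagrangianSet L) :
    LinearMap.range ((A.prol (F →L[ℝ] ℝ) (DualFiber V)).anchor p.proj).toLinearMap ⊔
      (tangentSubmodule ((I.prod 𝓘(ℝ, F →L[ℝ] ℝ)).prod 𝓘(ℝ, F × (F →L[ℝ] ℝ)))
        (A.lagrangianSet L) p).map (mfderiv ((I.prod 𝓘(ℝ, F →L[ℝ] ℝ)).prod 𝓘(ℝ, F × (F →L[ℝ] ℝ)))
          (I.prod 𝓘(ℝ, F →L[ℝ] ℝ)) (π (F × (F →L[ℝ] ℝ))
            (Prol (F →L[ℝ] ℝ) (DualFiber V) A.anchor)) p).toLinearMap = ⊤ := by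
  have hx := mem_coordDomain_self H F V p.proj.proj
  have hx' := mem_coordDomain_self H (F →L[ℝ] ℝ) (DualFiber V) p.proj.proj
  have hκ := isCoordAt_tcoord (I := I) hx'
  have hG := A.hasFDerivAt_constraint hL (a := (⟨p.proj.proj, p.2.fst⟩ : TotalSpace F V)) hx
    (k := pcoord A.anchor p.proj.proj p) rfl
  rw [eq_top_iff]
  intro t _
  -- A tangent vector of `S_L` with the same projection to the base as `t`.
  let y := (dirDeriv (I.prod 𝓘(ℝ, F →L[ℝ] ℝ)) (tcoord I (F →L[ℝ] ℝ) (DualFiber V) p.proj.proj)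
    p.proj t).1
  let z := ((pcoord A.anchor p.proj.proj p).1.1, (pcoord A.anchor p.proj.proj p).2.1)
  obtain ⟨v, hv⟩ := (isCoordAt_pcoord A.anchor hx hx').exists_dirDeriv_eq
    ((y, fderiv ℝ (momentum I L p.proj.proj) z (y, 0)),
      (0, fderiv ℝ (A.force L p.proj.proj) z (y, 0)))
  have hv' : v ∈ tangentSubmodule ((I.prod 𝓘(ℝ, F →L[ℝ] ℝ)).prod 𝓘(ℝ, F × (F →L[ℝ] ℝ)))
      (A.lagrangianSet L) p := by
    rw [A.mem_tangentSubmodule_iff hL hp hx, hv, hG.2, Prod.mk_eq_zero]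
    exact ⟨sub_self _, sub_self _⟩
  have hπ := dirDeriv_pcoord_fst A.anchor hx hx' v
  rw [hv] at hπ
  -- The difference is vertical, and vertical vectors lie in the image of the anchor.
  obtain ⟨b, hb⟩ := Prol.exists_coord_eq A (w := p.proj) hx hx' (0, (dirDeriv (I.prod 𝓘(ℝ, F →L[ℝ] ℝ))
    (tcoord I (F →L[ℝ] ℝ) (DualFiber V) p.proj.proj) p.proj t).2 -
      fderiv ℝ (momentum I L p.proj.proj) z (y, 0))
  have hb' := Prol.dirDeriv_tcoord_snd hx hx' b
  rw [hb, map_zero] at hb'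
  rw [Submodule.mem_sup]
  refine ⟨b.snd, ⟨b, rfl⟩, _, ⟨v, hv', rfl⟩, ?_⟩
  refine hκ.dirDeriv_inj.1 ?_
  refine (dirDeriv_add _ _ _ _).trans ?_
  refine (congrArg₂ (· + ·) hb' hπ.symm).trans ?_
  refine Prod.ext ?_ ?_
  · exact zero_add _
  · exact sub_add_cancel _ _

theorem isLagrangianSubmanifold_lagrangianSet (hL : ContMDiff (I.prod 𝓘(ℝ, F)) 𝓘(ℝ, ℝ) ∞ L) :
    (A.prol (F →L[ℝ] ℝ) (DualFiber V)).IsLagrangianSubmanifold (F := F × (F →L[ℝ] ℝ))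
      A.canonicalTwo (A.lagrangianSet L) := by
  refine ⟨A.isEmbeddedSubmanifold_lagrangianSet hL, ⟨Module.finrank ℝ (EB × (F →L[ℝ] ℝ)),
    fun p hp => ?_⟩, fun p hp u => A.snd_mem_tangentSubmodule_iff_orthogonal hL hp u⟩
  refine (congrArg (fun S : Submodule ℝ (TangentSpace (I.prod 𝓘(ℝ, F →L[ℝ] ℝ)) p.proj) =>
    Module.finrank ℝ S) (A.range_anchor_sup_tangent hL hp)).trans ?_
  exact finrank_top ℝ (EB × (F →L[ℝ] ℝ))

end LieAlgebroid
end lagrangian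

/-! ### The section of `S_L` over `E` -/

section velocity
variable {EB : Type*} [NormedAddCommGroup EB] [NormedSpace ℝ EB] [FiniteDimensional ℝ EB]
  {H : Type*} [TopologicalSpace H]
  {I : ModelWithCorners ℝ EB H} [I.Boundaryless] {B : Type*} [TopologicalSpace B] [T2Space B]
  [ChartedSpace H B] [IsManifold I ∞ B]
  {F : Type*} [NormedAddCommGroup F] [NormedSpace ℝ F] [FiniteDimensional ℝ F] {V : B → Type*}
  [TopologicalSpace (TotalSpace F V)] [∀ x, AddCommGroup (V x)] [∀ x, Module ℝ (V x)]
  [∀ x, TopologicalSpace (V x)] [FiberBundle F V] [VectorBundle ℝ F V]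
  [ContMDiffVectorBundle ∞ F V I]
  {FW : Type*} [NormedAddCommGroup FW] [NormedSpace ℝ FW] {W : B → Type*}
  [TopologicalSpace (TotalSpace FW W)] [∀ x, AddCommGroup (W x)] [∀ x, Module ℝ (W x)]
  [∀ x, TopologicalSpace (W x)] [FiberBundle FW W] [VectorBundle ℝ FW W]
  [ContMDiffVectorBundle ∞ FW W I]

/-- The projection `(b, v) ↦ b` of a prolongation of `V` to `V`. -/
def Prol.toBundle {ρ : Cₛ^∞⟮I; F →L[ℝ] EB, fun x => V x →L[ℝ] TangentSpace I x⟯}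
    (p : TotalSpace (F × FW) (Prol FW W ρ)) : TotalSpace F V := ⟨p.proj.proj, p.2.fst⟩

theorem Prol.contMDiff_toBundle (ρ : Cₛ^∞⟮I; F →L[ℝ] EB, fun x => V x →L[ℝ] TangentSpace I x⟯) :
    ContMDiff ((I.prod 𝓘(ℝ, FW)).prod 𝓘(ℝ, F × FW)) (I.prod 𝓘(ℝ, F)) ∞
      (Prol.toBundle : TotalSpace (F × FW) (Prol FW W ρ) → TotalSpace F V) := by
  intro p
  rw [contMDiffAt_totalSpace]
  refine ⟨((contMDiff_proj W (n := ∞) (IB := I)).comp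
    (contMDiff_proj (Prol FW W ρ) (n := ∞) (IB := I.prod 𝓘(ℝ, FW)))) p, ?_⟩
  have h := (isCoordAt_pcoord ρ (mem_coordDomain_self H F V p.proj.proj)
    (mem_coordDomain_self H FW W p.proj.proj)).contMDiffAt
  have h2 : ContDiff ℝ ∞ (fun k : (EB × FW) × (F × FW) => k.2.1) := by fun_prop
  exact h2.contDiffAt.contMDiffAt.comp p h

theorem tcoord_inj {x₀ : B} {w w' : TotalSpace FW W} (h : w.proj ∈ coordDomain H FW W x₀)
    (h' : w'.proj ∈ coordDomain H FW W x₀) (e : tcoord I FW W x₀ w = tcoord I FW W x₀ w') :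
    w = w' := by
  have h1 : w.proj = w'.proj := (extChartAt I x₀).injOn (by simpa using h.2) (by simpa using h'.2)
    (congrArg Prod.fst e)
  obtain ⟨y, b⟩ := w
  obtain ⟨y', b'⟩ := w'
  obtain rfl : y = y' := h1
  have h2 : fcoord FW x₀ b = fcoord FW x₀ b' := by
    have h3 := congrArg Prod.snd e
    exact h3
  obtain rfl := (fcoord_inj h.1).1 h2
  rfl

theorem pcoord_inj {A : LieAlgebroid I F V} {x₀ : B} {p q : TotalSpace (F × FW) (Prol FW W A.anchor)}
    (hV : p.proj.proj ∈ coordDomain H F V x₀) (hW : p.proj.proj ∈ coordDomain H FW W x₀)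
    (hW' : q.proj.proj ∈ coordDomain H FW W x₀) (e : pcoord A.anchor x₀ p = pcoord A.anchor x₀ q) :
    p = q := by
  have h1 := tcoord_inj hW hW' (congrArg Prod.fst e)
  obtain ⟨w, u⟩ := p
  obtain ⟨w', u'⟩ := q
  obtain rfl : w = w' := h1
  have h2 : u = u' := (Prol.coord_inj hV hW).1 (by
    have h3 := congrArg Prod.snd e
    exact h3)
  rw [h2]

namespace LieAlgebroid
variable (A : LieAlgebroid I F V) {L : TotalSpace F V → ℝ} {x₀ : B}

theorem tulczyjew_eq_dLagrangian_iff
    {p : TotalSpace (F × (F →L[ℝ] ℝ)) (Prol (F →L[ℝ] ℝ) (DualFiber V) A.anchor)}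
    {a : TotalSpace F V} :
    A.tulczyjew p = A.dLagrangian L a ↔ p ∈ A.lagrangianSet L ∧ Prol.toBundle p = a := by
  constructor
  · intro h
    exact ⟨⟨a, h.symm⟩, congrArg Sigma.fst h⟩
  · rintro ⟨h, rfl⟩
    exact A.mem_lagrangianSet_iff.1 h

theorem pcoord_of_mem_lagrangianSet (hL : ContMDiff (I.prod 𝓘(ℝ, F)) 𝓘(ℝ, ℝ) ∞ L)
    {p : TotalSpace (F × (F →L[ℝ] ℝ)) (Prol (F →L[ℝ] ℝ) (DualFiber V) A.anchor)}
    (hp : p ∈ A.lagrangianSet L) (hx : p.proj.proj ∈ coordDomain H F V x₀) :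
    pcoord A.anchor x₀ p =
      (((tcoord I F V x₀ (Prol.toBundle p)).1, momentum I L x₀ (tcoord I F V x₀ (Prol.toBundle p))),
        ((tcoord I F V x₀ (Prol.toBundle p)).2, A.force L x₀ (tcoord I F V x₀ (Prol.toBundle p)))) := by
  obtain ⟨h1, h2⟩ := (A.mem_lagrangianSet_iff_coord hL hx).1 hp
  exact Prod.ext (Prod.ext rfl h1) (Prod.ext rfl h2)

/-- `A_E` restricts to a bijection of `S_L` onto the image of `dL`, which is parametrized by `E`. -/
theorem existsUnique_mem_lagrangianSet (hL : ContMDiff (I.prod 𝓘(ℝ, F)) 𝓘(ℝ, ℝ) ∞ L)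
    (a : TotalSpace F V) : ∃! p, p ∈ A.lagrangianSet L ∧ Prol.toBundle p = a := by
  have hx := mem_coordDomain_self H F V a.proj
  have hx' := mem_coordDomain_self H (F →L[ℝ] ℝ) (DualFiber V) a.proj
  refine existsUnique_of_exists_of_unique ?_ ?_
  · let w : TotalSpace (F →L[ℝ] ℝ) (DualFiber V) := ⟨a.proj, constSec (F →L[ℝ] ℝ) (DualFiber V) a.proj
      (momentum I L a.proj (tcoord I F V a.proj a)) a.proj⟩
    obtain ⟨u, hu⟩ := Prol.exists_coord_eq A (w := w) hx hx'
      (fcoord F a.proj a.2, A.force L a.proj (tcoord I F V a.proj a))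
    refine ⟨⟨w, u⟩, ?_, ?_⟩
    · refine (A.mem_lagrangianSet_iff_coord hL (p := ⟨w, u⟩) hx).2 ⟨?_, ?_⟩
      · change fcoord (F →L[ℝ] ℝ) (V := DualFiber V) a.proj (constSec (F →L[ℝ] ℝ) (DualFiber V) a.proj
          _ a.proj) = momentum I L a.proj (extChartAt I a.proj a.proj, (Prol.coord a.proj u).1)
        rw [fcoord_constSec hx'.1, hu]
        rfl
      · change (Prol.coord a.proj u).2 =
          A.force L a.proj (extChartAt I a.proj a.proj, (Prol.coord a.proj u).1)
        rw [hu]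
        rfl
    · have h1 : u.fst = a.2 := (fcoord_inj hx.1).1 (congrArg Prod.fst hu)
      change TotalSpace.mk' F a.proj u.fst = a
      rw [h1]
  · rintro p q ⟨hp, hpa⟩ ⟨hq, hqa⟩
    have e1 : p.proj.proj = a.proj := congrArg TotalSpace.proj hpa
    have e2 : q.proj.proj = a.proj := congrArg TotalSpace.proj hqa
    refine pcoord_inj (A := A) (x₀ := a.proj) (by rwa [e1]) (by rwa [e1]) (by rwa [e2]) ?_
    rw [A.pcoord_of_mem_lagrangianSet hL hp (by rwa [e1]),
      A.pcoord_of_mem_lagrangianSet hL hq (by rwa [e2]), hpa, hqa]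

/-- A map to `S_L` is smooth if its projection to `E` is. -/
theorem contMDiff_of_toBundle (hL : ContMDiff (I.prod 𝓘(ℝ, F)) 𝓘(ℝ, ℝ) ∞ L)
    {E' : Type*} [NormedAddCommGroup E'] [NormedSpace ℝ E'] {K : Type*} [TopologicalSpace K]
    {J : ModelWithCorners ℝ E' K} {N : Type*} [TopologicalSpace N] [ChartedSpace K N]
    {γ : N → TotalSpace (F × (F →L[ℝ] ℝ)) (Prol (F →L[ℝ] ℝ) (DualFiber V) A.anchor)}
    (hγ : ∀ t, γ t ∈ A.lagrangianSet L)
    (h : ContMDiff J (I.prod 𝓘(ℝ, F)) ∞ (fun t => Prol.toBundle (γ t))) :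
    ContMDiff J ((I.prod 𝓘(ℝ, F →L[ℝ] ℝ)).prod 𝓘(ℝ, F × (F →L[ℝ] ℝ))) ∞ γ := by
  intro t
  have hx := mem_coordDomain_self H F V (γ t).proj.proj
  have hx' := mem_coordDomain_self H (F →L[ℝ] ℝ) (DualFiber V) (γ t).proj.proj
  set x₀ := (γ t).proj.proj with hx₀
  have hκ : ContMDiffAt J 𝓘(ℝ, EB × F) ∞ (fun s => tcoord I F V x₀ (Prol.toBundle (γ s))) t :=
    (isCoordAt_tcoord (I := I) (w := Prol.toBundle (γ t)) hx).contMDiffAt.comp t (h t)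
  have hπ : ContMDiffAt J I ∞ (fun s => (γ s).proj.proj) t :=
    (contMDiff_proj V (n := ∞) (IB := I)).contMDiffAt.comp t (h t)
  have hev : ∀ᶠ s in 𝓝 t, (γ s).proj.proj ∈ coordDomain H F V x₀ :=
    hπ.continuousAt.eventually ((isOpen_coordDomain H F V x₀).mem_nhds hx)
  have hP : ContMDiffAt J 𝓘(ℝ, F →L[ℝ] ℝ) ∞
      (fun s => momentum I L x₀ (tcoord I F V x₀ (Prol.toBundle (γ s)))) t :=
    (contDiffAt_momentum hL (a := Prol.toBundle (γ t)) hx).contMDiffAt.comp t hκ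
  have hQ : ContMDiffAt J 𝓘(ℝ, F →L[ℝ] ℝ) ∞
      (fun s => A.force L x₀ (tcoord I F V x₀ (Prol.toBundle (γ s)))) t :=
    (A.contDiffAt_force hL (a := Prol.toBundle (γ t)) hx).contMDiffAt.comp t hκ
  have hβ : ContMDiffAt J 𝓘(ℝ, F) ∞ (fun s => (tcoord I F V x₀ (Prol.toBundle (γ s))).2) t :=
    contDiff_snd.contDiffAt.contMDiffAt.comp t hκ
  rw [contMDiffAt_totalSpace, contMDiffAt_totalSpace]
  refine ⟨⟨hπ, hP.congr_of_eventuallyEq ?_⟩, (hβ.prodMk_space hQ).congr_of_eventuallyEq ?_⟩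
  · filter_upwards [hev] with s hs
    exact congrArg (fun k => k.1.2) (A.pcoord_of_mem_lagrangianSet hL (hγ s) hs)
  · filter_upwards [hev] with s hs
    have h1 := congrArg Prod.snd (A.pcoord_of_mem_lagrangianSet hL (hγ s) hs)
    exact (Prol.fcoord_eq_coord hs (by rwa [coordDomain_dual]) (γ t).proj rfl (γ s).2).trans h1

/-- The bijection between the curves in `S_L` and the curves in `E`. -/
noncomputable def curveEquiv (hL : ContMDiff (I.prod 𝓘(ℝ, F)) 𝓘(ℝ, ℝ) ∞ L)
    (J : TopologicalSpace.Opens ℝ) :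
    {γ : C^∞⟮𝓘(ℝ, ℝ), J; (I.prod 𝓘(ℝ, F →L[ℝ] ℝ)).prod 𝓘(ℝ, F × (F →L[ℝ] ℝ)),
        TotalSpace (F × (F →L[ℝ] ℝ)) (Prol (F →L[ℝ] ℝ) (DualFiber V) A.anchor)⟯ //
          ∀ t, γ t ∈ A.lagrangianSet L} ≃
      C^∞⟮𝓘(ℝ, ℝ), J; I.prod 𝓘(ℝ, F), TotalSpace F V⟯ where
  toFun γ := ⟨fun t => Prol.toBundle (γ.1 t), (Prol.contMDiff_toBundle A.anchor).comp γ.1.contMDiff⟩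
  invFun c := ⟨⟨fun t => (A.existsUnique_mem_lagrangianSet hL (c t)).choose,
      A.contMDiff_of_toBundle hL
        (fun t => (A.existsUnique_mem_lagrangianSet hL (c t)).choose_spec.1.1)
        (c.contMDiff.congr fun t =>
          (A.existsUnique_mem_lagrangianSet hL (c t)).choose_spec.1.2)⟩,
    fun t => (A.existsUnique_mem_lagrangianSet hL (c t)).choose_spec.1.1⟩
  left_inv γ := Subtype.ext (ContMDiffMap.ext fun t =>
    ((A.existsUnique_mem_lagrangianSet hL (Prol.toBundle (γ.1 t))).choose_spec.2 (γ.1 t)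
      ⟨γ.2 t, rfl⟩).symm)
  right_inv c := ContMDiffMap.ext fun t =>
    (A.existsUnique_mem_lagrangianSet hL (c t)).choose_spec.1.2

end LieAlgebroid
end velocity

/-! ### The Euler-Lagrange equations -/

section eulerLagrange
variable {EB : Type*} [NormedAddCommGroup EB] [NormedSpace ℝ EB] [FiniteDimensional ℝ EB]
  {H : Type*} [TopologicalSpace H]
  {I : ModelWithCorners ℝ EB H} [I.Boundaryless] {B : Type*} [TopologicalSpace B] [T2Space B]
  [ChartedSpace H B] [IsManifold I ∞ B]
  {F : Type*} [NormedAddCommGroup F] [NormedSpace ℝ F] [FiniteDimensional ℝ F] {V : B → Type*}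
  [TopologicalSpace (TotalSpace F V)] [∀ x, AddCommGroup (V x)] [∀ x, Module ℝ (V x)]
  [∀ x, TopologicalSpace (V x)] [FiberBundle F V] [VectorBundle ℝ F V]
  [ContMDiffVectorBundle ∞ F V I]

namespace LieAlgebroid
variable (A : LieAlgebroid I F V) {L : TotalSpace F V → ℝ}

theorem cartanOne_eq (hL : ContMDiff (I.prod 𝓘(ℝ, F)) 𝓘(ℝ, ℝ) ∞ L) {x₀ : B} {a : TotalSpace F V}
    (ha : a.proj ∈ coordDomain H F V x₀) (u : Prol F V A.anchor a) :
    A.cartanOne L a u = momentum I L x₀ (tcoord I F V x₀ a) (Prol.coord x₀ u).1 := by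
  change dirDeriv (I.prod 𝓘(ℝ, F)) L a (vlift a u.fst) = _
  rw [dirDeriv_lagrangian hL ha, dirDeriv_tcoord_vlift ha]
  rfl

theorem energy_eq (hL : ContMDiff (I.prod 𝓘(ℝ, F)) 𝓘(ℝ, ℝ) ∞ L) {x₀ : B} {a : TotalSpace F V}
    (ha : a.proj ∈ coordDomain H F V x₀) :
    A.energy L a = momentum I L x₀ (tcoord I F V x₀ a) (tcoord I F V x₀ a).2 -
      coordLagrangian I L x₀ (tcoord I F V x₀ a) := by
  change dirDeriv (I.prod 𝓘(ℝ, F)) L a (vlift a a.2) - L a = _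
  rw [dirDeriv_lagrangian hL ha, dirDeriv_tcoord_vlift ha,
    (eventually_coordLagrangian (I := I) L ha).self_of_nhds]
  rfl

/-- The Cartan 2-section in the preferred coordinates around the point. -/
theorem cartanTwo_eq (hL : ContMDiff (I.prod 𝓘(ℝ, F)) 𝓘(ℝ, ℝ) ∞ L) {a : TotalSpace F V}
    (u u' : Prol F V A.anchor a) :
    A.cartanTwo L a u u' =
      fderiv ℝ (momentum I L a.proj) (tcoord I F V a.proj a)
        (dirDeriv (I.prod 𝓘(ℝ, F)) (tcoord I F V a.proj) a u'.snd) (Prol.coord a.proj u).1 -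
      fderiv ℝ (momentum I L a.proj) (tcoord I F V a.proj a)
        (dirDeriv (I.prod 𝓘(ℝ, F)) (tcoord I F V a.proj) a u.snd) (Prol.coord a.proj u').1 +
      momentum I L a.proj (tcoord I F V a.proj a)
        (A.structFun a.proj (extChartAt I a.proj a.proj) (Prol.coord a.proj u).1
          (Prol.coord a.proj u').1) := by
  have hx := mem_coordDomain_self H F V a.proj
  have hP := ((contDiffAt_momentum hL hx).differentiableAt (by simp)).hasFDerivAt
  have hm := hP.clm_comp (hasFDerivAt_const (ContinuousLinearMap.fst ℝ F F) (tcoord I F V a.proj a))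
  have h1 := A.prol_d1 (μ := A.cartanOne L)
    (m := fun z => (momentum I L a.proj z).comp (ContinuousLinearMap.fst ℝ F F)) ?_
    hm.differentiableAt u u'
  · unfold cartanTwo
    rw [h1, hm.fderiv]
    simp
    ring
  · filter_upwards [eventually_mem_coordDomain hx] with y hy b
    exact A.cartanOne_eq hL hy b

/-- The differential of the energy in coordinates. -/
theorem prol_d0_energy (hL : ContMDiff (I.prod 𝓘(ℝ, F)) 𝓘(ℝ, ℝ) ∞ L) {x₀ : B} {a : TotalSpace F V}
    (hx : a.proj ∈ coordDomain H F V x₀) (u : Prol F V A.anchor a) :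
    (A.prol F V).d0 (A.energy L) a u =
      fderiv ℝ (momentum I L x₀) (tcoord I F V x₀ a)
        (dirDeriv (I.prod 𝓘(ℝ, F)) (tcoord I F V x₀) a u.snd) (tcoord I F V x₀ a).2 -
      fderiv ℝ (coordLagrangian I L x₀) (tcoord I F V x₀ a)
        (A.anchorFun x₀ (extChartAt I x₀ a.proj) (Prol.coord x₀ u).1, 0) := by
  have hP := ((contDiffAt_momentum hL hx).differentiableAt (by simp)).hasFDerivAt
  have hl := ((contDiffAt_coordLagrangian hL hx).differentiableAt (by simp)).hasFDerivAt
  have h1 := (hP.clm_apply hasFDerivAt_snd).fun_sub hl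
  rw [prol_d0, (isCoordAt_tcoord hx).dirDeriv_eq (g := fun z => momentum I L x₀ z z.2 -
    coordLagrangian I L x₀ z) ?_ h1.differentiableAt, h1.fderiv]
  · have h2 := Prol.dirDeriv_tcoord_snd hx hx u
    have h3 : ∀ y z, fderiv ℝ (coordLagrangian I L x₀) (tcoord I F V x₀ a) (y, z) =
        fderiv ℝ (coordLagrangian I L x₀) (tcoord I F V x₀ a) (y, 0) +
        momentum I L x₀ (tcoord I F V x₀ a) z := fun y z => by
      rw [momentum_apply, ← map_add]; simp
    simp only [sub_apply, add_apply, ContinuousLinearMap.comp_apply, ContinuousLinearMap.flip_apply]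
    rw [h2, h3]
    simp
    ring
  · filter_upwards [eventually_mem_coordDomain hx] with y hy
    exact A.energy_eq hL hy

/-- The Euler-Lagrange equations at a point, in the preferred coordinates: `x' = ρ(β)` and
`(∂ℓ/∂β)' = ∂ℓ/∂x ∘ ρ + ∂ℓ/∂β ∘ C(β, ·)`. -/
theorem eulerLagrange_iff (hL : ContMDiff (I.prod 𝓘(ℝ, F)) 𝓘(ℝ, ℝ) ∞ L) (a : TotalSpace F V)
    (v : TangentSpace (I.prod 𝓘(ℝ, F)) a) :
    (∃ h : A.anchor a.proj a.2 = mfderiv (I.prod 𝓘(ℝ, F)) I (π F V) a v,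
      ∀ u : Prol F V A.anchor a, A.cartanTwo L a (Prol.mk a.2 v h) u =
        (A.prol F V).d0 (A.energy L) a u) ↔
    (dirDeriv (I.prod 𝓘(ℝ, F)) (tcoord I F V a.proj) a v).1 =
        A.anchorFun a.proj (tcoord I F V a.proj a).1 (tcoord I F V a.proj a).2 ∧
      fderiv ℝ (momentum I L a.proj) (tcoord I F V a.proj a)
        (dirDeriv (I.prod 𝓘(ℝ, F)) (tcoord I F V a.proj) a v) =
          A.force L a.proj (tcoord I F V a.proj a) := by
  have hx := mem_coordDomain_self H F V a.proj
  have h1 : A.anchor a.proj a.2 = mfderiv (I.prod 𝓘(ℝ, F)) I (π F V) a v ↔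
      (dirDeriv (I.prod 𝓘(ℝ, F)) (tcoord I F V a.proj) a v).1 =
        A.anchorFun a.proj (tcoord I F V a.proj a).1 (tcoord I F V a.proj a).2 := by
    rw [← (isCoordAt_extChartAt (J := I) hx.2).dirDeriv_inj, ← dirDeriv_tcoord_fst hx,
      A.dirDeriv_anchor hx, eq_comm]
    rfl
  have h2 : ∀ h u, A.cartanTwo L a (Prol.mk a.2 v h) u = (A.prol F V).d0 (A.energy L) a u ↔
      fderiv ℝ (momentum I L a.proj) (tcoord I F V a.proj a)
        (dirDeriv (I.prod 𝓘(ℝ, F)) (tcoord I F V a.proj) a v) (Prol.coord a.proj u).1 =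
          A.force L a.proj (tcoord I F V a.proj a) (Prol.coord a.proj u).1 := by
    intro h u
    have h3 : ∀ y z, fderiv ℝ (coordLagrangian I L a.proj) (tcoord I F V a.proj a) (y, z) =
        fderiv ℝ (coordLagrangian I L a.proj) (tcoord I F V a.proj a) (y, 0) +
        momentum I L a.proj (tcoord I F V a.proj a) z := fun y z => by
      rw [momentum_apply, ← map_add]; simp
    have h4 : (Prol.coord a.proj (Prol.mk (ρ := A.anchor) a.2 v h)).1 = (tcoord I F V a.proj a).2 := rfl
    have h5 : (Prol.mk (ρ := A.anchor) a.2 v h).snd = v := rfl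
    rw [A.cartanTwo_eq hL, A.prol_d0_energy hL hx, h4, h5, force_apply,
      h3 _ (A.structFun a.proj _ _ _)]
    change _ - _ + momentum I L a.proj _ (A.structFun a.proj (extChartAt I a.proj a.proj) _ _) =
      _ - _ ↔ _ = _ + momentum I L a.proj _ (A.structFun a.proj (extChartAt I a.proj a.proj) _ _)
    change _ ↔ _ = fderiv ℝ (coordLagrangian I L a.proj) _
      (A.anchorFun a.proj (extChartAt I a.proj a.proj) _, 0) + _
    constructor <;> intro h6 <;> linarith
  constructor
  · rintro ⟨h, hu⟩
    refine ⟨h1.1 h, ContinuousLinearMap.ext fun b => ?_⟩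
    obtain ⟨u, hb⟩ := Prol.exists_coord_eq A (w := a) hx hx (b, 0)
    have h3 := (h2 h u).1 (hu u)
    rwa [hb] at h3
  · rintro ⟨h, hu⟩
    exact ⟨h1.2 h, fun u => (h2 _ u).2 (by rw [hu])⟩

/-- A curve in `S_L` is admissible if and only if its projection to `E` is a solution of the
Euler-Lagrange equations. -/
theorem isAdmissible_iff (hL : ContMDiff (I.prod 𝓘(ℝ, F)) 𝓘(ℝ, ℝ) ∞ L)
    {J : TopologicalSpace.Opens ℝ}
    {γ : J → TotalSpace (F × (F →L[ℝ] ℝ)) (Prol (F →L[ℝ] ℝ) (DualFiber V) A.anchor)}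
    (hγ : ContMDiff 𝓘(ℝ, ℝ) ((I.prod 𝓘(ℝ, F →L[ℝ] ℝ)).prod 𝓘(ℝ, F × (F →L[ℝ] ℝ))) ∞ γ)
    (hS : ∀ t, γ t ∈ A.lagrangianSet L) :
    A.IsAdmissible γ ↔ A.IsELSolution L (fun t => Prol.toBundle (γ t)) := by
  refine forall_congr' fun t => ?_
  rw [A.eulerLagrange_iff hL (Prol.toBundle (γ t))]
  have hx := mem_coordDomain_self H F V (γ t).proj.proj
  have hx' := mem_coordDomain_self H (F →L[ℝ] ℝ) (DualFiber V) (γ t).proj.proj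
  have hc := ((Prol.contMDiff_toBundle A.anchor).comp hγ).mdifferentiableAt (x := t) (by simp)
  have hπ : MDifferentiableAt 𝓘(ℝ, ℝ) (I.prod 𝓘(ℝ, F →L[ℝ] ℝ)) (fun s => (γ s).proj) t :=
    ((contMDiff_proj (Prol (F →L[ℝ] ℝ) (DualFiber V) A.anchor) (n := ∞)
      (IB := I.prod 𝓘(ℝ, F →L[ℝ] ℝ))).comp hγ).mdifferentiableAt (by simp)
  have k1 := isCoordAt_tcoord (I := I) (w := Prol.toBundle (γ t)) hx
  have k2 := isCoordAt_tcoord (I := I) hx'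
  set x₀ := (γ t).proj.proj with hx₀
  have hev : ∀ᶠ s in 𝓝 t, (γ s).proj.proj ∈ coordDomain H F V x₀ :=
    hπ.continuousAt.eventually (eventually_mem_coordDomain hx)
  have hP := (contDiffAt_momentum hL (a := Prol.toBundle (γ t)) hx).differentiableAt (by simp)
  have hg := (hasFDerivAt_fst (𝕜 := ℝ) (p := tcoord I F V x₀ (Prol.toBundle (γ t)))).prodMk
    hP.hasFDerivAt
  -- The velocity of `γ` in the dual bundle, in coordinates.
  have h1 := dirDeriv_mfderiv (c := fun s => Prol.toBundle (γ s)) k1.mdifferentiableAt hc (1 : ℝ)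
  have h2 := (dirDeriv_mfderiv (c := fun s => (γ s).proj) k2.mdifferentiableAt hπ (1 : ℝ)).trans
    (dirDeriv_comp_of_differentiableAt
      (κ := fun s => tcoord I F V x₀ (Prol.toBundle (γ s))) (k1.mdifferentiableAt.comp t hc)
      (g := fun z => (z.1, momentum I L x₀ z)) (by
        filter_upwards [hev] with s hs
        exact congrArg Prod.fst (A.pcoord_of_mem_lagrangianSet hL (hS s) hs))
      hg.differentiableAt (1 : ℝ))
  have h3 := Prol.dirDeriv_tcoord_snd hx hx' (γ t).2
  have h4 := A.pcoord_of_mem_lagrangianSet hL (hS t) hx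
  have h5 : (Prol.coord x₀ (γ t).2).1 = (tcoord I F V x₀ (Prol.toBundle (γ t))).2 :=
    congrArg (fun k => k.2.1) h4
  have h6 : (Prol.coord x₀ (γ t).2).2 = A.force L x₀ (tcoord I F V x₀ (Prol.toBundle (γ t))) :=
    congrArg (fun k => k.2.2) h4
  rw [h5, h6] at h3
  rw [hg.fderiv] at h2
  rw [← k2.dirDeriv_inj]
  refine Iff.trans (b := (A.anchorFun x₀ (extChartAt I x₀ (γ t).proj.proj)
    (tcoord I F V x₀ (Prol.toBundle (γ t))).2, A.force L x₀ (tcoord I F V x₀ (Prol.toBundle (γ t)))) =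
      ((ContinuousLinearMap.fst ℝ EB F).prod (fderiv ℝ (momentum I L x₀)
        (tcoord I F V x₀ (Prol.toBundle (γ t)))) (dirDeriv 𝓘(ℝ, ℝ)
          (fun s => tcoord I F V x₀ (Prol.toBundle (γ s))) t (1 : ℝ)))) ?_ ?_
  · exact ⟨fun h => h3.symm.trans (h.trans h2), fun h => h3.trans (h.trans h2.symm)⟩
  · rw [Prod.ext_iff, eq_comm, @eq_comm _ (A.force L x₀ _), ← h1]
    rfl

end LieAlgebroid
end eulerLagrange

theorem mainTheorem1 {EB : Type*} [NormedAddCommGroup EB] [NormedSpace ℝ EB]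
    [FiniteDimensional ℝ EB] {H : Type*} [TopologicalSpace H] (I : ModelWithCorners ℝ EB H)
    [I.Boundaryless] {B : Type*} [TopologicalSpace B] [T2Space B] [ChartedSpace H B]
    [IsManifold I ∞ B] (F : Type*) [NormedAddCommGroup F] [NormedSpace ℝ F]
    [FiniteDimensional ℝ F] (V : B → Type*) [TopologicalSpace (TotalSpace F V)]
    [∀ x, AddCommGroup (V x)] [∀ x, Module ℝ (V x)] [∀ x, TopologicalSpace (V x)]
    [FiberBundle F V] [VectorBundle ℝ F V] [ContMDiffVectorBundle ∞ F V I]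
    (A : LieAlgebroid I F V) (L : TotalSpace F V → ℝ)
    (hL : ContMDiff (I.prod 𝓘(ℝ, F)) 𝓘(ℝ, ℝ) ∞ L) :
    (A.prol (F →L[ℝ] ℝ) (DualFiber V)).IsLagrangianSubmanifold (F := F × (F →L[ℝ] ℝ))
        A.canonicalTwo (A.lagrangianSet L) ∧
      ∀ J : TopologicalSpace.Opens ℝ, (J : Set ℝ).OrdConnected →
        ∃ Ψ : {γ : C^∞⟮𝓘(ℝ, ℝ), J; (I.prod 𝓘(ℝ, F →L[ℝ] ℝ)).prod 𝓘(ℝ, F × (F →L[ℝ] ℝ)),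
              TotalSpace (F × (F →L[ℝ] ℝ)) (Prol (F →L[ℝ] ℝ) (DualFiber V) A.anchor)⟯ //
                ∀ t, γ t ∈ A.lagrangianSet L} ≃
            C^∞⟮𝓘(ℝ, ℝ), J; I.prod 𝓘(ℝ, F), TotalSpace F V⟯,
          (∀ γ t, A.tulczyjew (γ.1 t) = A.dLagrangian L (Ψ γ t)) ∧
          ∀ γ, A.IsAdmissible γ.1 ↔ A.IsELSolution L (Ψ γ) := by
  refine ⟨A.isLagrangianSubmanifold_lagrangianSet hL, fun J _ => ⟨A.curveEquiv hL J,
    fun γ t => A.tulczyjew_eq_dLagrangian_iff.2 ⟨γ.2 t, rfl⟩,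
    fun γ => A.isAdmissible_iff hL γ.1.contMDiff γ.2⟩⟩
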